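/- Let $k$ be an integer, let $\mathcal H$ be the upper half-plane, $q=e^{2\pi i z}$, and $\theta(z)=\sum_{n\in\mathbb Z}q^{n^2}$. Let $S_{k+1/2}(4)$ be the space of cusp forms of weight $k+\tfrac12$ on $\Gamma_0(4)$, that is, of holomorphic functions $f:\mathcal H\to\mathbb C$ with $f(\gamma z)=\bigl(\theta(\gamma z)/\theta(z)\bigr)^{2k+1}f(z)$ for all $\gamma\in\Gamma_0(4)$ which vanish at all cusps. Complex powers are taken with the principal branch. Put $$(f|W_4)(z)=(-2iz)^{-k-1/2}f\!\left(-\tfrac1{4z}\right),\qquad S^{(\pm)}_{k+1/2}(4)=\{f\in S_{k+1/2}(4): f|W_4=\pm f\}.$$ A Hecke eigenform is a nonzero $f=\sum_{n\ge1}a(n)q^n\in S_{k+1/2}(4)$ that is an eigenfunction of the Hecke operators $T(p^2)$ for all odd primes $p$, where $$T(p^2)f=\sum_{n\ge1}\Bigl(a(p^2n)+\Bigl(\tfrac{(-1)^kn}{p}\Bigr)p^{k-1}a(n)+p^{2k-1}a(n/p^2)\Bigr)q^n$$ and $a(n/p^2)=0$ if $p^2\nmid n$. For $f=\sum_{n\ge1}a(n)q^n\in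 S_{k+1/2}(4)$ let $L^*(f,s)$ be the entire function of $s\in\mathbb C$ which for $\operatorname{Re}(s)$ sufficiently large equals $(2\pi)^{-s}\,2^s\,\Gamma(s)\sum_{n\ge1}a(n)n^{-s}$, with the series absolutely convergent. Theorem. Let $\sigma\in\mathbb R$ be fixed. (i) If $k\ge4$, then there is a Hecke eigenform $f\in S^{(+)}_{k+1/2}(4)$ with $L^*(f,\sigma)\ne0$. (ii) If $k\ge6$ and $\sigma\ne\frac k2+\frac14$, then there is a Hecke eigenform $f\in S^{(-)}_{k+1/2}(4)$ with $L^*(f,\sigma)\ne0$. -/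

import Mathlib

open UpperHalfPlane
open scoped Manifold MatrixGroups

noncomputable section

namespace HalfIntegral

/-- The theta function `θ(z) = ∑_{n ∈ ℤ} q^{n²}`, `q = e^{2πiz}`, on the upper half-plane.
Mathlib's `jacobiTheta τ` is `∑ e^{πi n² τ}`, so `θ(z) = jacobiTheta (2z)`. -/
def theta (z : ℍ) : ℂ := jacobiTheta (2 * (z : ℂ))

/-- The theta multiplier `j(γ, z) = θ(γz) / θ(z)` (used for `γ ∈ Γ₀(4)`). -/
def thetaMultiplier (γ : SL(2, ℤ)) (z : ℍ) : ℂ := theta (γ • z) / theta z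

/-- The expression `(cz + d)^{-(k+1/2)} f(γz)`, with the principal branch of the power.
It is used only to express vanishing at the cusps, where the branch is irrelevant. -/
def cuspTranslate (k : ℤ) (γ : SL(2, ℤ)) (f : ℍ → ℂ) (z : ℍ) : ℂ :=
  ((γ 1 0 : ℂ) * z + (γ 1 1 : ℂ)) ^ (-(k : ℂ) - 1 / 2) * f (γ • z)

/-- `f` is a cusp form of weight `k + 1/2` for `Γ₀(4)`: it is holomorphic on the upper half-plane,
satisfies `f(γz) = j(γ, z)^{2k+1} f(z)` for `γ ∈ Γ₀(4)`, and vanishes at every cusp. -/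
structure IsCuspForm (k : ℤ) (f : ℍ → ℂ) : Prop where
  holo : MDiff f
  transform : ∀ γ ∈ CongruenceSubgroup.Gamma0 4, ∀ z : ℍ,
    f (γ • z) = thetaMultiplier γ z ^ (2 * k + 1) * f z
  zero_at_cusps : ∀ γ : SL(2, ℤ), IsZeroAtImInfty (cuspTranslate k γ f)

/-- The space `S_{k+1/2}(4)` of cusp forms of weight `k + 1/2` for `Γ₀(4)`. -/
def cuspForms (k : ℤ) : Submodule ℂ (ℍ → ℂ) where
  carrier := {f | IsCuspForm k f}
  zero_mem' := by
    refine ⟨mdifferentiable_const, fun γ _ z => by simp, fun γ => ?_⟩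
    have h : cuspTranslate k γ 0 = 0 := by
      funext z; simp [cuspTranslate]
    rw [h]
    exact Filter.zero_zeroAtFilter _
  add_mem' := by
    intro f g hf hg
    refine ⟨hf.holo.add hg.holo, fun γ hγ z => ?_, fun γ => ?_⟩
    · simp only [Pi.add_apply]
      rw [hf.transform γ hγ z, hg.transform γ hγ z, mul_add]
    · have h : cuspTranslate k γ (f + g) = cuspTranslate k γ f + cuspTranslate k γ g := by
        funext z; simp [cuspTranslate, mul_add]
      rw [h]
      exact Filter.ZeroAtFilter.add (hf.zero_at_cusps γ) (hg.zero_at_cusps γ)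
  smul_mem' := by
    intro c f hf
    refine ⟨hf.holo.const_smul c, fun γ hγ z => ?_, fun γ => ?_⟩
    · simp only [Pi.smul_apply, smul_eq_mul]
      rw [hf.transform γ hγ z, mul_left_comm]
    · have h : cuspTranslate k γ (c • f) = c • cuspTranslate k γ f := by
        funext z; simp [cuspTranslate, mul_left_comm]
      rw [h]
      exact Filter.ZeroAtFilter.smul c (hf.zero_at_cusps γ)

lemma frickePoint_im_pos (z : ℍ) : 0 < (-1 / (4 * (z : ℂ))).im := by
  have h1 : (-1 / (4 * (z : ℂ))) = ((1 / 4 : ℝ) : ℂ) * (-(z : ℂ))⁻¹ := by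
    have := z.ne_zero
    push_cast
    field_simp
  rw [h1, Complex.im_ofReal_mul]
  exact mul_pos (by norm_num) z.im_inv_neg_coe_pos

/-- The point `-1/(4z)` of the upper half-plane. -/
def frickePoint (z : ℍ) : ℍ := ⟨-1 / (4 * (z : ℂ)), frickePoint_im_pos z⟩

/-- The Fricke involution in weight `k + 1/2`: `(f|W₄)(z) = (-2iz)^{-k-1/2} f(-1/(4z))`, with the
principal branch of the power. -/
def fricke (k : ℤ) : (ℍ → ℂ) →ₗ[ℂ] (ℍ → ℂ) where
  toFun f z := (-2 * Complex.I * (z : ℂ)) ^ (-(k : ℂ) - 1 / 2) * f (frickePoint z)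
  map_add' f g := by
    funext z
    simp [mul_add]
  map_smul' c f := by
    funext z
    simp [mul_left_comm]

/-- The plus space `S_{k+1/2}^{(+)}(4)` of cusp forms with `f|W₄ = f`. -/
def plusSpace (k : ℤ) : Submodule ℂ (ℍ → ℂ) :=
  cuspForms k ⊓ LinearMap.eqLocus (fricke k) LinearMap.id

/-- The minus space `S_{k+1/2}^{(-)}(4)` of cusp forms with `f|W₄ = -f`. -/
def minusSpace (k : ℤ) : Submodule ℂ (ℍ → ℂ) :=
  cuspForms k ⊓ LinearMap.eqLocus (fricke k) (-LinearMap.id)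

/-- The Fourier coefficient `a(n)` of `f(z) = ∑ a(n) qⁿ`, `q = e^{2πiz}`. -/
def fourierCoeff (f : ℍ → ℂ) (n : ℕ) : ℂ := (qExpansion 1 f).coeff n

/-- The `n`-th Fourier coefficient of `T(p²) f` for an odd prime `p` in weight `k + 1/2`:
`a(p²n) + ((-1)^k n / p) p^{k-1} a(n) + p^{2k-1} a(n/p²)`,
where `a(n/p²) = 0` unless `p² ∣ n`. -/
def heckeCoeff (k : ℤ) (p : ℕ) (f : ℍ → ℂ) (n : ℕ) : ℂ :=
  fourierCoeff f (p ^ 2 * n)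
    + (jacobiSym ((k.negOnePow : ℤ) * n) p : ℂ) * (p : ℂ) ^ (k - 1) * fourierCoeff f n
    + (p : ℂ) ^ (2 * k - 1) * (if p ^ 2 ∣ n then fourierCoeff f (n / p ^ 2) else 0)

/-- The Hecke operator `T(p²)` (`p` an odd prime) in weight `k + 1/2`, given by its action on
Fourier expansions. -/
def hecke (k : ℤ) (p : ℕ) (f : ℍ → ℂ) (z : ℍ) : ℂ :=
  ∑' n : ℕ, heckeCoeff k p f n * Complex.exp (2 * Real.pi * Complex.I * n * z)

/-- A Hecke eigenform of weight `k + 1/2` for `Γ₀(4)`: a nonzero cusp form that is an eigenfunction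
of all the `T(p²)`, `p` an odd prime. -/
structure IsHeckeEigenform (k : ℤ) (f : ℍ → ℂ) : Prop where
  mem : f ∈ cuspForms k
  ne_zero : f ≠ 0
  eigen : ∀ p : ℕ, p.Prime → p ≠ 2 → ∃ c : ℂ, hecke k p f = c • f

/-- `Λ` is the completed `L`-function `L*(f, ·)` of `f`: the entire function that for `Re s`
sufficiently large is `(2π)^{-s} 2^s Γ(s) L(f, s)`, with the absolutely convergent series
`L(f, s) = ∑_{n ≥ 1} a(n) n^{-s}`. -/
structure IsCompletedL (f : ℍ → ℂ) (Λ : ℂ → ℂ) : Prop where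
  entire : Differentiable ℂ Λ
  eq_of_large_re : ∃ C : ℝ, ∀ s : ℂ, C < s.re →
    LSeriesSummable (fourierCoeff f) s ∧
      Λ s = (2 * Real.pi : ℂ) ^ (-s) * 2 ^ s * Complex.Gamma s * LSeries (fourierCoeff f) s

/-- The completed `L`-function is determined by `f`. -/
theorem IsCompletedL.unique {f : ℍ → ℂ} {Λ₁ Λ₂ : ℂ → ℂ}
    (h₁ : IsCompletedL f Λ₁) (h₂ : IsCompletedL f Λ₂) : Λ₁ = Λ₂ := by
  obtain ⟨C₁, hC₁⟩ := h₁.eq_of_large_re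
  obtain ⟨C₂, hC₂⟩ := h₂.eq_of_large_re
  have hopen : IsOpen {s : ℂ | max C₁ C₂ < s.re} :=
    isOpen_lt continuous_const Complex.continuous_re
  have hmem : ((max C₁ C₂ + 1 : ℝ) : ℂ) ∈ {s : ℂ | max C₁ C₂ < s.re} := by
    simp only [Set.mem_ofPred_eq, Complex.ofReal_re]
    linarith
  refine AnalyticOnNhd.eq_of_eventuallyEq (z₀ := ((max C₁ C₂ + 1 : ℝ) : ℂ))
    (fun z _ => h₁.entire.analyticAt z) (fun z _ => h₂.entire.analyticAt z) ?_
  filter_upwards [hopen.mem_nhds hmem] with s hs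
  rw [(hC₁ s (lt_of_le_of_lt (le_max_left _ _) hs)).2,
    (hC₂ s (lt_of_le_of_lt (le_max_right _ _) hs)).2]

end HalfIntegral

end

/-! Each Fricke eigenspace `frickeSpace k ε` with ε = ±1 is finite dimensional. The operators T(p²),
p an odd prime, preserve it, commute on it and are symmetric for the Petersson product, so it is
spanned by Hecke eigenforms. For fixed s the map f ↦ L*(f, s) is a linear functional on this space.
A functional that is nonzero on one form is nonzero on some member of a spanning set
(`exists_joint_eigenvector`, `exists_eigenform`). Hence it suffices to exhibit, for each sign, one
form whose completed L-function does not vanish at σ.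

The test forms are monomials in theta constants at 2z (`thetaForm`): θ₂⁴θ₄⁴θ₃^{2k-7} for the sign +,
and θ₂⁴θ₄⁴(θ₄⁴ - θ₂⁴)θ₃^{2k-11} for the sign -. The Fricke involution fixes θ₃ and swaps θ₂ and θ₄,
which accounts for the signs. A positive power of θ₃ makes them cuspidal, whence k ≥ 4 and k ≥ 6. L*
is the Mellin transform of t ↦ f(it/2) (`isCompletedL_mellin`). The first form is positive on the
imaginary axis, so its transform is positive at every real σ. The second is positive for t > 1 and,
by the functional equation, nonpositive for t ≤ 1. If its transform vanished at σ it would also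
vanish at κ - σ, κ = k + 1/2. The difference of the two transforms, taken in the right order, has a
nonnegative integrand that is positive for t > 1 unless σ = κ/2.

Half-integral weight is handled by comparison with θ. The product (θ₂θ₃θ₄)⁸ is a multiple of Δ, so θ
has no zeros and f/θ^{2k+1} is invariant under Γ₀(4). The fourth power of f has integral weight,
which gives the bound |f| ≤ C y^{-κ/2} and, through a norm to level one, a Sturm bound. Γ₀(4) is
generated by -1, T and a conjugate of T⁻¹ by the Fricke involution. Modularity of `heckeSum`
therefore reduces to how these two maps permute its p² + p terms, the constants being quadratic
Gauss sums (`lift_quadSum`, `heckeTerm_neg_inv`).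

For symmetry, the Petersson integral of T(p²)f against g unfolds to an integral at level 4p² of the
single term p^{2k-1} f(p²z) times the conjugate of g(z). The involution z ↦ -1/(4p²z) exchanges f
and g there (`heckePet_levelFricke`). Integrals over fundamental domains are replaced by integrals
against weights whose translates sum to one (`IsWeight`). -/

noncomputable section

namespace HalfIntegral

open Filter Topology SlashInvariantForm
open scoped ModularForm

/-! ### The three theta constants -/

/-- The theta constant `θ₂(τ) = ∑ e^{πi (n + 1/2)² τ}`. -/
def theta2 (τ : ℂ) : ℂ := Complex.exp (Real.pi * Complex.I * τ / 4) * jacobiTheta₂ (τ / 2) τ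

/-- The theta constant `θ₄(τ) = ∑ (-1)ⁿ e^{πi n² τ}`. -/
def theta4 (τ : ℂ) : ℂ := jacobiTheta₂ (1 / 2) τ

lemma exp_pi_mul_even {m : ℤ} (hm : Even m) : Complex.exp (Real.pi * Complex.I * m) = 1 := by
  obtain ⟨r, rfl⟩ := hm
  rw [Complex.exp_eq_one_iff]
  exact ⟨r, by push_cast; ring⟩

/-- Since n² ≡ n mod 2, the factor e^{πi n²} equals (-1)ⁿ. -/
lemma jacobiTheta_add_one (τ : ℂ) : jacobiTheta (τ + 1) = theta4 τ := by
  rw [jacobiTheta_eq_jacobiTheta₂, theta4]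
  refine tsum_congr fun n => ?_
  simp only [jacobiTheta₂_term]
  have h : (2 * Real.pi * Complex.I * n * 0 + Real.pi * Complex.I * n ^ 2 * (τ + 1) : ℂ) =
    (2 * Real.pi * Complex.I * n * (1 / 2) + Real.pi * Complex.I * n ^ 2 * τ) +
      Real.pi * Complex.I * ((n ^ 2 - n : ℤ) : ℂ) := by push_cast; ring
  rw [h, Complex.exp_add, exp_pi_mul_even, mul_one]
  simpa [sq, mul_sub] using Int.even_mul_pred_self n

lemma theta4_add_one (τ : ℂ) : theta4 (τ + 1) = jacobiTheta τ := by
  rw [← jacobiTheta_add_one, add_assoc, add_comm, one_add_one_eq_two, jacobiTheta_two_add]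

/-- (n + 1/2)² = n(n + 1) + 1/4 with n(n + 1) even, so all terms acquire the same eighth root of
unity. -/
lemma theta2_add_one (τ : ℂ) :
    theta2 (τ + 1) = Complex.exp (Real.pi * Complex.I / 4) * theta2 τ := by
  have : jacobiTheta₂ ((τ + 1) / 2) (τ + 1) = jacobiTheta₂ (τ / 2) τ := by
    refine tsum_congr fun n => ?_
    simp only [jacobiTheta₂_term]
    have h : (2 * Real.pi * Complex.I * n * ((τ + 1) / 2) +
        Real.pi * Complex.I * n ^ 2 * (τ + 1) : ℂ) =
      (2 * Real.pi * Complex.I * n * (τ / 2) + Real.pi * Complex.I * n ^ 2 * τ) +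
        Real.pi * Complex.I * ((n ^ 2 + n : ℤ) : ℂ) := by push_cast; ring
    rw [h, Complex.exp_add, exp_pi_mul_even, mul_one]
    simpa [sq, mul_add] using Int.even_mul_succ_self n
  rw [theta2, theta2, this, ← mul_assoc, ← Complex.exp_add]
  congr 2
  ring

lemma neg_I_mul_cpow_half_ne_zero {τ : ℂ} (h : τ ≠ 0) : (-Complex.I * τ) ^ (1 / 2 : ℂ) ≠ 0 := by
  rw [Ne, Complex.cpow_eq_zero_iff, not_and_or]
  exact Or.inl (mul_ne_zero (neg_ne_zero.mpr Complex.I_ne_zero) h)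

lemma jacobiTheta_neg_inv {τ : ℂ} (h : τ ≠ 0) :
    jacobiTheta (-1 / τ) = (-Complex.I * τ) ^ (1 / 2 : ℂ) * jacobiTheta τ := by
  have h1 := neg_I_mul_cpow_half_ne_zero h
  rw [jacobiTheta_eq_jacobiTheta₂, jacobiTheta_eq_jacobiTheta₂,
    jacobiTheta₂_functional_equation 0 τ]
  simp only [zero_div, ne_eq, OfNat.ofNat_ne_zero, not_false_eq_true, zero_pow, mul_zero,
    Complex.exp_zero, mul_one]
  rw [← mul_assoc, mul_one_div_cancel h1, one_mul]

/-- Inversion carries the half-period τ/2 to 1/2, so it swaps θ₂ and θ₄ with the same factor by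
which it multiplies θ₃. -/
lemma theta4_neg_inv {τ : ℂ} (h : τ ≠ 0) :
    theta4 (-1 / τ) = (-Complex.I * τ) ^ (1 / 2 : ℂ) * theta2 τ := by
  have h1 := neg_I_mul_cpow_half_ne_zero h
  rw [theta2, theta4, jacobiTheta₂_functional_equation (τ / 2) τ]
  have e : τ / 2 / τ = 1 / 2 := by field_simp
  have e2 : (-Real.pi * Complex.I * (τ / 2) ^ 2 / τ : ℂ) = -(Real.pi * Complex.I * τ / 4) := by
    field_simp; ring
  rw [e, e2, Complex.exp_neg]
  have := Complex.exp_ne_zero (Real.pi * Complex.I * τ / 4)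
  field_simp

lemma theta2_neg_inv {τ : ℂ} (h : τ ≠ 0) :
    theta2 (-1 / τ) = (-Complex.I * τ) ^ (1 / 2 : ℂ) * theta4 τ := by
  have h1 := neg_I_mul_cpow_half_ne_zero h
  rw [theta2, theta4, jacobiTheta₂_functional_equation (1 / 2) τ]
  have e : -1 / τ / 2 = - (1 / 2 / τ) := by field_simp
  have e2 : (-Real.pi * Complex.I * (1 / 2) ^ 2 / τ : ℂ) = Real.pi * Complex.I * (-1 / τ) / 4 := by
    field_simp; ring
  rw [e, e2, jacobiTheta₂_neg_left]
  field_simp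

lemma differentiableAt_theta2 {τ : ℂ} (hτ : 0 < τ.im) : DifferentiableAt ℂ theta2 τ := by
  unfold theta2
  refine DifferentiableAt.mul (by fun_prop) ?_
  have h := (hasFDerivAt_jacobiTheta₂ (τ / 2) hτ).differentiableAt
  exact DifferentiableAt.comp τ (f := fun τ : ℂ => (τ / 2, τ)) h (by fun_prop)

lemma differentiableAt_theta4 {τ : ℂ} (hτ : 0 < τ.im) : DifferentiableAt ℂ theta4 τ :=
  differentiableAt_jacobiTheta₂_snd _ hτ

/-! ### Growth at infinity -/

lemma norm_jacobiTheta_term_le {τ : ℂ} (hτ : 1 ≤ τ.im) (x : ℝ) (n : ℤ) :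
    ‖jacobiTheta₂_term n x τ‖ ≤ Real.exp (-Real.pi * (1 * n ^ 2 - 2 * 0 * |n|)) := by
  exact norm_jacobiTheta₂_term_le one_pos (by simp) hτ n

/-- A real x contributes only phases, so the bound is uniform in x; x = 0 and x = 1/2 give θ₃ and
θ₄. -/
lemma exists_norm_jacobiTheta₂_real_le :
    ∃ C : ℝ, ∀ (x : ℝ) (τ : ℂ), 1 ≤ τ.im → ‖jacobiTheta₂ x τ‖ ≤ C := by
  have hs : Summable fun n : ℤ => Real.exp (-Real.pi * (1 * n ^ 2 - 2 * 0 * |n|)) := by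
    simpa using summable_pow_mul_jacobiTheta₂_term_bound 0 one_pos 0
  refine ⟨∑' n : ℤ, Real.exp (-Real.pi * (1 * n ^ 2 - 2 * 0 * |n|)), fun x τ hτ => ?_⟩
  exact tsum_of_norm_bounded hs.hasSum (norm_jacobiTheta_term_le hτ x)

lemma exists_norm_jacobiTheta_le : ∃ C : ℝ, ∀ τ : ℂ, 1 ≤ τ.im → ‖jacobiTheta τ‖ ≤ C := by
  obtain ⟨C, hC⟩ := exists_norm_jacobiTheta₂_real_le
  refine ⟨C, fun τ hτ => ?_⟩
  rw [jacobiTheta_eq_jacobiTheta₂]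
  exact_mod_cast hC 0 τ hτ

lemma exists_norm_theta4_le : ∃ C : ℝ, ∀ τ : ℂ, 1 ≤ τ.im → ‖theta4 τ‖ ≤ C := by
  obtain ⟨C, hC⟩ := exists_norm_jacobiTheta₂_real_le
  refine ⟨C, fun τ hτ => ?_⟩
  simpa [theta4] using hC (1 / 2) τ hτ

lemma theta2_term (n : ℤ) (τ : ℂ) :
    Complex.exp (Real.pi * Complex.I * τ / 4) * jacobiTheta₂_term n (τ / 2) τ =
      Complex.exp (Real.pi * Complex.I * ((n : ℂ) + 1 / 2) ^ 2 * τ) := by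
  rw [jacobiTheta₂_term, ← Complex.exp_add]
  congr 1
  ring

lemma hasSum_theta2 {τ : ℂ} (hτ : 0 < τ.im) :
    HasSum (fun n : ℤ => Complex.exp (Real.pi * Complex.I * ((n : ℂ) + 1 / 2) ^ 2 * τ))
      (theta2 τ) := by
  have := (hasSum_jacobiTheta₂_term (τ / 2) hτ).mul_left
    (Complex.exp (Real.pi * Complex.I * τ / 4))
  simpa only [theta2_term] using! this

lemma norm_theta2_term (n : ℤ) (τ : ℂ) :
    ‖Complex.exp (Real.pi * Complex.I * ((n : ℂ) + 1 / 2) ^ 2 * τ)‖ =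
      Real.exp (-Real.pi * (n + 1 / 2) ^ 2 * τ.im) := by
  rw [Complex.norm_exp]
  congr 1
  have : (Real.pi * Complex.I * ((n : ℂ) + 1 / 2) ^ 2 * τ : ℂ) =
      ((Real.pi * (n + 1 / 2) ^ 2 : ℝ) : ℂ) * (Complex.I * τ) := by push_cast; ring
  rw [this, Complex.re_ofReal_mul]
  simp

lemma summable_exp_theta2 {t : ℝ} (ht : 0 < t) :
    Summable fun n : ℤ => Real.exp (-Real.pi * ((n : ℝ) + 1 / 2) ^ 2 * t) := by
  have h := (hasSum_theta2 (τ := t * Complex.I) (by simpa using ht)).summable.norm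
  simp only [norm_theta2_term] at h
  simpa using h

lemma int_half_sq_ge (n : ℤ) : (1 / 4 : ℝ) ≤ ((n : ℝ) + 1 / 2) ^ 2 := by
  have : (0 : ℤ) ≤ n * (n + 1) := by
    rcases le_or_gt 0 n with h | h
    · positivity
    · exact mul_nonneg_of_nonpos_of_nonpos h.le (by omega)
  have : (0 : ℝ) ≤ (n : ℝ) * (n + 1) := by exact_mod_cast this
  nlinarith

/-- The least exponent (n + 1/2)² is 1/4. Extracting e^{-π(y-1)/4} from every term leaves a series
dominated by its value at height 1. -/
lemma exists_norm_theta2_le : ∃ C : ℝ, 0 < C ∧ ∀ τ : ℂ, 1 ≤ τ.im →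
    ‖theta2 τ‖ ≤ C * Real.exp (-Real.pi / 4 * τ.im) := by
  have hs := summable_exp_theta2 one_pos
  refine ⟨Real.exp (Real.pi / 4) * ∑' n : ℤ, Real.exp (-Real.pi * ((n : ℝ) + 1 / 2) ^ 2 * 1),
    mul_pos (Real.exp_pos _) (hs.tsum_pos (fun _ => (Real.exp_pos _).le) 0 (Real.exp_pos _)),
    fun τ hτ => ?_⟩
  have hpos : 0 < τ.im := by linarith
  rw [mul_right_comm, mul_comm, ← tsum_mul_right, ← (hasSum_theta2 hpos).tsum_eq]
  refine tsum_of_norm_bounded (hs.mul_right _).hasSum fun n => ?_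
  rw [norm_theta2_term, ← Real.exp_add, ← Real.exp_add, Real.exp_le_exp]
  have h1 := int_half_sq_ge n
  have h2 := Real.pi_pos
  nlinarith [mul_nonneg (mul_nonneg h2.le (sub_nonneg.mpr h1)) (sub_nonneg.mpr hτ)]

/-! ### Values on the imaginary axis -/

/-- The real value `∑ e^{-π (n + 1/2)² t}` of `θ₂(it)`. -/
def realTheta2 (t : ℝ) : ℝ := ∑' n : ℤ, Real.exp (-Real.pi * ((n : ℝ) + 1 / 2) ^ 2 * t)

lemma realTheta2_pos {t : ℝ} (ht : 0 < t) : 0 < realTheta2 t :=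
  (summable_exp_theta2 ht).tsum_pos (fun _ => (Real.exp_pos _).le) 0 (Real.exp_pos _)

lemma theta2_I {t : ℝ} (ht : 0 < t) : theta2 (t * Complex.I) = realTheta2 t := by
  rw [← (hasSum_theta2 (τ := t * Complex.I) (by simpa using ht)).tsum_eq, realTheta2,
    Complex.ofReal_tsum]
  refine tsum_congr fun n => ?_
  push_cast
  congr 1
  linear_combination (Real.pi * ((n : ℂ) + 1 / 2) ^ 2 * t) * Complex.I_sq

/-- The defining series of θ₄ alternates. Inversion rewrites it through θ₂ at 1/t, which makes
positivity evident and permits a termwise comparison with θ₂. -/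
lemma theta4_I {t : ℝ} (ht : 0 < t) :
    theta4 (t * Complex.I) = (t ^ (-(1 / 2) : ℝ) * realTheta2 (1 / t) : ℝ) := by
  have ht' : (t : ℂ) ≠ 0 := by exact_mod_cast ht.ne'
  have h := theta4_neg_inv (τ := ((1 / t : ℝ) : ℂ) * Complex.I)
    (mul_ne_zero (by exact_mod_cast (one_div_pos.mpr ht).ne') Complex.I_ne_zero)
  have e1 : -1 / (((1 / t : ℝ) : ℂ) * Complex.I) = t * Complex.I := by
    push_cast
    field_simp
    linear_combination -Complex.I_sq
  have e2 : -Complex.I * (((1 / t : ℝ) : ℂ) * Complex.I) = ((1 / t : ℝ) : ℂ) := by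
    linear_combination (-((1 / t : ℝ) : ℂ)) * Complex.I_sq
  rw [e1, e2, theta2_I (one_div_pos.mpr ht)] at h
  rw [h, Complex.ofReal_mul, Real.rpow_neg ht.le, ← Real.inv_rpow ht.le,
    Complex.ofReal_cpow (inv_pos.mpr ht).le, one_div]
  norm_num

/-- The real value of `θ₄(it)`. -/
def realTheta4 (t : ℝ) : ℝ := t ^ (-(1 / 2) : ℝ) * realTheta2 (1 / t)

lemma realTheta4_pos {t : ℝ} (ht : 0 < t) : 0 < realTheta4 t :=
  mul_pos (Real.rpow_pos_of_pos ht _) (realTheta2_pos (one_div_pos.mpr ht))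

/-- The real value `∑ e^{-π n² t}` of `θ₃(it)`. -/
def realTheta3 (t : ℝ) : ℝ := ∑' n : ℤ, Real.exp (-Real.pi * (n : ℝ) ^ 2 * t)

lemma jacobiTheta_I {t : ℝ} : jacobiTheta (t * Complex.I) = realTheta3 t := by
  rw [jacobiTheta, realTheta3, Complex.ofReal_tsum]
  refine tsum_congr fun n => ?_
  push_cast
  congr 1
  linear_combination (Real.pi * (n : ℂ) ^ 2 * t) * Complex.I_sq

lemma realTheta3_pos {t : ℝ} (ht : 0 < t) : 0 < realTheta3 t := by
  have h := (hasSum_jacobiTheta₂_term 0 (τ := t * Complex.I) (by simpa using ht)).summable.norm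
  simp only [norm_jacobiTheta₂_term] at h
  refine Summable.tsum_pos ?_ (fun _ => (Real.exp_pos _).le) 0 (Real.exp_pos _)
  simpa using h

/-- For `t > 1` the strict inequality `θ₂(it) < θ₄(it)` holds. -/
lemma realTheta2_lt_realTheta4 {t : ℝ} (ht : 1 < t) : realTheta2 t < realTheta4 t := by
  have h0 : 0 < t := by linarith
  rw [realTheta4, realTheta2, realTheta2, ← tsum_mul_left]
  have key (n : ℤ) : Real.exp (-Real.pi * ((n : ℝ) + 1 / 2) ^ 2 * t) <
      t ^ (-(1 / 2) : ℝ) * Real.exp (-Real.pi * ((n : ℝ) + 1 / 2) ^ 2 * (1 / t)) := by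
    rw [Real.rpow_def_of_pos h0, ← Real.exp_add, Real.exp_lt_exp]
    have h1 := int_half_sq_ge n
    have h2 := Real.pi_gt_three
    -- This is u ≤ sinh u at u = log t. The termwise claim is (log t)/2 < π(n + 1/2)²(t - 1/t), and
    -- π(n + 1/2)² > 3/4 while only 1/4 is needed.
    have hlog : Real.log t ≤ (t - 1 / t) / 2 := by
      have h4 := Real.self_le_sinh_iff.mpr (Real.log_pos ht).le
      rw [Real.sinh_eq, Real.exp_log h0, Real.exp_neg, Real.exp_log h0] at h4
      simpa using h4
    have h5 : 0 < t - 1 / t := by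
      have : 1 / t < 1 := by rw [div_lt_one h0]; exact ht
      linarith
    have h6 : (1 / 4 : ℝ) * 3 < ((n : ℝ) + 1 / 2) ^ 2 * Real.pi := by nlinarith
    nlinarith
  exact Summable.tsum_lt_tsum (fun n => (key n).le) (key 0) (summable_exp_theta2 h0)
    ((summable_exp_theta2 (one_div_pos.mpr h0)).mul_left _)

/-! ### Nonvanishing -/

/-- The function `(θ₂ θ₃ θ₄)⁸`, a multiple of the discriminant. -/
def thetaProd (τ : ℍ) : ℂ := (theta2 τ * jacobiTheta τ * theta4 τ) ^ 8

/-- The exponent 8 is there to kill the eighth root of unity coming from θ₂. -/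
lemma thetaProd_slash_T : thetaProd ∣[(12 : ℤ)] ModularGroup.T = thetaProd := by
  ext τ
  rw [ModularForm.SL_slash_apply, modular_T_smul]
  have : ((1 : ℝ) +ᵥ τ : ℍ) = (τ : ℂ) + 1 := by simp [add_comm]
  simp only [thetaProd, this, theta2_add_one, jacobiTheta_add_one, theta4_add_one]
  have h8 : Complex.exp (Real.pi * Complex.I / 4) ^ 8 = 1 := by
    rw [← Complex.exp_nat_mul, Complex.exp_eq_one_iff]
    exact ⟨1, by push_cast; ring⟩
  have hd : denom ModularGroup.T τ = 1 := by rw [ModularGroup.denom_apply]; simp [ModularGroup.T]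
  rw [hd, one_zpow, mul_one]
  linear_combination (theta2 τ * jacobiTheta τ * theta4 τ) ^ 8 * h8

lemma thetaProd_slash_S : thetaProd ∣[(12 : ℤ)] ModularGroup.S = thetaProd := by
  ext τ
  rw [ModularForm.SL_slash_apply, modular_S_smul]
  have h0 := τ.ne_zero
  have e : ((-(τ : ℂ))⁻¹) = -1 / τ := by field_simp
  simp only [thetaProd, ModularGroup.denom_S]
  rw [e, theta2_neg_inv h0, theta4_neg_inv h0, jacobiTheta_neg_inv h0]
  have h24 : ((-Complex.I * τ) ^ (1 / 2 : ℂ)) ^ 24 = (τ : ℂ) ^ 12 := by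
    rw [← Complex.cpow_nat_mul]
    norm_num
    rw [mul_pow, show Complex.I ^ 12 = (Complex.I ^ 4) ^ 3 by ring, Complex.I_pow_four]
    norm_num
  have h12 : (τ : ℂ) ^ 12 ≠ 0 := pow_ne_zero _ h0
  rw [zpow_neg, show (12 : ℤ) = ((12 : ℕ) : ℤ) by norm_num, zpow_natCast, ← div_eq_mul_inv,
    div_eq_iff h12]
  linear_combination (theta2 τ * jacobiTheta τ * theta4 τ) ^ 8 * h24

lemma mdifferentiable_of_differentiableAt {F : ℂ → ℂ}
    (hF : ∀ z : ℂ, 0 < z.im → DifferentiableAt ℂ F z) : MDiff (fun τ : ℍ => F τ) := by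
  rw [UpperHalfPlane.mdifferentiable_iff]
  intro z hz
  refine ((hF z hz).congr_of_eventuallyEq ?_).differentiableWithinAt
  filter_upwards [isOpen_upperHalfPlaneSet.mem_nhds hz] with w hw
  simp [ofComplex_apply_of_im_pos hw]

lemma tendsto_theta2_atImInfty : Tendsto (fun τ : ℍ => theta2 τ) atImInfty (𝓝 0) := by
  obtain ⟨C, -, hC⟩ := exists_norm_theta2_le
  have h1 : Tendsto (fun τ : ℍ => C * Real.exp (-Real.pi / 4 * τ.im)) atImInfty (𝓝 0) := by
    rw [← mul_zero C]
    refine Tendsto.const_mul C (Real.tendsto_exp_atBot.comp ?_)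
    exact Tendsto.const_mul_atTop_of_neg (by have := Real.pi_pos; linarith) tendsto_comap
  refine squeeze_zero_norm' ?_ h1
  filter_upwards [tendsto_comap.eventually_ge_atTop 1] with τ hτ
  exact hC τ hτ

lemma thetaProd_isZeroAtImInfty : IsZeroAtImInfty thetaProd := by
  obtain ⟨C, hC⟩ := exists_norm_jacobiTheta_le
  obtain ⟨D, hD⟩ := exists_norm_theta4_le
  have hbd : IsBoundedAtImInfty fun τ : ℍ => jacobiTheta τ * theta4 τ := by
    rw [isBoundedAtImInfty_iff]
    refine ⟨C * D, 1, fun z hz => ?_⟩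
    rw [norm_mul]
    exact mul_le_mul (hC z hz) (hD z hz) (norm_nonneg _) ((norm_nonneg _).trans (hC z hz))
  have h : Tendsto (fun τ : ℍ => theta2 τ * (jacobiTheta τ * theta4 τ)) atImInfty (𝓝 0) :=
    tendsto_theta2_atImInfty.zero_mul_isBoundedUnder_le
      (by simpa using! hbd.isBoundedUnder_le)
  have h8 := h.pow 8
  simp only [ne_eq, OfNat.ofNat_ne_zero, not_false_eq_true, zero_pow] at h8
  refine h8.congr fun τ => ?_
  rw [thetaProd, mul_assoc]

/-- `(θ₂ θ₃ θ₄)⁸` as a cusp form of weight 12 and level one. -/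
def thetaProdCuspForm : CuspForm 𝒮ℒ 12 where
  toFun := thetaProd
  slash_action_eq' A hA := by
    obtain ⟨A, rfl⟩ := hA
    exact slash_action_generators_SL2Z thetaProd_slash_S thetaProd_slash_T A
  holo' := mdifferentiable_of_differentiableAt
    (F := fun τ => (theta2 τ * jacobiTheta τ * theta4 τ) ^ 8) fun z hz =>
      (((differentiableAt_theta2 hz).mul (differentiableAt_jacobiTheta hz)).mul
        (differentiableAt_theta4 hz)).pow 8
  zero_at_cusps' hc := by
    rw [Subgroup.IsArithmetic.isCusp_iff_isCusp_SL2Z] at hc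
    rw [OnePoint.isZeroAt_iff_forall_SL2Z hc]
    intro γ _
    rw [slash_action_generators_SL2Z thetaProd_slash_S thetaProd_slash_T]
    exact thetaProd_isZeroAtImInfty

/-- Level one cusp forms of weight 12 are multiples of Δ, which has no zeros. The multiple is
nonzero because all three theta constants are positive at i. -/
lemma thetaProd_ne_zero (τ : ℍ) : thetaProd τ ≠ 0 := by
  obtain ⟨c, hc⟩ := CuspForm.exists_smul_discriminant_of_weight_eq_twelve thetaProdCuspForm
  have hfun (w : ℍ) : c * ModularForm.discriminant w = thetaProd w :=
    congrArg (fun f : CuspForm 𝒮ℒ 12 => f w) hc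
  have hI : thetaProd I ≠ 0 := by
    have e : ((I : ℍ) : ℂ) = ((1 : ℝ) : ℂ) * Complex.I := by simp
    rw [thetaProd, e, theta2_I one_pos, jacobiTheta_I, theta4_I one_pos]
    refine pow_ne_zero _ (mul_ne_zero (mul_ne_zero ?_ ?_) ?_)
    · exact_mod_cast (realTheta2_pos one_pos).ne'
    · exact_mod_cast (realTheta3_pos one_pos).ne'
    · exact_mod_cast (realTheta4_pos one_pos).ne'
  have hc0 : c ≠ 0 := by
    rintro rfl
    exact hI (by rw [← hfun, zero_mul])
  rw [← hfun]
  exact mul_ne_zero hc0 (ModularForm.discriminant_ne_zero τ)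

lemma jacobiTheta_ne_zero {τ : ℂ} (hτ : 0 < τ.im) : jacobiTheta τ ≠ 0 := by
  intro h
  have := thetaProd_ne_zero ⟨τ, hτ⟩
  rw [thetaProd] at this
  simp [h] at this

/-- The theta function does not vanish on the upper half-plane. -/
lemma theta_ne_zero (z : ℍ) : theta z ≠ 0 :=
  jacobiTheta_ne_zero (by simpa using z.im_pos)

/-! ### Generators of `Γ₀(4)` -/

/-- The lower triangular generator of `Γ₀(4)`. -/
def lowerGen : SL(2, ℤ) := ⟨!![1, 0; 4, 1], by simp⟩

lemma lowerGen_zpow (n : ℤ) : (lowerGen ^ n).1 = !![1, 0; 4 * n, 1] := by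
  induction n using Int.induction_on with
  | zero => simp [Matrix.one_fin_two]
  | succ n ih =>
    rw [zpow_add_one, Matrix.SpecialLinearGroup.coe_mul, ih]
    ext i j; fin_cases i <;> fin_cases j <;> simp [lowerGen, Matrix.mul_apply]; ring
  | pred n ih =>
    rw [zpow_sub_one, Matrix.SpecialLinearGroup.coe_mul, ih, Matrix.SpecialLinearGroup.coe_inv]
    ext i j; fin_cases i <;> fin_cases j <;>
      simp [lowerGen, Matrix.mul_apply, Matrix.adjugate_fin_two]; ring

/-- Division with remainder of least absolute value. -/
lemma exists_two_mul_abs_add_mul_le (d : ℤ) {c : ℤ} (hc : c ≠ 0) :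
    ∃ n : ℤ, 2 * |d + c * n| ≤ |c| := by
  have hpos : 0 < c.natAbs := Int.natAbs_pos.mpr hc
  have h1 := Int.bmod_lt (x := d) hpos
  have h2 := Int.le_bmod (x := d) hpos
  obtain ⟨m, hm⟩ : c ∣ d.bmod c.natAbs - d :=
    Int.natAbs_dvd.mp (Int.dvd_bmod_sub_self (x := d) (m := c.natAbs))
  refine ⟨m, ?_⟩
  have : d + c * m = d.bmod c.natAbs := by linarith
  rw [this, Int.abs_eq_natAbs c]
  rcases abs_cases (d.bmod c.natAbs) with ⟨h, _⟩ | ⟨h, _⟩ <;> rw [h] <;> omega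

/-- An induction principle for `Γ₀(4)`, from the generators `T`, `lowerGen` and `-1`. -/
theorem gamma0_four_induction {P : SL(2, ℤ) → Prop} (one : P 1) (neg : ∀ γ, P γ → P (-γ))
    (mul_T : ∀ γ, P γ → P (γ * ModularGroup.T)) (mul_T_inv : ∀ γ, P γ → P (γ * ModularGroup.T⁻¹))
    (mul_L : ∀ γ, P γ → P (γ * lowerGen)) (mul_L_inv : ∀ γ, P γ → P (γ * lowerGen⁻¹))
    (γ : SL(2, ℤ)) (hγ : γ ∈ CongruenceSubgroup.Gamma0 4) : P γ := by
  have hT (n : ℤ) : ∀ γ, P γ → P (γ * ModularGroup.T ^ n) := by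
    induction n using Int.induction_on with
    | zero => simp
    | succ n ih => intro γ h; rw [zpow_add_one, ← mul_assoc]; exact mul_T _ (ih γ h)
    | pred n ih => intro γ h; rw [zpow_sub_one, ← mul_assoc]; exact mul_T_inv _ (ih γ h)
  have hL (n : ℤ) : ∀ γ, P γ → P (γ * lowerGen ^ n) := by
    induction n using Int.induction_on with
    | zero => simp
    | succ n ih => intro γ h; rw [zpow_add_one, ← mul_assoc]; exact mul_L _ (ih γ h)
    | pred n ih => intro γ h; rw [zpow_sub_one, ← mul_assoc]; exact mul_L_inv _ (ih γ h)
  -- Descent on |c|. A power of T replaces d by d' with 2|d'| ≤ |c|, then a power of `lowerGen`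
  -- replaces c by a residue mod 4d' of size at most 2|d'|.
  induction hn : (γ 1 0).natAbs using Nat.strong_induction_on generalizing γ with
  | _ m ih =>
  have hdet : γ 0 0 * γ 1 1 - γ 0 1 * γ 1 0 = 1 := by
    rw [← Matrix.det_fin_two]; exact γ.det_coe
  have h4 : (4 : ℤ) ∣ γ 1 0 := by
    rw [CongruenceSubgroup.Gamma0_mem] at hγ
    exact_mod_cast (ZMod.intCast_zmod_eq_zero_iff_dvd _ 4).mp hγ
  by_cases hc : γ 1 0 = 0
  · rw [hc, mul_zero, sub_zero] at hdet
    rcases Int.mul_eq_one_iff_eq_one_or_neg_one.mp hdet with ⟨ha, hd⟩ | ⟨ha, hd⟩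
    · have : γ = 1 * ModularGroup.T ^ (γ 0 1) := by
        ext i j; rw [one_mul, ModularGroup.coe_T_zpow]
        fin_cases i <;> fin_cases j <;> simp [ha, hd, hc]
      rw [this]
      exact hT _ _ one
    · have : γ = -(1 * ModularGroup.T ^ (-γ 0 1)) := by
        ext i j; rw [one_mul, Matrix.SpecialLinearGroup.coe_neg, ModularGroup.coe_T_zpow]
        fin_cases i <;> fin_cases j <;> simp [ha, hd, hc]
      rw [this]
      exact neg _ (hT _ _ one)
  · obtain ⟨n, hn1⟩ := exists_two_mul_abs_add_mul_le (γ 1 1) hc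
    set d' := γ 1 1 + γ 1 0 * n with hd'
    have hodd : d' % 2 = 1 := by
      obtain ⟨e, he⟩ := h4
      have h5 : γ 0 0 * γ 1 1 = 1 + 2 * (2 * γ 0 1 * e) := by rw [he] at hdet; linarith
      have h6 : (γ 1 1) % 2 = 1 := by
        rcases Int.emod_two_eq_zero_or_one (γ 1 1) with h | h
        · exfalso
          have := congrArg (· % 2) h5
          simp [Int.mul_emod, h, Int.add_emod] at this
        · exact h
      have h7 : γ 1 0 * n = 2 * (2 * (e * n)) := by rw [he]; ring
      rw [hd', h7]
      omega
    -- Strict, because d' is odd while 4 ∣ c.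
    have hlt : 2 * |d'| < |γ 1 0| := by
      refine lt_of_le_of_ne hn1 fun h => ?_
      obtain ⟨e, he⟩ := h4
      rw [he] at h
      rcases abs_cases d' with ⟨h1, _⟩ | ⟨h1, _⟩ <;>
        rcases abs_cases (4 * e) with ⟨h2, _⟩ | ⟨h2, _⟩ <;> rw [h1, h2] at h <;> omega
    have hd0 : d' ≠ 0 := by intro h; rw [h] at hodd; simp at hodd
    obtain ⟨r, hr⟩ := exists_two_mul_abs_add_mul_le (γ 1 0) (c := 4 * d') (by omega)
    have hγ' : (γ * ModularGroup.T ^ n * lowerGen ^ r) 1 0 = γ 1 0 + 4 * d' * r := by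
      rw [Matrix.SpecialLinearGroup.coe_mul, Matrix.SpecialLinearGroup.coe_mul, lowerGen_zpow,
        ModularGroup.coe_T_zpow]
      simp [Matrix.mul_apply, hd']
      ring
    have hlt2 : |γ 1 0 + 4 * d' * r| < |γ 1 0| := by
      rw [abs_mul, show |(4 : ℤ)| = 4 by norm_num] at hr
      linarith
    have key := ih _ (by
      rw [Int.abs_eq_natAbs, Int.abs_eq_natAbs] at hlt2
      rw [← hn, hγ']
      exact_mod_cast hlt2) (γ * ModularGroup.T ^ n * lowerGen ^ r) (by
      rw [CongruenceSubgroup.Gamma0_mem, hγ']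
      obtain ⟨e, he⟩ := h4
      rw [ZMod.intCast_zmod_eq_zero_iff_dvd]
      exact ⟨e + d' * r, by rw [he]; push_cast; ring⟩) rfl
    have := hT (-n) _ (hL (-r) _ key)
    simpa [mul_assoc] using this

/-! ### The action of the generators -/

lemma coe_frickePoint (z : ℍ) : (frickePoint z : ℂ) = -1 / (4 * z) := rfl

@[simp]
lemma frickePoint_frickePoint (z : ℍ) : frickePoint (frickePoint z) = z := by
  ext
  have := z.ne_zero
  simp only [coe_frickePoint]
  field_simp

/-- The lower generator is the conjugate of T⁻¹ by the Fricke involution. Behaviour under Γ₀(4) is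
thereby reduced to z ↦ z + 1 and z ↦ -1/(4z). -/
lemma lowerGen_smul (z : ℍ) :
    lowerGen • z = frickePoint ((-1 : ℝ) +ᵥ frickePoint z) := by
  ext
  have h0 := z.ne_zero
  have h1 := (lowerGen • z).ne_zero
  rw [coe_frickePoint, coe_vadd, coe_frickePoint, coe_specialLinearGroup_apply]
  have h2 : (4 : ℂ) * z + 1 ≠ 0 := by
    intro h
    have := congrArg Complex.im h
    simp [z.im_ne_zero] at this
  simp [lowerGen]
  have h3 : -1 + -1 / (4 * (z : ℂ)) = -(4 * z + 1) / (4 * z) := by field_simp; ring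
  rw [h3]
  field_simp

lemma T_smul (z : ℍ) : ModularGroup.T • z = (1 : ℝ) +ᵥ z := modular_T_smul z

lemma bottom_row_mul (γ δ : SL(2, ℤ)) (j : Fin 2) :
    (γ * δ) 1 j = γ 1 0 * δ 0 j + γ 1 1 * δ 1 j := by
  simp [Matrix.mul_apply]

/-- A family of functions indexed by integral row vectors that is equivariant for the generators
of `Γ₀(4)` is equivariant for `Γ₀(4)`. -/
theorem gamma0_four_equivariant {α : Type*} {S : ℤ → ℤ → ℍ → α}
    (hneg : ∀ c d z, S (-c) (-d) z = S c d z)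
    (hT : ∀ c d z, S c d ((1 : ℝ) +ᵥ z) = S c (c + d) z)
    (hL : ∀ c d z, S c d (lowerGen • z) = S (c + 4 * d) d z)
    {γ : SL(2, ℤ)} (hγ : γ ∈ CongruenceSubgroup.Gamma0 4) (z : ℍ) :
    S 0 1 (γ • z) = S (γ 1 0) (γ 1 1) z := by
  revert z
  refine gamma0_four_induction (P := fun γ => ∀ z, S 0 1 (γ • z) = S (γ 1 0) (γ 1 1) z)
    (by simp) ?_ ?_ ?_ ?_ ?_ γ hγ
  · intro γ h z
    rw [ModularGroup.SL_neg_smul, h z, Matrix.SpecialLinearGroup.coe_neg]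
    simp [hneg]
  · intro γ h z
    rw [mul_smul, h, T_smul, hT, bottom_row_mul, bottom_row_mul]
    simp [ModularGroup.T]
  · intro γ h z
    -- The inverse generator is handled by reading the identity for δT at the point T⁻¹z.
    obtain ⟨δ, rfl⟩ : ∃ δ, γ = δ * ModularGroup.T := ⟨γ * ModularGroup.T⁻¹, by simp⟩
    have h1 := h (ModularGroup.T⁻¹ • z)
    have h2 := hT (δ 1 0) (δ 1 1) (ModularGroup.T⁻¹ • z)
    rw [← T_smul, smul_inv_smul] at h2
    rw [mul_smul, smul_inv_smul, bottom_row_mul, bottom_row_mul] at h1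
    rw [mul_inv_cancel_right, h1, h2]
    simp [ModularGroup.T]
  · intro γ h z
    rw [mul_smul, h, hL, bottom_row_mul, bottom_row_mul]
    simp [lowerGen, mul_comm]
  · intro γ h z
    obtain ⟨δ, rfl⟩ : ∃ δ, γ = δ * lowerGen := ⟨γ * lowerGen⁻¹, by simp⟩
    have h1 := h (lowerGen⁻¹ • z)
    have h2 := hL (δ 1 0) (δ 1 1) (lowerGen⁻¹ • z)
    rw [smul_inv_smul] at h2
    rw [mul_smul, smul_inv_smul, bottom_row_mul, bottom_row_mul] at h1
    rw [mul_inv_cancel_right, h1, h2]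
    simp [lowerGen, mul_comm]

/-- A function which is invariant under `z ↦ z + 1` and whose composite with the Fricke involution
is invariant under `z ↦ z + 1` is invariant under `Γ₀(4)`. -/
theorem gamma0_four_invariant {α : Type*} {F : ℍ → α} (hT : ∀ z, F ((1 : ℝ) +ᵥ z) = F z)
    (hW : ∀ z, F (frickePoint ((1 : ℝ) +ᵥ z)) = F (frickePoint z))
    {γ : SL(2, ℤ)} (hγ : γ ∈ CongruenceSubgroup.Gamma0 4) (z : ℍ) : F (γ • z) = F z := by
  refine gamma0_four_equivariant (S := fun _ _ => F) (fun _ _ _ => rfl) (fun _ _ z => hT z)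
    (fun _ _ z => ?_) hγ z
  rw [lowerGen_smul, ← hW, vadd_vadd]
  simp

/-! ### Transformation of `θ` -/

lemma theta_vadd_one (z : ℍ) : theta ((1 : ℝ) +ᵥ z) = theta z := by
  rw [theta, theta, coe_vadd, ← jacobiTheta_two_add (2 * (z : ℂ))]
  congr 1
  push_cast
  ring

lemma neg_two_I_mul_ne_zero (z : ℍ) : -2 * Complex.I * (z : ℂ) ≠ 0 :=
  mul_ne_zero (by simp) z.ne_zero

lemma theta_frickePoint (z : ℍ) :
    theta (frickePoint z) = (-2 * Complex.I * z) ^ (1 / 2 : ℂ) * theta z := by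
  have h0 := z.ne_zero
  have e : 2 * (frickePoint z : ℂ) = -1 / (2 * z) := by rw [coe_frickePoint]; field_simp; ring
  rw [theta, e, jacobiTheta_neg_inv (by simpa using h0), theta]
  congr 2
  ring

lemma cpow_half_zpow (k : ℤ) (w : ℂ) : (w ^ (1 / 2 : ℂ)) ^ (2 * k + 1) = w ^ ((k : ℂ) + 1 / 2) := by
  rw [← Complex.cpow_int_mul]
  congr 1
  push_cast
  ring

lemma cpow_half_pow_four (w : ℂ) : (w ^ (1 / 2 : ℂ)) ^ 4 = w ^ 2 := by
  rw [← Complex.cpow_nat_mul]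
  norm_num

lemma theta_frickePoint_pow_four (z : ℍ) :
    theta (frickePoint z) ^ 4 = -4 * (z : ℂ) ^ 2 * theta z ^ 4 := by
  rw [theta_frickePoint, mul_pow, cpow_half_pow_four, mul_pow, mul_pow, Complex.I_sq]
  ring

lemma four_mul_add_one_ne_zero (z : ℍ) : (4 : ℂ) * z + 1 ≠ 0 := by
  intro h
  have := congrArg Complex.im h
  simp [z.im_ne_zero] at this

/-- In the fourth power the square roots disappear, so neither branches nor quadratic symbols have
to be followed. -/
lemma theta_lowerGen_pow_four (z : ℍ) :
    theta (lowerGen • z) ^ 4 = (4 * (z : ℂ) + 1) ^ 2 * theta z ^ 4 := by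
  have h0 := z.ne_zero
  have h1 : theta ((-1 : ℝ) +ᵥ frickePoint z) = theta (frickePoint z) := by
    rw [← theta_vadd_one, vadd_vadd]
    simp
  rw [lowerGen_smul, theta_frickePoint_pow_four, h1, theta_frickePoint_pow_four, coe_vadd,
    coe_frickePoint]
  push_cast
  field_simp
  ring

lemma coe_lowerGen_smul (z : ℍ) : ((lowerGen • z : ℍ) : ℂ) = z / (4 * z + 1) := by
  rw [coe_specialLinearGroup_apply]
  simp [lowerGen]

/-- The fourth power of the theta multiplier is the automorphy factor of weight two. -/
lemma theta_smul_pow_four {γ : SL(2, ℤ)} (hγ : γ ∈ CongruenceSubgroup.Gamma0 4) (z : ℍ) :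
    theta (γ • z) ^ 4 = ((γ 1 0 : ℂ) * z + γ 1 1) ^ 2 * theta z ^ 4 := by
  have h := gamma0_four_equivariant
    (S := fun c d z => ((c : ℂ) * z + d) ^ 2 * theta z ^ 4) (fun c d z => by push_cast; ring)
    (fun c d z => by rw [theta_vadd_one, coe_vadd]; push_cast; ring)
    (fun c d z => by
      have := four_mul_add_one_ne_zero z
      rw [theta_lowerGen_pow_four, coe_lowerGen_smul, ← mul_assoc, ← mul_pow]
      congr 2
      rw [add_mul, mul_assoc, div_mul_cancel₀ _ this]
      push_cast
      ring) hγ z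
  simpa using h

/-- The weight zero quotient `f / θ^{2k+1}`. -/
def thetaRatio (k : ℤ) (f : ℍ → ℂ) (z : ℍ) : ℂ := f z / theta z ^ (2 * k + 1)

lemma thetaRatio_mul (k : ℤ) (f : ℍ → ℂ) (z : ℍ) :
    thetaRatio k f z * theta z ^ (2 * k + 1) = f z :=
  div_mul_cancel₀ _ (zpow_ne_zero _ (theta_ne_zero z))

/-- The subspace of cusp forms with `f|W₄ = ε f`. -/
def frickeSpace (k : ℤ) (ε : ℂ) : Submodule ℂ (ℍ → ℂ) :=
  cuspForms k ⊓ LinearMap.eqLocus (fricke k) (ε • LinearMap.id)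

lemma plusSpace_eq (k : ℤ) : plusSpace k = frickeSpace k 1 := by
  rw [plusSpace, frickeSpace, one_smul]

lemma minusSpace_eq (k : ℤ) : minusSpace k = frickeSpace k (-1) := by
  have : ((-1 : ℂ) • LinearMap.id : (ℍ → ℂ) →ₗ[ℂ] (ℍ → ℂ)) = -LinearMap.id := by ext; simp
  rw [minusSpace, frickeSpace, this]

lemma fricke_eq_iff (k : ℤ) (f : ℍ → ℂ) (ε : ℂ) (z : ℍ) :
    fricke k f z = ε * f z ↔
      f (frickePoint z) = ε * (-2 * Complex.I * z) ^ ((k : ℂ) + 1 / 2) * f z := by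
  have h0 := neg_two_I_mul_ne_zero z
  have e : (-(k : ℂ) - 1 / 2) = -((k : ℂ) + 1 / 2) := by ring
  have h1 : (-2 * Complex.I * z : ℂ) ^ ((k : ℂ) + 1 / 2) ≠ 0 := by
    rw [Ne, Complex.cpow_eq_zero_iff, not_and_or]; exact Or.inl h0
  simp only [fricke, LinearMap.coe_mk, AddHom.coe_mk, e, Complex.cpow_neg]
  rw [inv_mul_eq_iff_eq_mul₀ h1]
  constructor <;> intro h <;> rw [h] <;> ring

/-- The multiplier of f is by definition that of θ^{2k+1}, so modularity of half-integral weight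
becomes plain invariance of the quotient. -/
lemma thetaRatio_smul {k : ℤ} {f : ℍ → ℂ} (hf : f ∈ cuspForms k) {γ : SL(2, ℤ)}
    (hγ : γ ∈ CongruenceSubgroup.Gamma0 4) (z : ℍ) :
    thetaRatio k f (γ • z) = thetaRatio k f z := by
  have h1 := zpow_ne_zero (2 * k + 1) (theta_ne_zero z)
  have h2 := zpow_ne_zero (2 * k + 1) (theta_ne_zero (γ • z))
  rw [thetaRatio, thetaRatio, hf.transform γ hγ z, thetaMultiplier, div_zpow]
  field_simp

lemma vadd_one_of_mem {k : ℤ} {f : ℍ → ℂ} (hf : f ∈ cuspForms k) (z : ℍ) :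
    f ((1 : ℝ) +ᵥ z) = f z := by
  have h := hf.transform ModularGroup.T
    (CongruenceSubgroup.Gamma0_mem.mpr (by simp [ModularGroup.T])) z
  rw [thetaMultiplier, T_smul, theta_vadd_one, div_self (theta_ne_zero z), one_zpow, one_mul] at h
  exact h

lemma frickePoint_of_mem {k : ℤ} {ε : ℂ} {f : ℍ → ℂ} (hf : f ∈ frickeSpace k ε) (z : ℍ) :
    f (frickePoint z) = ε * (-2 * Complex.I * z) ^ ((k : ℂ) + 1 / 2) * f z := by
  rw [← fricke_eq_iff]
  exact congrFun (LinearMap.mem_eqLocus.mp hf.2) z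

/-- θ^{2k+1} has the same Fricke factor (-2iz)^{k+1/2}, for the same branch; only ε survives in the
quotient. -/
lemma thetaRatio_frickePoint {k : ℤ} {ε : ℂ} {f : ℍ → ℂ} (z : ℍ)
    (hf : f (frickePoint z) = ε * (-2 * Complex.I * z) ^ ((k : ℂ) + 1 / 2) * f z) :
    thetaRatio k f (frickePoint z) = ε * thetaRatio k f z := by
  have h0 := neg_two_I_mul_ne_zero z
  have h1 : (-2 * Complex.I * z : ℂ) ^ ((k : ℂ) + 1 / 2) ≠ 0 := by
    rw [Ne, Complex.cpow_eq_zero_iff, not_and_or]; exact Or.inl h0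
  have h2 := zpow_ne_zero (2 * k + 1) (theta_ne_zero z)
  rw [thetaRatio, thetaRatio, hf, theta_frickePoint, mul_zpow, cpow_half_zpow, mul_right_comm,
    mul_comm _ (theta z ^ _), mul_div_mul_right _ _ h1, mul_div_assoc]

/-! ### The growth criterion -/

/-- The bound `|f(z)| ≤ C y^{-(k+1/2)/2}` characterising cusp forms. -/
def HasCuspBound (k : ℤ) (f : ℍ → ℂ) : Prop :=
  ∃ C : ℝ, ∀ z : ℍ, ‖f z‖ ≤ C * z.im ^ (-((k : ℝ) + 1 / 2) / 2)

lemma smul_im_eq (γ : SL(2, ℤ)) (z : ℍ) :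
    (γ • z).im = z.im / ‖(γ 1 0 : ℂ) * z + γ 1 1‖ ^ 2 := by
  rw [ModularGroup.im_smul_eq_div_normSq, ModularGroup.denom_apply, Complex.normSq_eq_norm_sq]

lemma bottom_ne_zero (γ : SL(2, ℤ)) (z : ℍ) : (γ 1 0 : ℂ) * z + γ 1 1 ≠ 0 := by
  rw [← ModularGroup.denom_apply]
  exact denom_ne_zero _ _

/-- As Im γz = y/|cz + d|², the bound is preserved by all of SL₂(ℤ), so one estimate controls every
cusp. -/
lemma norm_cuspTranslate_le {k : ℤ} {f : ℍ → ℂ} {C : ℝ}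
    (hC : ∀ z : ℍ, ‖f z‖ ≤ C * z.im ^ (-((k : ℝ) + 1 / 2) / 2)) (γ : SL(2, ℤ)) (z : ℍ) :
    ‖cuspTranslate k γ f z‖ ≤ C * z.im ^ (-((k : ℝ) + 1 / 2) / 2) := by
  have hne := norm_pos_iff.mpr (bottom_ne_zero γ z)
  have e : (-(k : ℂ) - 1 / 2) = ((-((k : ℝ) + 1 / 2) : ℝ) : ℂ) := by push_cast; ring
  rw [cuspTranslate, norm_mul, e, Complex.norm_cpow_real]
  refine (mul_le_mul_of_nonneg_left (hC _) (by positivity)).trans (le_of_eq ?_)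
  rw [smul_im_eq, Real.div_rpow z.im_pos.le (by positivity), ← Real.rpow_natCast _ 2,
    ← Real.rpow_mul hne.le]
  have e2 : ((2 : ℕ) : ℝ) * (-((k : ℝ) + 1 / 2) / 2) = -((k : ℝ) + 1 / 2) := by push_cast; ring
  rw [e2]
  have := Real.rpow_pos_of_pos hne (-((k : ℝ) + 1 / 2))
  field_simp

lemma tendsto_im_rpow_neg {r : ℝ} (hr : r < 0) (C : ℝ) :
    Tendsto (fun z : ℍ => C * z.im ^ r) atImInfty (𝓝 0) := by
  rw [← mul_zero C]
  refine Tendsto.const_mul C ?_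
  have := tendsto_rpow_neg_atTop (y := -r) (by linarith)
  rw [neg_neg] at this
  exact this.comp tendsto_comap

/-- The working criterion for membership, used for Hecke images and for theta forms. Periodicity and
the Fricke relation give invariance of f/θ^{2k+1}; the growth bound, whose exponent is negative for
k ≥ 0, gives vanishing at all cusps. -/
lemma mem_frickeSpace_of {k : ℤ} (hk : 0 ≤ k) {ε : ℂ} {f : ℍ → ℂ} (holo : MDiff f)
    (hT : ∀ z, f ((1 : ℝ) +ᵥ z) = f z)
    (hW : ∀ z : ℍ, f (frickePoint z) = ε * (-2 * Complex.I * z) ^ ((k : ℂ) + 1 / 2) * f z)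
    (hb : HasCuspBound k f) : f ∈ frickeSpace k ε := by
  have hk' : (0 : ℝ) ≤ k := by exact_mod_cast hk
  refine ⟨⟨holo, fun γ hγ z => ?_, fun γ => ?_⟩, ?_⟩
  · have hT' (z : ℍ) : thetaRatio k f ((1 : ℝ) +ᵥ z) = thetaRatio k f z := by
      rw [thetaRatio, thetaRatio, hT, theta_vadd_one]
    have h := gamma0_four_invariant (F := thetaRatio k f) hT' (fun z => by
      rw [thetaRatio_frickePoint _ (hW _), thetaRatio_frickePoint _ (hW _), hT']) hγ z
    rw [← thetaRatio_mul k f (γ • z), h, thetaRatio, thetaMultiplier, div_zpow]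
    ring
  · obtain ⟨C, hC⟩ := hb
    exact squeeze_zero_norm (norm_cuspTranslate_le hC γ)
      (tendsto_im_rpow_neg (by linarith) C)
  · exact LinearMap.mem_eqLocus.mpr (funext fun z => (fricke_eq_iff k f ε z).mpr (hW z))

/-- The fourth power of a cusp form of weight `k + 1/2` as a cusp form of weight `4k + 2`. -/
def powFourCuspForm (k : ℤ) (f : ℍ → ℂ) (hf : f ∈ cuspForms k) :
    CuspForm (CongruenceSubgroup.Gamma0 4 : Subgroup (GL (Fin 2) ℝ)) (4 * k + 2) where
  toFun z := f z ^ 4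
  slash_action_eq' A hA := by
    obtain ⟨γ, hγ, rfl⟩ := hA
    ext z
    change ((fun z => f z ^ 4) ∣[4 * k + 2] γ) z = f z ^ 4
    have h0 := bottom_ne_zero γ z
    have h2 : theta (γ • z) ^ (4 * (2 * k + 1)) =
        ((γ 1 0 : ℂ) * z + γ 1 1) ^ (4 * k + 2) * theta z ^ (4 * (2 * k + 1)) := by
      have := congrArg (· ^ (2 * k + 1)) (theta_smul_pow_four hγ z)
      simp only [mul_zpow, ← zpow_natCast, ← zpow_mul] at this
      rw [show (4 * k + 2 : ℤ) = (2 : ℕ) * (2 * k + 1) by push_cast; ring]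
      exact this
    have h3 := zpow_ne_zero (4 * (2 * k + 1)) (theta_ne_zero z)
    have h4 := zpow_ne_zero (4 * k + 2) h0
    rw [ModularForm.SL_slash_apply, ModularGroup.denom_apply, hf.transform γ hγ z,
      thetaMultiplier, mul_pow, ← zpow_natCast (_ ^ (2 * k + 1)), ← zpow_mul,
      show (2 * k + 1) * ((4 : ℕ) : ℤ) = 4 * (2 * k + 1) by push_cast; ring, div_zpow, h2, zpow_neg]
    field_simp
  holo' := hf.holo.pow 4
  zero_at_cusps' hc := by
    rw [Subgroup.IsArithmetic.isCusp_iff_isCusp_SL2Z] at hc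
    rw [OnePoint.isZeroAt_iff_forall_SL2Z hc]
    intro γ _
    have h := (hf.zero_at_cusps γ).pow 4
    simp only [ne_eq, OfNat.ofNat_ne_zero, not_false_eq_true, zero_pow] at h
    refine h.congr fun z => ?_
    rw [ModularForm.SL_slash_apply, ModularGroup.denom_apply, cuspTranslate, mul_pow,
      ← Complex.cpow_nat_mul, mul_comm]
    congr 1
    rw [← Complex.cpow_intCast]
    congr 1
    push_cast
    ring

lemma powFourCuspForm_apply (k : ℤ) (f : ℍ → ℂ) (hf : f ∈ cuspForms k) (z : ℍ) :
    powFourCuspForm k f hf z = f z ^ 4 := rfl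

/-- The bound for cusp forms of integral weight is applied to f⁴, and fourth roots are taken. -/
lemma hasCuspBound_of_mem {k : ℤ} {f : ℍ → ℂ} (hf : f ∈ cuspForms k) : HasCuspBound k f := by
  obtain ⟨C, hC⟩ := CuspFormClass.exists_bound (powFourCuspForm k f hf)
  have hC0 : 0 ≤ C := by
    have h := (norm_nonneg _).trans (hC I)
    simpa using h
  refine ⟨C ^ (1 / 4 : ℝ), fun z => ?_⟩
  have h := hC z
  rw [powFourCuspForm_apply, norm_pow] at h
  refine le_of_pow_le_pow_left₀ (n := 4) (by norm_num) (by have := z.im_pos; positivity) (h.trans (le_of_eq ?_))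
  rw [mul_pow, ← Real.rpow_mul_natCast hC0, ← Real.rpow_mul_natCast z.im_pos.le, div_eq_mul_inv,
    ← Real.rpow_neg z.im_pos.le]
  norm_num
  left
  congr 1
  ring

/-! ### Fourier expansions -/

/-- The exponential `e^{2πi n z}`. -/
def qExp (n : ℕ) (z : ℂ) : ℂ := Complex.exp (2 * Real.pi * Complex.I * n * z)

lemma qExp_ne_zero (n : ℕ) (z : ℂ) : qExp n z ≠ 0 := Complex.exp_ne_zero _

lemma qParam_pow_eq (n : ℕ) (z : ℂ) : Function.Periodic.qParam 1 z ^ n = qExp n z := by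
  rw [Function.Periodic.qParam, ← Complex.exp_nat_mul, qExp]
  congr 1
  push_cast
  ring

lemma isZeroAtImInfty_of_mem {k : ℤ} {f : ℍ → ℂ} (hf : f ∈ cuspForms k) : IsZeroAtImInfty f := by
  have h := hf.zero_at_cusps 1
  have e : cuspTranslate k 1 f = f := by
    funext z
    simp [cuspTranslate]
  rwa [e] at h

lemma periodic_of_vadd {f : ℍ → ℂ} (hT : ∀ z, f ((1 : ℝ) +ᵥ z) = f z) :
    Function.Periodic (f ∘ ofComplex) (1 : ℝ) := by
  intro w
  by_cases hw : 0 < w.im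
  · have h2 : 0 < (w + ((1 : ℝ) : ℂ)).im := by simpa using hw
    simp only [Function.comp_apply, ofComplex_apply_of_im_pos h2, ofComplex_apply_of_im_pos hw]
    rw [← hT ⟨w, hw⟩]
    congr 1
    ext
    simp [add_comm]
  · have h2 : (w + ((1 : ℝ) : ℂ)).im ≤ 0 := by simpa using hw
    simp only [Function.comp_apply]
    rw [ofComplex_apply_of_im_nonpos h2, ofComplex_apply_of_im_nonpos (not_lt.mp hw)]

section Fourier

variable {k : ℤ} {f : ℍ → ℂ}

lemma hasSum_fourierCoeff (hf : f ∈ cuspForms k) (z : ℍ) :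
    HasSum (fun n : ℕ => fourierCoeff f n * qExp n z) (f z) := by
  have h := hasSum_qExpansion one_pos (periodic_of_vadd (vadd_one_of_mem hf)) hf.holo
    (isZeroAtImInfty_of_mem hf).isBoundedAtImInfty z
  simpa only [qParam_pow_eq, smul_eq_mul] using! h

lemma fourierCoeff_unique (hf : f ∈ cuspForms k) {c : ℕ → ℂ}
    (hc : ∀ z : ℍ, HasSum (fun n : ℕ => c n * qExp n z) (f z)) : fourierCoeff f = c := by
  have hper := periodic_of_vadd (vadd_one_of_mem hf)
  have hbd := (isZeroAtImInfty_of_mem hf).isBoundedAtImInfty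
  have h1 := (hasFPowerSeriesOnBall_cuspFunction one_pos
    (analyticAt_cuspFunction_zero one_pos hper hf.holo hbd) (c := c) fun z => by
      simpa only [qParam_pow_eq, smul_eq_mul] using hc z).hasFPowerSeriesAt
  have h2 := (hasFPowerSeriesOnBall_cuspFunction one_pos
    (analyticAt_cuspFunction_zero one_pos hper hf.holo hbd) (c := fourierCoeff f) fun z => by
      simpa only [qParam_pow_eq, smul_eq_mul] using hasSum_fourierCoeff hf z).hasFPowerSeriesAt
  funext n
  simpa using congrArg (FormalMultilinearSeries.coeff · n) (h2.eq_formalMultilinearSeries h1)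

lemma fourierCoeff_zero (hf : f ∈ cuspForms k) : fourierCoeff f 0 = 0 := by
  rw [fourierCoeff, qExpansion_coeff_zero one_pos (analyticAt_cuspFunction_zero one_pos
    (periodic_of_vadd (vadd_one_of_mem hf)) hf.holo
    (isZeroAtImInfty_of_mem hf).isBoundedAtImInfty) (periodic_of_vadd (vadd_one_of_mem hf)),
    (isZeroAtImInfty_of_mem hf).valueAtInfty_eq_zero]

lemma fourierCoeff_add {g : ℍ → ℂ} (hf : f ∈ cuspForms k) (hg : g ∈ cuspForms k) :
    fourierCoeff (f + g) = fourierCoeff f + fourierCoeff g := by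
  refine fourierCoeff_unique (Submodule.add_mem _ hf hg) fun z => ?_
  simpa only [Pi.add_apply, add_mul] using
    (hasSum_fourierCoeff hf z).add (hasSum_fourierCoeff hg z)

lemma fourierCoeff_smul (hf : f ∈ cuspForms k) (c : ℂ) :
    fourierCoeff (c • f) = c • fourierCoeff f := by
  refine fourierCoeff_unique (Submodule.smul_mem _ c hf) fun z => ?_
  simpa only [Pi.smul_apply, smul_eq_mul, mul_assoc] using (hasSum_fourierCoeff hf z).mul_left c

lemma eq_of_fourierCoeff_eq {g : ℍ → ℂ} (hf : f ∈ cuspForms k) (hg : g ∈ cuspForms k)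
    (h : fourierCoeff f = fourierCoeff g) : f = g := by
  funext z
  refine (hasSum_fourierCoeff hf z).unique ?_
  rw [h]
  exact hasSum_fourierCoeff hg z

/-! ### Finite dimensionality -/

/-- After division by q^N a power series in q remains, and it is bounded at infinity. -/
lemma isBigO_of_fourierCoeff_eq_zero (hf : f ∈ cuspForms k) {N : ℕ}
    (hN : ∀ n < N, fourierCoeff f n = 0) :
    f =O[atImInfty] fun z => Real.exp (-(2 * Real.pi * N) * z.im) := by
  have hsum (z : ℍ) : HasSum (fun n : ℕ => fourierCoeff f (n + N) * qExp n z)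
      (f z * (qExp N z)⁻¹) := by
    have h := (hasSum_nat_add_iff' N).mpr (hasSum_fourierCoeff hf z)
    rw [Finset.sum_eq_zero (fun i hi => by rw [hN i (Finset.mem_range.mp hi), zero_mul]),
      sub_zero] at h
    have h2 := h.mul_right (qExp N z)⁻¹
    refine (congrArg (HasSum · _) (funext fun n => ?_)).mp h2
    have h1 : qExp (n + N) z = qExp n z * qExp N z := by
      rw [qExp, qExp, qExp, ← Complex.exp_add]; congr 1; push_cast; ring
    rw [h1, mul_assoc, mul_assoc, mul_inv_cancel₀ (qExp_ne_zero _ _), mul_one]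
  have hb : IsBoundedAtImInfty fun z => f z * (qExp N z)⁻¹ :=
    isBoundedAtImInfty_of_hasSum_qExpansion (c := fun n => fourierCoeff f (n + N)) one_pos
      fun z => by simpa only [qParam_pow_eq, smul_eq_mul] using hsum z
  have h2 : (fun z : ℍ => qExp N z) =O[atImInfty]
      fun z => Real.exp (-(2 * Real.pi * N) * z.im) := by
    refine Asymptotics.isBigO_of_le _ fun z => le_of_eq ?_
    rw [qExp, Complex.norm_exp, Real.norm_of_nonneg (Real.exp_pos _).le]
    congr 1
    have : (2 * Real.pi * Complex.I * N * z : ℂ) =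
        ((2 * Real.pi * N : ℝ) : ℂ) * (Complex.I * z) := by push_cast; ring
    rw [this, Complex.re_ofReal_mul]
    simp
  have h3 := Asymptotics.IsBigO.mul hb h2
  refine (h3.congr_left fun z => ?_).congr_right fun z => ?_
  · rw [mul_assoc, inv_mul_cancel₀ (qExp_ne_zero _ _), mul_one]
  · simp

/-- The n-th coefficient is an integral along any line of large height t, hence O(e^{-2π(M-n)t}).
Letting t → ∞ kills all coefficients with n < M, and the Sturm bound of level one applies. -/
lemma levelOne_eq_zero_of_isBigO {K : ℤ} (G : ModularForm 𝒮ℒ K) {M : ℕ} (hM : K.toNat / 12 < M)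
    (hG : (G : ℍ → ℂ) =O[atImInfty] fun z => Real.exp (-(2 * Real.pi * M) * z.im)) : G = 0 := by
  refine ModularForm.sturm_bound_levelOne ?_
  refine lt_of_lt_of_le (b := (M : ℕ∞)) (by exact_mod_cast hM) ?_
  refine PowerSeries.nat_le_order _ _ fun n hn => ?_
  obtain ⟨C, hC⟩ := hG.bound
  obtain ⟨A, hA⟩ := (atImInfty_mem _).mp hC
  have hbound : ∀ t : ℝ, max A 1 ≤ t → ‖(qExpansion 1 G).coeff n‖ ≤
      C * Real.exp (-(2 * Real.pi * (M - n)) * t) := by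
    intro t ht
    have ht0 : 0 < t := lt_of_lt_of_le one_pos ((le_max_right _ _).trans ht)
    rw [ModularFormClass.qExpansion_coeff_eq_intervalIntegral G one_pos
      one_mem_strictPeriods_SL n ht0]
    simp only [Complex.ofReal_one, div_one, one_mul]
    refine (intervalIntegral.norm_integral_le_of_norm_le_const
      (C := C * Real.exp (-(2 * Real.pi * (M - n)) * t)) fun u _ => ?_).trans (by simp)
    have h1 : ‖G (⟨u + t * Complex.I, by simpa using ht0⟩ : ℍ)‖ ≤
        C * ‖Real.exp (-(2 * Real.pi * M) * t)‖ := by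
      have h := hA (⟨u + t * Complex.I, by simpa using ht0⟩ : ℍ) (by
        simpa [← UpperHalfPlane.coe_im] using (le_max_left _ _).trans ht)
      simpa [← UpperHalfPlane.coe_im] using h
    rw [norm_mul, norm_div, norm_one, norm_pow, Function.Periodic.norm_qParam]
    simp only [Complex.add_im, Complex.ofReal_im, Complex.mul_im, Complex.ofReal_re,
      Complex.I_im, mul_one, Complex.I_re, mul_zero, add_zero, zero_add, div_one]
    rw [Real.norm_of_nonneg (Real.exp_pos _).le] at h1
    refine (mul_le_mul_of_nonneg_left h1 (by positivity)).trans (le_of_eq ?_)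
    rw [← Real.exp_nat_mul, one_div, ← Real.exp_neg, mul_left_comm, ← Real.exp_add]
    congr 2
    ring
  have hlim : Tendsto (fun t : ℝ => C * Real.exp (-(2 * Real.pi * (M - n)) * t)) atTop (𝓝 0) := by
    rw [← mul_zero C]
    refine Tendsto.const_mul C (Real.tendsto_exp_atBot.comp ?_)
    refine Tendsto.const_mul_atTop_of_neg ?_ tendsto_id
    have : (n : ℝ) < M := by exact_mod_cast hn
    have := Real.pi_pos
    nlinarith
  have h0 : ‖(qExpansion 1 G).coeff n‖ ≤ 0 :=
    ge_of_tendsto hlim (by filter_upwards [eventually_ge_atTop (max A 1)] with t ht using hbound t ht)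
  exact norm_le_zero_iff.mp h0

/-- The norm of f⁴ to level one is a product over cosets. The factor of the trivial coset decays
like q^N and the others are bounded, so the norm vanishes once N exceeds the level one bound; then
f⁴ = 0. -/
lemma exists_sturm_bound (k : ℤ) : ∃ N : ℕ, ∀ f ∈ cuspForms k,
    (∀ n < N, fourierCoeff f n = 0) → f = 0 := by
  set Γ : Subgroup (GL (Fin 2) ℝ) := (CongruenceSubgroup.Gamma0 4 : Subgroup (GL (Fin 2) ℝ))
  set K : ℤ := (4 * k + 2) * Nat.card (𝒮ℒ ⧸ Γ.subgroupOf 𝒮ℒ)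
  refine ⟨K.toNat / 12 + 1, fun f hf hN => ?_⟩
  set F := powFourCuspForm k f hf
  have hF4 : (F : ℍ → ℂ) =O[atImInfty]
      fun z => Real.exp (-(2 * Real.pi * (K.toNat / 12 + 1 : ℕ)) * z.im) := by
    have h1 := isBigO_of_fourierCoeff_eq_zero hf hN
    -- The decay of one of the four factors is enough; f³ need only be bounded.
    have h2 : (fun z => f z ^ 3) =O[atImInfty] (1 : ℍ → ℝ) := by
      exact (Asymptotics.IsBigO.pow (isZeroAtImInfty_of_mem hf).isBoundedAtImInfty 3).congr_right
        fun z => by simp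
    refine ((h2.mul h1).congr_left fun z => ?_).congr_right fun z => ?_
    · change f z ^ 3 * f z = f z ^ 4
      ring
    · simp
  have hnorm : ModularForm.norm 𝒮ℒ F = 0 := by
    refine levelOne_eq_zero_of_isBigO _ (Nat.lt_succ_self _) ?_
    classical
    let := Fintype.ofFinite (𝒮ℒ ⧸ Γ.subgroupOf 𝒮ℒ)
    let q₀ : 𝒮ℒ ⧸ Γ.subgroupOf 𝒮ℒ := ⟦1⟧
    have hq₀ : quotientFunc F q₀ = F := by
      rw [show q₀ = ⟦1⟧ from rfl, quotientFunc_mk]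
      simp
    have hrest : (fun z => ∏ q ∈ Finset.univ.erase q₀, quotientFunc F q z) =O[atImInfty]
        (1 : ℍ → ℝ) := by
      have : (1 : ℍ → ℝ) = fun z => ∏ q ∈ Finset.univ.erase q₀, (1 : ℝ) := by ext; simp
      rw [this]
      refine Asymptotics.IsBigO.finsetProd fun q _ => ?_
      induction q using Quotient.inductionOn with
      | h r =>
        obtain ⟨r, γ, rfl⟩ := r
        rw [quotientFunc_mk]
        have := ModularFormClass.bdd_at_infty_slash F γ⁻¹
        change IsBoundedAtImInfty (F ∣[4 * k + 2] (Matrix.SpecialLinearGroup.mapGL ℝ γ)⁻¹)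
        rw [← map_inv]
        exact this
    refine ((hF4.mul hrest).congr_left fun z => ?_).congr_right fun z => ?_
    · rw [ModularForm.coe_norm, Finset.prod_apply]
      rw [← Finset.mul_prod_erase _ _ (Finset.mem_univ q₀), hq₀]
    · rw [Pi.one_apply, mul_one]
  have hF0 := (ModularForm.norm_eq_zero_iff (f := F) 𝒮ℒ).mp hnorm
  funext z
  exact eq_zero_of_pow_eq_zero (congrFun hF0 z : f z ^ 4 = 0)

instance finiteDimensional_cuspForms (k : ℤ) : FiniteDimensional ℂ (cuspForms k) := by
  obtain ⟨N, hN⟩ := exists_sturm_bound k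
  let φ : cuspForms k →ₗ[ℂ] (Fin N → ℂ) :=
    { toFun := fun f n => fourierCoeff f.1 n
      map_add' := fun f g => by ext n; simp [fourierCoeff_add f.2 g.2]
      map_smul' := fun c f => by ext n; simp [fourierCoeff_smul f.2] }
  refine FiniteDimensional.of_injective φ ((injective_iff_map_eq_zero φ).mpr fun f hf => ?_)
  exact Subtype.ext (hN f.1 f.2 fun n hn => congrFun hf ⟨n, hn⟩)

end Fourier

lemma hasSum_congr_terms {β M : Type*} [AddCommMonoid M] [TopologicalSpace M] {f g : β → M} {a : M}
    (h : ∀ x, f x = g x) :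
    HasSum f a ↔ HasSum g a := by
  rw [funext h]

/-! ### Quadratic Gauss sums -/

section GaussSums

variable {N : ℕ} [NeZero N]

/-- The quadratic Gauss sum `∑ e(b r² / N)` over residues `r` modulo `N`. -/
def quadSum (b : ZMod N) : ℂ := ∑ r : ZMod N, ZMod.stdAddChar (b * r ^ 2)

lemma sum_fin_cast {M : Type*} [AddCommMonoid M] (F : ZMod N → M) :
    ∑ r : Fin N, F ((r : ℕ) : ZMod N) = ∑ r : ZMod N, F r := by
  refine Fintype.sum_bijective (fun r : Fin N => ((r : ℕ) : ZMod N)) ?_ _ _ fun _ => rfl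
  rw [Fintype.bijective_iff_injective_and_card]
  refine ⟨fun r s h => ?_, by simp [ZMod.card]⟩
  have := (ZMod.natCast_eq_natCast_iff' _ _ _).mp h
  rw [Nat.mod_eq_of_lt r.2, Nat.mod_eq_of_lt s.2] at this
  exact Fin.ext this

/-- Completing the square: since 4bh = -1, the shift r ↦ r + 2hm cancels the linear term and leaves
hm². -/
lemma sum_stdAddChar_sq_add (b h m : ZMod N) (hbh : 4 * b * h = -1) :
    ∑ r : ZMod N, (ZMod.stdAddChar (b * r ^ 2) * ZMod.stdAddChar (m * r) : ℂ) =
      quadSum b * ZMod.stdAddChar (h * m ^ 2) := by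
  rw [quadSum, Finset.sum_mul, ← Equiv.sum_comp (Equiv.addRight (2 * h * m))]
  refine Finset.sum_congr rfl fun r _ => ?_
  rw [← AddChar.map_add_eq_mul, ← AddChar.map_add_eq_mul]
  congr 1
  simp only [Equiv.coe_addRight]
  linear_combination (m * r + h * m ^ 2) * hbh

/-- The theta series is split by n = mN + r. The phase e(bn²/N) depends only on r, and the sum over
m is inverted by the functional equation of `jacobiTheta₂`. Summing over r then gives a Gauss sum
with a linear term. This yields the theta multiplier explicitly, with the principal branch. -/
lemma theta_quadSum {b h : ℤ} (hbh : (4 * b * h : ZMod N) = -1) {z : ℂ} (hz : 0 < z.im) :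
    jacobiTheta (2 * (b / N + -1 / (4 * z) / N ^ 2)) =
      quadSum (b : ZMod N) * (-2 * Complex.I * z) ^ (1 / 2 : ℂ) *
        jacobiTheta (2 * (z + h / N)) := by
  have hN : (N : ℂ) ≠ 0 := Nat.cast_ne_zero.mpr (NeZero.ne N)
  have hNr : (0 : ℝ) < N := Nat.cast_pos.mpr (NeZero.pos N)
  have hz0 : z ≠ 0 := by rintro rfl; simp at hz
  have hu : -2 * Complex.I * z ≠ 0 := mul_ne_zero (by simp) hz0
  have hu2 : (-2 * Complex.I * z) ^ (1 / 2 : ℂ) ≠ 0 := by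
    rw [Ne, Complex.cpow_eq_zero_iff, not_and_or]; exact Or.inl hu
  have hw : 0 < (-1 / (2 * z)).im := by
    have := (UpperHalfPlane.mk z hz).im_inv_neg_coe_pos
    have e : -1 / (2 * z) = ((1 / 2 : ℝ) : ℂ) * (-z)⁻¹ := by push_cast; field_simp
    rw [e, Complex.im_ofReal_mul]
    exact mul_pos (by norm_num) this
  have hτ : 0 < (2 * (b / N + -1 / (4 * z) / N ^ 2) : ℂ).im := by
    have e : (2 * (b / N + -1 / (4 * z) / N ^ 2) : ℂ) =
        ((2 * b / N : ℝ) : ℂ) + ((1 / N ^ 2 : ℝ) : ℂ) * (-1 / (2 * z)) := by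
      push_cast; field_simp; ring
    rw [e, Complex.add_im, Complex.ofReal_im, Complex.im_ofReal_mul, zero_add]
    positivity
  have hτ' : 0 < (2 * (z + h / N) : ℂ).im := by
    have e : (2 * (z + h / N) : ℂ) = ((2 : ℝ) : ℂ) * z + ((2 * h / N : ℝ) : ℂ) := by
      push_cast; ring
    rw [e, Complex.add_im, Complex.ofReal_im, Complex.im_ofReal_mul, add_zero]
    positivity
  have hz2 : 0 < (2 * z).im := by simpa using hz
  have h1 := hasSum_jacobiTheta₂_term 0 hτ
  rw [← jacobiTheta_eq_jacobiTheta₂, ← (Int.divModEquiv N).symm.hasSum_iff,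
    ← (Equiv.prodComm (Fin N) ℤ).hasSum_iff] at h1
  have hinner (r : Fin N) : HasSum (fun m : ℤ => jacobiTheta₂_term (m * N + (r : ℕ)) 0
      (2 * (b / N + -1 / (4 * z) / N ^ 2)))
      (ZMod.stdAddChar ((b : ZMod N) * ((r : ℕ) : ZMod N) ^ 2) *
        ((-2 * Complex.I * z) ^ (1 / 2 : ℂ) * jacobiTheta₂ ((r : ℕ) / N) (2 * z))) := by
    have h2 := hasSum_jacobiTheta₂_term (((r : ℕ) / N : ℂ) / (2 * z)) hw
    have h3 : jacobiTheta₂ (((r : ℕ) / N : ℂ) / (2 * z)) (-1 / (2 * z)) =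
        Complex.exp (Real.pi * Complex.I * ((r : ℕ) / N) ^ 2 / (2 * z)) *
        ((-2 * Complex.I * z) ^ (1 / 2 : ℂ) * jacobiTheta₂ ((r : ℕ) / N) (2 * z)) := by
      rw [jacobiTheta₂_functional_equation ((r : ℕ) / N) (2 * z)]
      rw [show -Complex.I * (2 * z) = -2 * Complex.I * z by ring, ← mul_assoc, ← mul_assoc,
        ← mul_assoc, mul_one_div, ]
      rw [mul_div_cancel_right₀ _ hu2, ← Complex.exp_add]
      simp [neg_mul, neg_div]
    rw [h3, ← (Equiv.neg ℤ).hasSum_iff] at h2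
    have h4 := h2.mul_left (ZMod.stdAddChar ((b : ZMod N) * ((r : ℕ) : ZMod N) ^ 2) *
      Complex.exp (-(Real.pi * Complex.I * ((r : ℕ) / N) ^ 2 / (2 * z))))
    have e1 : ((b : ZMod N) * ((r : ℕ) : ZMod N) ^ 2) = ((b * (r : ℕ) ^ 2 : ℤ) : ZMod N) := by
      push_cast; ring
    have e0 (A x B : ℂ) : A * Complex.exp (-x) * (Complex.exp x * B) = A * B := by
      rw [mul_assoc, ← mul_assoc (Complex.exp _), ← Complex.exp_add, neg_add_cancel,
        Complex.exp_zero, one_mul]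
    rw [e0] at h4
    refine (hasSum_congr_terms fun m => ?_).mpr h4
    · simp only [Function.comp_apply, Equiv.neg_apply, jacobiTheta₂_term]
      rw [e1, ZMod.stdAddChar_coe, ← Complex.exp_add, ← Complex.exp_add, Complex.exp_eq_exp_iff_exists_int]
      -- The integer b(mN + r)²/N - br²/N.
      refine ⟨b * m ^ 2 * N + 2 * b * m * (r : ℕ), ?_⟩
      push_cast
      field_simp
      ring
  have h5 := h1.prod_fiberwise hinner
  have h6 := h5.unique (hasSum_fintype _)
  have h7 : HasSum (fun m : ℤ => ∑ r : Fin N, ZMod.stdAddChar ((b : ZMod N) *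
      ((r : ℕ) : ZMod N) ^ 2) * ((-2 * Complex.I * z) ^ (1 / 2 : ℂ) *
        jacobiTheta₂_term m ((r : ℕ) / N) (2 * z))) _ :=
    hasSum_sum fun r _ => ((hasSum_jacobiTheta₂_term ((r : ℕ) / N) hz2).mul_left
      ((-2 * Complex.I * z) ^ (1 / 2 : ℂ))).mul_left
        (ZMod.stdAddChar ((b : ZMod N) * ((r : ℕ) : ZMod N) ^ 2))
  rw [← h6] at h7
  refine h7.unique ?_
  have h8 := (hasSum_jacobiTheta₂_term 0 hτ').mul_left
    (quadSum (b : ZMod N) * (-2 * Complex.I * z) ^ (1 / 2 : ℂ))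
  rw [← jacobiTheta_eq_jacobiTheta₂] at h8
  refine (hasSum_congr_terms fun m => ?_).mpr h8
  have e2 (r : Fin N) : jacobiTheta₂_term m ((r : ℕ) / N) (2 * z) =
      ZMod.stdAddChar ((m : ZMod N) * ((r : ℕ) : ZMod N)) * Complex.exp (2 * Real.pi * Complex.I * m ^ 2 * z) := by
    have : ((m : ZMod N) * ((r : ℕ) : ZMod N)) = ((m * (r : ℕ) : ℤ) : ZMod N) := by push_cast; ring
    rw [this, ZMod.stdAddChar_coe, ← Complex.exp_add, jacobiTheta₂_term]
    congr 1
    push_cast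
    ring
  have e3 : jacobiTheta₂_term m 0 (2 * (z + h / N)) =
      ZMod.stdAddChar ((h : ZMod N) * (m : ZMod N) ^ 2) * Complex.exp (2 * Real.pi * Complex.I * m ^ 2 * z) := by
    have : ((h : ZMod N) * (m : ZMod N) ^ 2) = ((h * m ^ 2 : ℤ) : ZMod N) := by push_cast; ring
    rw [this, ZMod.stdAddChar_coe, ← Complex.exp_add, jacobiTheta₂_term]
    congr 1
    push_cast
    ring
  rw [e3]
  simp only [e2]
  have h9 := sum_stdAddChar_sq_add (b : ZMod N) h m hbh
  rw [← sum_fin_cast] at h9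
  calc _ = (∑ r : Fin N, (ZMod.stdAddChar ((b : ZMod N) * ((r : ℕ) : ZMod N) ^ 2) *
          ZMod.stdAddChar ((m : ZMod N) * ((r : ℕ) : ZMod N)) : ℂ)) *
        ((-2 * Complex.I * z) ^ (1 / 2 : ℂ) * Complex.exp (2 * Real.pi * Complex.I * m ^ 2 * z)) := by
        rw [Finset.sum_mul]
        exact Finset.sum_congr rfl fun r _ => by ring
    _ = _ := by rw [h9]; ring

lemma exists_eq_mul_of_mul_eq_zero {p : ℕ} [Fact p.Prime] {r : ZMod (p ^ 2)}
    (hr : (p : ZMod (p ^ 2)) * r = 0) : ∃ s : ℕ, s < p ∧ r = (p : ZMod (p ^ 2)) * (s : ZMod (p ^ 2)) := by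
  have hd : p * p ∣ p * r.val := by
    rw [← sq p, ← ZMod.natCast_eq_zero_iff]
    simpa using hr
  rw [Nat.mul_dvd_mul_iff_left (Fact.out : p.Prime).pos] at hd
  obtain ⟨s, hs⟩ := hd
  have hlt : r.val < p * p := (ZMod.val_lt r).trans_eq (sq p)
  rw [hs] at hlt
  exact ⟨s, Nat.lt_of_mul_lt_mul_left hlt,
    by rw [← Nat.cast_mul, ← hs, ZMod.natCast_zmod_val]⟩

/-- The sum is averaged over the shifts r ↦ r + py, which change br² only by 2bpry because p² = 0.
The sum over y eliminates every r not divisible by p, and the p remaining residues contribute 1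
each. -/
lemma quadSum_prime_sq {p : ℕ} [Fact p.Prime] (hp : p ≠ 2) {b : ZMod (p ^ 2)} (hb : IsUnit b) :
    quadSum b = p := by
  have hp0 : (p : ℂ) ≠ 0 := Nat.cast_ne_zero.mpr (Fact.out : p.Prime).ne_zero
  have hpp : (p : ZMod (p ^ 2)) * p = 0 := by
    rw [← Nat.cast_mul, ← sq, ZMod.natCast_self]
  have h2 : IsUnit (2 : ZMod (p ^ 2)) := by
    have : ((2 : ℕ) : ZMod (p ^ 2)) = 2 := by norm_num
    rw [← this, ZMod.isUnit_iff_coprime]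
    exact ((Nat.coprime_primes Nat.prime_two Fact.out).mpr hp.symm).pow_right 2
  have h1 (y : ZMod (p ^ 2)) : quadSum b = ∑ r : ZMod (p ^ 2),
      (ZMod.stdAddChar (b * r ^ 2) * ZMod.stdAddChar (y * (2 * b * (p : ZMod (p ^ 2)) * r)) : ℂ) := by
    rw [quadSum, ← Equiv.sum_comp (Equiv.addRight (p * y))]
    refine Finset.sum_congr rfl fun r _ => ?_
    rw [← AddChar.map_add_eq_mul]
    congr 1
    simp only [Equiv.coe_addRight]
    linear_combination b * y ^ 2 * hpp
  have h3 : ((p : ℂ) ^ 2) * quadSum b = ((p : ℂ) ^ 2) * p := by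
    calc ((p : ℂ) ^ 2) * quadSum b = ∑ y : ZMod (p ^ 2), quadSum b := by
          simp [ZMod.card]
      _ = ∑ r : ZMod (p ^ 2), (ZMod.stdAddChar (b * r ^ 2) *
            ∑ y : ZMod (p ^ 2), ZMod.stdAddChar (y * (2 * b * (p : ZMod (p ^ 2)) * r)) : ℂ) := by
          rw [Finset.sum_congr rfl fun y _ => h1 y, Finset.sum_comm]
          exact Finset.sum_congr rfl fun r _ => (Finset.mul_sum _ _ _).symm
      _ = ∑ r : ZMod (p ^ 2), if (p : ZMod (p ^ 2)) * r = 0 then (p : ℂ) ^ 2 else 0 := by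
          refine Finset.sum_congr rfl fun r _ => ?_
          rw [AddChar.sum_mulShift _ (ZMod.isPrimitive_stdAddChar _), ZMod.card]
          have e : 2 * b * p * r = 0 ↔ (p : ZMod (p ^ 2)) * r = 0 := by
            rw [mul_assoc, (h2.mul hb).mul_right_eq_zero]
          by_cases hr : (p : ZMod (p ^ 2)) * r = 0
          · obtain ⟨s, -, rfl⟩ := exists_eq_mul_of_mul_eq_zero hr
            have : b * ((p : ZMod (p ^ 2)) * (s : ZMod (p ^ 2))) ^ 2 = 0 := by linear_combination b * s ^ 2 * hpp
            rw [if_pos (e.mpr hr), if_pos hr, this]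
            simp
          · rw [if_neg (fun h => hr (e.mp h)), if_neg hr]
            simp
      _ = ((p : ℂ) ^ 2) * p := by
          rw [← Finset.sum_filter, Finset.sum_const, nsmul_eq_mul, mul_comm]
          congr 2
          refine Eq.trans ?_ (Finset.card_fin p)
          symm
          refine Finset.card_bij (fun s _ => (p : ZMod (p ^ 2)) * (s : ℕ)) (fun s _ => ?_)
            (fun s _ t _ hst => ?_) (fun r hr => ?_)
          · simp only [Finset.mem_filter, Finset.mem_univ, true_and]
            rw [← mul_assoc, hpp, zero_mul]
          · rw [← Nat.cast_mul, ← Nat.cast_mul, ZMod.natCast_eq_natCast_iff', sq,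
              Nat.mul_mod_mul_left, Nat.mul_mod_mul_left, Nat.mod_eq_of_lt s.2,
              Nat.mod_eq_of_lt t.2] at hst
            exact Fin.ext (Nat.eq_of_mul_eq_mul_left (Fact.out : p.Prime).pos hst)
          · obtain ⟨s, hs, rfl⟩ := exists_eq_mul_of_mul_eq_zero (by simpa using hr)
            exact ⟨⟨s, hs⟩, Finset.mem_univ _, rfl⟩
  exact mul_left_cancel₀ (pow_ne_zero 2 hp0) h3

variable (p : ℕ) [Fact p.Prime]

/-- The complex-valued quadratic character modulo `p`. -/
def legendreChar : MulChar (ZMod p) ℂ := (quadraticChar (ZMod p)).ringHomComp (Int.castRingHom ℂ)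

/-- The Gauss sum of the quadratic character modulo `p`. -/
def legendreGauss : ℂ := gaussSum (legendreChar p) ZMod.stdAddChar

lemma legendreChar_apply (a : ZMod p) : legendreChar p a = (quadraticChar (ZMod p) a : ℂ) := rfl

variable {p}

lemma legendreChar_ne_one (hp : p ≠ 2) : legendreChar p ≠ 1 := by
  rw [legendreChar, Ne, MulChar.ringHomComp_eq_one_iff Int.cast_injective]
  exact quadraticChar_ne_one (by rwa [ZMod.ringChar_zmod_n])

lemma legendreChar_isQuadratic : (legendreChar p).IsQuadratic :=
  (quadraticChar_isQuadratic _).comp _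

lemma legendreGauss_sq (hp : p ≠ 2) : legendreGauss p ^ 2 = legendreChar p (-1) * p := by
  have h := gaussSum_sq (legendreChar_ne_one hp) legendreChar_isQuadratic
    (ZMod.isPrimitive_stdAddChar p)
  rwa [ZMod.card] at h

lemma legendreChar_neg_one_sq : legendreChar p (-1) ^ 2 = 1 := by
  rw [← map_pow]; simp

lemma legendreGauss_ne_zero (hp : p ≠ 2) : legendreGauss p ≠ 0 := by
  intro h
  have h1 := legendreGauss_sq hp
  rw [h] at h1
  have h2 := legendreChar_neg_one_sq (p := p)
  have hp0 : (p : ℂ) ≠ 0 := Nat.cast_ne_zero.mpr (Fact.out : p.Prime).ne_zero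
  have h3 : legendreChar p (-1) = 0 := by simpa [hp0] using h1
  simp [h3] at h2

lemma legendreChar_mul_self {a : ZMod p} (ha : a ≠ 0) :
    legendreChar p a * legendreChar p a = 1 := by
  rw [legendreChar_apply, ← sq]
  exact_mod_cast quadraticChar_sq_one ha

lemma sum_legendreChar_mul (hp : p ≠ 2) (a : ZMod p) :
    ∑ h : ZMod p, legendreChar p h * ZMod.stdAddChar (a * h) =
      legendreChar p a * legendreGauss p := by
  by_cases ha : a = 0
  · subst ha
    simp only [zero_mul, AddChar.map_zero_eq_one, mul_one]
    rw [MulChar.sum_eq_zero_of_ne_one (legendreChar_ne_one hp), MulChar.map_zero, zero_mul]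
  · have h1 := gaussSum_mulShift (legendreChar p) ZMod.stdAddChar (Units.mk0 a ha)
    rw [legendreGauss, ← h1, ← mul_assoc, Units.val_mk0, legendreChar_mul_self ha, one_mul,
      gaussSum]
    simp [AddChar.mulShift_apply]

/-- A residue a has 1 + χ(a) square roots. -/
lemma sum_comp_sq (hp : p ≠ 2) (F : ZMod p → ℂ) :
    ∑ r : ZMod p, F (r ^ 2) = ∑ a : ZMod p, (legendreChar p a + 1) * F a := by
  rw [← Finset.sum_fiberwise_of_maps_to (s := Finset.univ) (t := Finset.univ)
    (g := fun r : ZMod p => r ^ 2) (fun _ _ => Finset.mem_univ _)]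
  refine Finset.sum_congr rfl fun a _ => ?_
  have h1 := quadraticChar_card_sqrts (F := ZMod p) (by rwa [ZMod.ringChar_zmod_n]) a
  rw [Finset.sum_congr rfl (g := fun _ => F a) (fun r hr => by
    rw [(Finset.mem_filter.mp hr).2]), Finset.sum_const, nsmul_eq_mul, legendreChar_apply]
  congr 1
  rw [Set.toFinset_ofPred] at h1
  exact_mod_cast congrArg (Int.cast : ℤ → ℂ) h1

lemma quadSum_prime (hp : p ≠ 2) {b : ZMod p} (hb : b ≠ 0) :
    quadSum b = legendreChar p b * legendreGauss p := by
  rw [quadSum, sum_comp_sq hp fun a => ZMod.stdAddChar (b * a)]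
  simp only [add_mul, one_mul, Finset.sum_add_distrib]
  rw [sum_legendreChar_mul hp]
  have h := AddChar.sum_mulShift b (ZMod.isPrimitive_stdAddChar p)
  simp only [hb, if_false, Nat.cast_zero, mul_comm _ b] at h
  rw [h, add_zero]

end GaussSums

/-! ### Extension to the complex plane -/

/-- A function on the upper half-plane as a function of a complex variable. -/
def lift (f : ℍ → ℂ) (w : ℂ) : ℂ := f (ofComplex w)

lemma lift_coe (f : ℍ → ℂ) (z : ℍ) : lift f z = f z := by rw [lift, ofComplex_apply]

lemma lift_of_im_pos (f : ℍ → ℂ) {w : ℂ} (hw : 0 < w.im) : lift f w = f ⟨w, hw⟩ := by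
  rw [lift, ofComplex_apply_of_im_pos hw]

lemma im_neg_inv_pos {z : ℂ} (hz : 0 < z.im) : 0 < (-1 / (4 * z)).im :=
  frickePoint_im_pos ⟨z, hz⟩

section Lift

variable {k : ℤ} {ε : ℂ} {f : ℍ → ℂ}

lemma lift_add_int (hf : f ∈ cuspForms k) (w : ℂ) (n : ℤ) : lift f (w + n) = lift f w := by
  have h := (periodic_of_vadd (vadd_one_of_mem hf)).int_mul n w
  simpa [lift] using h

lemma lift_neg_inv (hf : f ∈ frickeSpace k ε) {w : ℂ} (hw : 0 < w.im) :
    lift f (-1 / (4 * w)) = ε * (-2 * Complex.I * w) ^ ((k : ℂ) + 1 / 2) * lift f w := by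
  rw [lift_of_im_pos f (im_neg_inv_pos hw), lift_of_im_pos f hw]
  exact frickePoint_of_mem hf ⟨w, hw⟩

/-- A matrix in Γ₀(4) carries the Fricke image of z + h/N to the point on the left, so the quotient
f/θ^{2k+1} is known there up to ε. The value of θ itself comes from `theta_quadSum`, and its
(2k+1)-st power brings in the Gauss sum. -/
lemma lift_quadSum (hf : f ∈ frickeSpace k ε) {N : ℕ} [NeZero N] {b h : ℤ}
    (hbh : (4 * b * h : ZMod N) = -1) {z : ℂ} (hz : 0 < z.im) :
    lift f (b / N + -1 / (4 * z) / N ^ 2) =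
      ε * quadSum (b : ZMod N) ^ (2 * k + 1) * (-2 * Complex.I * z) ^ ((k : ℂ) + 1 / 2) *
        lift f (z + h / N) := by
  have hN : (N : ℂ) ≠ 0 := Nat.cast_ne_zero.mpr (NeZero.ne N)
  have hNr : (0 : ℝ) < N := Nat.cast_pos.mpr (NeZero.pos N)
  have hz0 : z ≠ 0 := by rintro rfl; simp at hz
  have h1 : 0 < (z + h / N : ℂ).im := by
    have e : (h / N : ℂ) = ((h / N : ℝ) : ℂ) := by push_cast; ring
    rw [e, Complex.add_im, Complex.ofReal_im, add_zero]
    exact hz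
  have h2 : 0 < (b / N + -1 / (4 * z) / N ^ 2 : ℂ).im := by
    have e : (b / N + -1 / (4 * z) / N ^ 2 : ℂ) =
        ((b / N : ℝ) : ℂ) + ((1 / N ^ 2 : ℝ) : ℂ) * (-1 / (4 * z)) := by push_cast; ring
    rw [e, Complex.add_im, Complex.ofReal_im, Complex.im_ofReal_mul, zero_add]
    have := im_neg_inv_pos hz
    positivity
  set P : ℍ := ⟨z + h / N, h1⟩ with hP
  set Q : ℍ := ⟨b / N + -1 / (4 * z) / N ^ 2, h2⟩ with hQ
  -- The entry a is forced by the determinant condition aN - 4bh = 1.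
  obtain ⟨a, ha⟩ : (N : ℤ) ∣ 4 * b * h + 1 := by
    rw [← ZMod.intCast_zmod_eq_zero_iff_dvd]
    push_cast
    rw [hbh]; ring
  let γ : SL(2, ℤ) := ⟨!![a, b; 4 * h, N], by rw [Matrix.det_fin_two_of]; linarith⟩
  have hγ : γ ∈ CongruenceSubgroup.Gamma0 4 := by
    rw [CongruenceSubgroup.Gamma0_mem]
    have : γ 1 0 = 4 * h := rfl
    rw [this]
    push_cast
    rw [show (4 : ZMod 4) = 0 by decide, zero_mul]
  have haC : (N * a : ℂ) = 4 * b * h + 1 := by exact_mod_cast ha.symm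
  have hPQ : γ • frickePoint P = Q := by
    apply UpperHalfPlane.ext
    have h0 : (z + h / N : ℂ) ≠ 0 := by intro h; rw [h] at h1; simp at h1
    have h0' : (N * z + h : ℂ) ≠ 0 := by
      have : (N * z + h : ℂ) = N * (z + h / N) := by field_simp
      rw [this]; exact mul_ne_zero hN h0
    obtain ⟨D, hD⟩ : ∃ D, D = (N * z + h : ℂ) := ⟨_, rfl⟩
    have hzD : z = (D - h) / N := by rw [hD]; field_simp; ring
    have e1 : -1 / (4 * (z + h / N)) = -N / (4 * D) := by rw [hzD]; field_simp; ring
    have hD0 : D ≠ 0 := hD ▸ h0'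
    have hDh : D - h ≠ 0 := fun h => hz0 (by rw [hzD, h, zero_div])
    have hden : (4 * h : ℂ) * (-N / (4 * D)) + N ≠ 0 := by
      have : (4 * h : ℂ) * (-N / (4 * D)) + N = N * (D - h) / D := by
        field_simp
        ring
      rw [this]
      exact div_ne_zero (mul_ne_zero hN hDh) hD0
    rw [coe_specialLinearGroup_apply, coe_frickePoint]
    simp only [γ, hP, hQ, Matrix.of_apply, Matrix.cons_val',
      Matrix.cons_val_zero, Matrix.cons_val_one, Matrix.cons_val_fin_one, eq_intCast]
    push_cast
    rw [e1, div_eq_iff (by simpa using hden), hzD]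
    field_simp
    linear_combination (h - D) * haC
  have h3 := thetaRatio_smul hf.1 hγ (frickePoint P)
  rw [hPQ, thetaRatio_frickePoint P (frickePoint_of_mem hf P)] at h3
  have h4 : theta Q = quadSum (b : ZMod N) * (-2 * Complex.I * z) ^ (1 / 2 : ℂ) * theta P :=
    theta_quadSum hbh hz
  rw [lift_of_im_pos f h1, lift_of_im_pos f h2, ← thetaRatio_mul k f Q, h3, h4, mul_zpow, mul_zpow,
    cpow_half_zpow, ← thetaRatio_mul k f P]
  ring

end Lift

/-- A positive factor does not change the argument, so it leaves the principal power, and its square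
root is rational in r. -/
lemma sq_mul_cpow {r : ℝ} (hr : 0 < r) (k : ℤ) {u : ℂ} (hu : u ≠ 0) :
    ((r : ℂ) ^ 2 * u) ^ ((k : ℂ) + 1 / 2) = (r : ℂ) ^ (2 * k + 1) * u ^ ((k : ℂ) + 1 / 2) := by
  have hr0 : (r : ℂ) ≠ 0 := Complex.ofReal_ne_zero.mpr hr.ne'
  rw [Complex.cpow_def_of_ne_zero (mul_ne_zero (pow_ne_zero 2 hr0) hu),
    Complex.cpow_def_of_ne_zero hu, ← Complex.ofReal_pow, Complex.log_ofReal_mul (pow_pos hr 2) hu,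
    Real.log_pow, ← Complex.cpow_intCast, Complex.cpow_def_of_ne_zero hr0, ← Complex.exp_add,
    Complex.ofReal_mul, Complex.ofReal_log hr.le]
  congr 1
  push_cast
  ring

/-! ### Classes of integer vectors modulo `p²` -/

lemma intCast_eq_iff_sq_dvd {p : ℕ} (x y : ℤ) :
    (x : ZMod (p ^ 2)) = y ↔ (p : ℤ) ^ 2 ∣ y - x := by
  rw [ZMod.intCast_eq_intCast_iff_dvd_sub]
  push_cast
  rfl

section Classes

variable (p : ℕ) [Fact p.Prime]

/-- Indices of the cosets occurring in `T(p²)`. -/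
abbrev HeckeIndex (p : ℕ) : Type := ZMod (p ^ 2) ⊕ ZMod p

/-- The index attached to the bottom row `(c, d)` of a matrix. -/
def heckeClass (c d : ℤ) : HeckeIndex p :=
  if (p : ℤ) ∣ c then .inr ((d : ZMod p) * ((c / p : ℤ) : ZMod p)⁻¹)
  else .inl ((d : ZMod (p ^ 2)) * (c : ZMod (p ^ 2))⁻¹)

/-- A bottom row with given index. -/
def heckeRow : HeckeIndex p → ℤ × ℤ
  | .inl b => (1, b.cast)
  | .inr h => if h = 0 then (0, 1) else (p, h.cast)

variable {p}

lemma prime_int : Prime (p : ℤ) := Nat.prime_iff_prime_int.mp Fact.out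

lemma prime_cast_ne_zero : (p : ℤ) ≠ 0 := prime_int.ne_zero

lemma isUnit_intCast_of_not_dvd {c : ℤ} (hc : ¬ (p : ℤ) ∣ c) : IsUnit (c : ZMod (p ^ 2)) := by
  obtain ⟨a, b, hab⟩ := ((prime_int.coprime_iff_not_dvd).mpr hc).pow_left (m := 2)
  refine IsUnit.of_mul_eq_one (b : ZMod (p ^ 2)) ?_
  have h := congrArg (Int.cast : ℤ → ZMod (p ^ 2)) hab
  push_cast at h
  have h0 : (p : ZMod (p ^ 2)) ^ 2 = 0 := by
    rw [← Nat.cast_pow, ZMod.natCast_self]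
  rw [h0] at h
  linear_combination h

lemma intCast_ne_zero_iff {x : ℤ} : (x : ZMod p) ≠ 0 ↔ ¬ (p : ℤ) ∣ x := by
  rw [Ne, ZMod.intCast_zmod_eq_zero_iff_dvd]

/-- `heckeClass` is a coordinate on the projective line over ℤ/p², which has p² + p points, and two
rows define the same point when their determinant vanishes. The charts are d/c for p ∤ c and d/(c/p)
mod p for p ∣ c. -/
lemma heckeClass_eq_iff {c d c' d' : ℤ} (h : ¬((p : ℤ) ∣ c ∧ (p : ℤ) ∣ d))
    (h' : ¬((p : ℤ) ∣ c' ∧ (p : ℤ) ∣ d')) :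
    heckeClass p c d = heckeClass p c' d' ↔ (p : ℤ) ^ 2 ∣ c * d' - d * c' := by
  have hp := prime_int (p := p)
  have hp2 : (p : ℤ) ∣ (p : ℤ) ^ 2 := dvd_pow_self _ two_ne_zero
  by_cases hc : (p : ℤ) ∣ c <;> by_cases hc' : (p : ℤ) ∣ c'
  · obtain ⟨e, rfl⟩ := hc
    obtain ⟨e', rfl⟩ := hc'
    have hd : ¬ (p : ℤ) ∣ d := fun hd => h ⟨dvd_mul_right _ _, hd⟩
    have hd' : ¬ (p : ℤ) ∣ d' := fun hd => h' ⟨dvd_mul_right _ _, hd⟩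
    have h1 : (p : ℤ) * e * d' - d * (p * e') = p * (e * d' - d * e') := by ring
    rw [heckeClass, heckeClass, if_pos (dvd_mul_right _ _), if_pos (dvd_mul_right _ _),
      Int.mul_ediv_cancel_left _ prime_cast_ne_zero, Int.mul_ediv_cancel_left _ prime_cast_ne_zero,
      Sum.inr.injEq, h1, sq, mul_dvd_mul_iff_left prime_cast_ne_zero,
      ← ZMod.intCast_zmod_eq_zero_iff_dvd]
    push_cast
    have hdz := intCast_ne_zero_iff.mpr hd
    have hdz' := intCast_ne_zero_iff.mpr hd'
    -- The convention 0⁻¹ = 0 reserves the index 0 for p² ∣ c; since p ∤ d, no other row takes this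
    -- value.
    by_cases he : (e : ZMod p) = 0 <;> by_cases he' : (e' : ZMod p) = 0
    · simp [he, he']
    · simp [hdz, hdz', he, he']
    · simp [hdz, hdz', he, he']
    · rw [← div_eq_mul_inv, ← div_eq_mul_inv, div_eq_div_iff he he', sub_eq_zero]
      constructor <;> intro h <;> linear_combination -h
  · rw [heckeClass, heckeClass, if_pos hc, if_neg hc']
    refine iff_of_false (by simp) fun hdv => ?_
    have h1 : (p : ℤ) ∣ d * c' := by
      have := dvd_sub (hc.mul_right d') (hp2.trans hdv)
      simpa using this
    exact (hp.dvd_or_dvd h1).elim (fun hd => h ⟨hc, hd⟩) hc'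
  · rw [heckeClass, heckeClass, if_neg hc, if_pos hc']
    refine iff_of_false (by simp) fun hdv => ?_
    have h1 : (p : ℤ) ∣ c * d' := by
      have := dvd_add (hp2.trans hdv) (hc'.mul_left d)
      simpa using this
    exact (hp.dvd_or_dvd h1).elim hc fun hd => h' ⟨hc', hd⟩
  · have hu := isUnit_intCast_of_not_dvd hc
    have hu' := isUnit_intCast_of_not_dvd hc'
    have e1 := ZMod.mul_inv_of_unit _ hu
    have e2 := ZMod.mul_inv_of_unit _ hu'
    rw [heckeClass, heckeClass, if_neg hc, if_neg hc', Sum.inl.injEq, ← intCast_eq_iff_sq_dvd]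
    push_cast
    constructor
    · intro h
      have := congrArg (fun x => (c : ZMod (p ^ 2)) * c' * x) h
      linear_combination this - d * c' * e1 + d' * c * e2
    · intro h
      have := congrArg (fun x => (c : ZMod (p ^ 2))⁻¹ * (c' : ZMod (p ^ 2))⁻¹ * x) h
      linear_combination this + d' * (c' : ZMod (p ^ 2))⁻¹ * e1 - d * (c : ZMod (p ^ 2))⁻¹ * e2

lemma heckeRow_primitive (x : HeckeIndex p) :
    ¬((p : ℤ) ∣ (heckeRow p x).1 ∧ (p : ℤ) ∣ (heckeRow p x).2) := by
  have hp1 : ¬ (p : ℤ) ∣ 1 := prime_int.not_dvd_one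
  rcases x with b | h
  · exact fun h => hp1 h.1
  · by_cases hh : h = 0
    · rw [heckeRow, if_pos hh]; exact fun h => hp1 h.2
    · rw [heckeRow, if_neg hh]
      intro hd
      refine hh ?_
      rw [← ZMod.intCast_zmod_cast h]
      exact (ZMod.intCast_zmod_eq_zero_iff_dvd _ _).mpr hd.2

lemma heckeClass_heckeRow (x : HeckeIndex p) :
    heckeClass p (heckeRow p x).1 (heckeRow p x).2 = x := by
  rcases x with b | h
  · rw [heckeRow, heckeClass, if_neg prime_int.not_dvd_one]
    simp
  · by_cases hh : h = 0
    · rw [heckeRow, if_pos hh, heckeClass, if_pos (dvd_zero _)]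
      simp [hh]
    · rw [heckeRow, if_neg hh, heckeClass, if_pos dvd_rfl, Int.ediv_self prime_cast_ne_zero]
      simp

lemma heckeClass_mul {c d m : ℤ} (hm : ¬ (p : ℤ) ∣ m) (h : ¬((p : ℤ) ∣ c ∧ (p : ℤ) ∣ d)) :
    heckeClass p (m * c) (m * d) = heckeClass p c d := by
  rw [heckeClass_eq_iff (fun h1 => h ⟨(prime_int.dvd_or_dvd h1.1).resolve_left hm,
    (prime_int.dvd_or_dvd h1.2).resolve_left hm⟩) h]
  exact ⟨0, by ring⟩

lemma not_dvd_four (hp : p ≠ 2) : ¬ (p : ℤ) ∣ 4 := by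
  intro h
  have h1 : (p : ℤ) ∣ 2 ^ 2 := by simpa using h
  have h2 : p ∣ 2 := by exact_mod_cast prime_int.dvd_of_dvd_pow h1
  exact hp ((Nat.prime_dvd_prime_iff_eq Fact.out Nat.prime_two).mp h2)

/-- Summation over indices is invariant under `(c, d) ↦ (c, c + d)`. -/
lemma sum_heckeClass_shear {M : Type*} [AddCommMonoid M] (F : HeckeIndex p → M) :
    ∑ x, F (heckeClass p (heckeRow p x).1 ((heckeRow p x).1 + (heckeRow p x).2)) = ∑ x, F x := by
  have hprim (x : HeckeIndex p) : ¬((p : ℤ) ∣ (heckeRow p x).1 ∧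
      (p : ℤ) ∣ (heckeRow p x).1 + (heckeRow p x).2) := fun h =>
    heckeRow_primitive x ⟨h.1, (dvd_add_right h.1).mp h.2⟩
  refine Fintype.sum_bijective _ ((Finite.injective_iff_bijective).mp fun x y hxy => ?_) _ _
    fun _ => rfl
  rw [heckeClass_eq_iff (hprim x) (hprim y)] at hxy
  rw [← heckeClass_heckeRow x, ← heckeClass_heckeRow y,
    heckeClass_eq_iff (heckeRow_primitive x) (heckeRow_primitive y)]
  obtain ⟨t, ht⟩ := hxy
  exact ⟨t, by linear_combination ht⟩

/-- Summation over indices is invariant under `(c, d) ↦ (4d, -c)`. -/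
lemma sum_heckeClass_fricke (hp : p ≠ 2) {M : Type*} [AddCommMonoid M] (F : HeckeIndex p → M) :
    ∑ x, F (heckeClass p (4 * (heckeRow p x).2) (-(heckeRow p x).1)) = ∑ x, F x := by
  have hprim (x : HeckeIndex p) : ¬((p : ℤ) ∣ 4 * (heckeRow p x).2 ∧
      (p : ℤ) ∣ -(heckeRow p x).1) := fun h =>
    heckeRow_primitive x ⟨(dvd_neg).mp h.2,
      (prime_int.dvd_or_dvd h.1).resolve_left (not_dvd_four hp)⟩
  refine Fintype.sum_bijective _ ((Finite.injective_iff_bijective).mp fun x y hxy => ?_) _ _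
    fun _ => rfl
  rw [heckeClass_eq_iff (hprim x) (hprim y)] at hxy
  rw [← heckeClass_heckeRow x, ← heckeClass_heckeRow y,
    heckeClass_eq_iff (heckeRow_primitive x) (heckeRow_primitive y)]
  have h4 : IsCoprime ((p : ℤ) ^ 2) 4 :=
    ((prime_int.coprime_iff_not_dvd).mpr (not_dvd_four hp)).pow_left
  refine h4.dvd_of_dvd_mul_left ?_
  obtain ⟨t, ht⟩ := hxy
  exact ⟨t, by linear_combination ht⟩

end Classes

/-! ### The terms of the Hecke operator -/

section HeckeTerms

variable (k : ℤ) (p : ℕ) [Fact p.Prime] (f : ℍ → ℂ)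

/-- The constant in front of the twisted terms of `T(p²)`. -/
def heckeConst : ℂ := (p : ℂ) ^ (k - 1) * legendreChar p (-1) ^ k / legendreGauss p

/-- The terms of the Hecke operator `T(p²)`, indexed by cosets. -/
def heckeTerm : HeckeIndex p → ℂ → ℂ
  | .inl b, z => (p : ℂ) ^ (-2 : ℤ) * lift f ((z + (b.cast : ℤ)) / p ^ 2)
  | .inr h, z =>
    if h = 0 then (p : ℂ) ^ (2 * k - 1) * lift f (p ^ 2 * z)
    else heckeConst k p * legendreChar p h * lift f (z + (h.cast : ℤ) / p)

variable {k p f} {ε : ℂ}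

lemma prime_natCast_ne_zero : (p : ℂ) ≠ 0 := Nat.cast_ne_zero.mpr (Fact.out : p.Prime).ne_zero

lemma prime_pos : (0 : ℝ) < p := Nat.cast_pos.mpr (Fact.out : p.Prime).pos

lemma heckeTerm_inl (hf : f ∈ cuspForms k) {m : ℤ} {b : ZMod (p ^ 2)} (hm : (m : ZMod (p ^ 2)) = b)
    (z : ℂ) : heckeTerm k p f (.inl b) z = (p : ℂ) ^ (-2 : ℤ) * lift f ((z + m) / p ^ 2) := by
  have hp0 := prime_natCast_ne_zero (p := p)
  obtain ⟨t, ht⟩ := (intCast_eq_iff_sq_dvd (p := p) m b.cast).mp (by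
    rw [hm, ZMod.intCast_zmod_cast])
  have e : ((z + (b.cast : ℤ)) / p ^ 2 : ℂ) = (z + m) / p ^ 2 + (t : ℤ) := by
    have h1 : ((b.cast : ℤ) : ℂ) = m + p ^ 2 * t := by
      rw [show (b.cast : ℤ) = m + p ^ 2 * t by linarith]; push_cast; ring
    rw [h1]
    field_simp
    ring
  rw [heckeTerm, e, lift_add_int hf]

lemma heckeTerm_inr_zero (z : ℂ) :
    heckeTerm k p f (.inr 0) z = (p : ℂ) ^ (2 * k - 1) * lift f (p ^ 2 * z) := by
  rw [heckeTerm, if_pos rfl]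

lemma heckeTerm_inr (hf : f ∈ cuspForms k) {m : ℤ} {h : ZMod p} (hm : (m : ZMod p) = h)
    (hh : h ≠ 0) (z : ℂ) :
    heckeTerm k p f (.inr h) z = heckeConst k p * legendreChar p h * lift f (z + m / p) := by
  have hp0 := prime_natCast_ne_zero (p := p)
  obtain ⟨t, ht⟩ := (ZMod.intCast_eq_intCast_iff_dvd_sub m h.cast p).mp (by
    rw [hm, ZMod.intCast_zmod_cast])
  have e : (z + (h.cast : ℤ) / p : ℂ) = z + m / p + (t : ℤ) := by
    have h1 : ((h.cast : ℤ) : ℂ) = m + p * t := by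
      rw [show (h.cast : ℤ) = m + p * t by linarith]; push_cast; ring
    rw [h1]
    field_simp
    ring
  rw [heckeTerm, if_neg hh, e, lift_add_int hf]

/-- For p ∤ c the translation adds 1 to d/c. For p ∣ c the index does not move and the periodicity
of f suffices. -/
lemma heckeTerm_add_one (hf : f ∈ cuspForms k) {c d : ℤ} (hcd : ¬((p : ℤ) ∣ c ∧ (p : ℤ) ∣ d))
    (z : ℂ) : heckeTerm k p f (heckeClass p c d) (z + 1) =
      heckeTerm k p f (heckeClass p c (c + d)) z := by
  have hp0 := prime_natCast_ne_zero (p := p)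
  by_cases hc : (p : ℤ) ∣ c
  · obtain ⟨e, rfl⟩ := hc
    rw [heckeClass, heckeClass, if_pos (dvd_mul_right _ _), if_pos (dvd_mul_right _ _)]
    have h1 : ((p * e + d : ℤ) : ZMod p) = d := by push_cast; simp
    rw [h1]
    by_cases hh : (d : ZMod p) * ((p * e / p : ℤ) : ZMod p)⁻¹ = 0
    · rw [hh, heckeTerm_inr_zero, heckeTerm_inr_zero]
      have := lift_add_int hf ((p : ℂ) ^ 2 * z) ((p : ℤ) ^ 2)
      rw [← this]
      congr 2
      push_cast
      ring
    · rw [heckeTerm_inr hf (ZMod.intCast_zmod_cast _) hh, heckeTerm_inr hf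
        (ZMod.intCast_zmod_cast _) hh, add_right_comm]
      have := lift_add_int hf (z + ((((d : ZMod p) * ((p * e / p : ℤ) : ZMod p)⁻¹).cast : ℤ) : ℂ) / p) 1
      rw [← this]
      push_cast
      rfl
  · rw [heckeClass, heckeClass, if_neg hc, if_neg hc]
    have hu := ZMod.mul_inv_of_unit _ (isUnit_intCast_of_not_dvd hc)
    rw [heckeTerm_inl hf (ZMod.intCast_zmod_cast _),
      heckeTerm_inl hf (m := ((d : ZMod (p ^ 2)) * (c : ZMod (p ^ 2))⁻¹).cast + 1)]
    · push_cast
      ring_nf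
    · push_cast
      linear_combination -hu

lemma cpow_ne_zero' {u : ℂ} (hu : u ≠ 0) (κ : ℂ) : u ^ κ ≠ 0 := by
  rw [Ne, Complex.cpow_eq_zero_iff, not_and_or]; exact Or.inl hu

/-- Three cases for b = d/c mod p². If b ≡ 0 the image is the term f(p²z). If b = pb' with p ∤ b' it
is a twisted term, through the Gauss sum mod p. If b is a unit it is again a term f((z + h)/p²),
through the Gauss sum mod p², which equals p. -/
lemma heckeTerm_neg_inv_of_not_dvd (hp : p ≠ 2) (hf : f ∈ frickeSpace k ε) {c d : ℤ}
    (hc : ¬ (p : ℤ) ∣ c) {z : ℂ} (hz : 0 < z.im) :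
    heckeTerm k p f (heckeClass p c d) (-1 / (4 * z)) =
      ε * (-2 * Complex.I * z) ^ ((k : ℂ) + 1 / 2) *
        heckeTerm k p f (heckeClass p (4 * d) (-c)) z := by
  have hp0 := prime_natCast_ne_zero (p := p)
  have hz0 : z ≠ 0 := by rintro rfl; simp at hz
  have hu : -2 * Complex.I * z ≠ 0 := mul_ne_zero (by simp) hz0
  have hcu := isUnit_intCast_of_not_dvd hc
  have h4 := not_dvd_four hp
  have hc2 := ZMod.mul_inv_of_unit _ hcu
  set b : ℤ := ((d : ZMod (p ^ 2)) * (c : ZMod (p ^ 2))⁻¹).cast with hb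
  have hbz : (b : ZMod (p ^ 2)) = (d : ZMod (p ^ 2)) * (c : ZMod (p ^ 2))⁻¹ :=
    ZMod.intCast_zmod_cast _
  have hdb : (p : ℤ) ^ 2 ∣ d - c * b := by
    rw [← intCast_eq_iff_sq_dvd]
    push_cast
    rw [hbz]
    linear_combination (d : ZMod (p ^ 2)) * hc2
  have hl : heckeClass p c d = .inl ((d : ZMod (p ^ 2)) * (c : ZMod (p ^ 2))⁻¹) := by
    rw [heckeClass, if_neg hc]
  rw [hl, heckeTerm_inl hf.1 hbz]
  have hp2 : (p : ℤ) ∣ (p : ℤ) ^ 2 := dvd_pow_self _ two_ne_zero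
  have hpd : (p : ℤ) ∣ d ↔ (p : ℤ) ∣ b := by
    have h1 : (p : ℤ) ∣ d - c * b := hp2.trans hdb
    constructor
    · intro h
      exact (prime_int.dvd_or_dvd ((dvd_sub_right h).mp h1)).resolve_left hc
    · intro h
      exact (dvd_sub_left (h.mul_left c)).mp h1
  have h4d : (p : ℤ) ∣ 4 * d ↔ (p : ℤ) ∣ d :=
    ⟨fun h => (prime_int.dvd_or_dvd h).resolve_left h4, fun h => h.mul_left _⟩
  by_cases hd : (p : ℤ) ∣ d
  · obtain ⟨b', hb'⟩ := hpd.mp hd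
    obtain ⟨d', rfl⟩ := hd
    have hdiv : 4 * ((p : ℤ) * d') / p = 4 * d' := by
      rw [mul_left_comm, Int.mul_ediv_cancel_left _ prime_cast_ne_zero]
    have hdb' : (d' : ZMod p) = c * b' := by
      have h1 : (p : ℤ) * p ∣ p * (d' - c * b') := by
        rw [← sq]
        convert hdb using 1
        rw [hb']; ring
      have h2 := (mul_dvd_mul_iff_left prime_cast_ne_zero).mp h1
      rw [← sub_eq_zero]
      exact_mod_cast (ZMod.intCast_zmod_eq_zero_iff_dvd _ _).mpr h2
    have hr : heckeClass p (4 * (p * d')) (-c) =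
        .inr ((-c : ZMod p) * (4 * d' : ZMod p)⁻¹) := by
      rw [heckeClass, if_pos (h4d.mpr (dvd_mul_right _ _)), hdiv]
      push_cast
      rfl
    have hcz : (c : ZMod p) ≠ 0 := intCast_ne_zero_iff.mpr hc
    have h4z : (4 : ZMod p) ≠ 0 := by exact_mod_cast intCast_ne_zero_iff.mpr h4
    rw [hr, hdb']
    by_cases hbz' : (b' : ZMod p) = 0
    · have hx : (-c : ZMod p) * (4 * (c * b') : ZMod p)⁻¹ = 0 := by rw [hbz']; simp
      obtain ⟨t, ht⟩ := (ZMod.intCast_zmod_eq_zero_iff_dvd b' p).mp hbz'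
      have hpz : 0 < ((p : ℂ) ^ 2 * z).im := by
        have e : ((p : ℂ) ^ 2 * z) = ((p ^ 2 : ℝ) : ℂ) * z := by push_cast; ring
        rw [e, Complex.im_ofReal_mul]
        exact mul_pos (pow_pos prime_pos 2) hz
      have e1 : ((-1 / (4 * z) + b) / p ^ 2 : ℂ) = -1 / (4 * (p ^ 2 * z)) + (t : ℤ) := by
        rw [hb', ht]
        push_cast
        field_simp
      have e2 : (-2 * Complex.I * ((p : ℂ) ^ 2 * z)) = ((p : ℝ) : ℂ) ^ 2 * (-2 * Complex.I * z) := by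
        push_cast; ring
      rw [hx, heckeTerm_inr_zero, e1, lift_add_int hf.1, lift_neg_inv hf hpz, e2,
        sq_mul_cpow prime_pos k hu]
      have e3 : (p : ℂ) ^ (2 * k - 1) = (p : ℂ) ^ (-2 : ℤ) * (p : ℂ) ^ (2 * k + 1) := by
        rw [← zpow_add₀ hp0]; congr 1; ring
      rw [e3]
      push_cast
      ring
    · have hx : (-c : ZMod p) * (4 * (c * b') : ZMod p)⁻¹ = -(4 * b' : ZMod p)⁻¹ := by
        field_simp
      have hx0 : -(4 * b' : ZMod p)⁻¹ ≠ 0 := neg_ne_zero.mpr (inv_ne_zero (mul_ne_zero h4z hbz'))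
      set h : ℤ := (-(4 * b' : ZMod p)⁻¹).cast with hh
      have hhz : (h : ZMod p) = -(4 * b' : ZMod p)⁻¹ := ZMod.intCast_zmod_cast _
      have hbh : (4 * b' * h : ZMod p) = -1 := by rw [hhz]; field_simp
      have hχ : legendreChar p (b' : ZMod p) = legendreChar p (-1) * legendreChar p (h : ZMod p) := by
        -- From 4b'h = -1, b' is -h times a square, which determines its quadratic character.
        have h1 : (b' : ZMod p) = -1 * h * (2 * b') * (2 * b') := by
          linear_combination (b' : ZMod p) * hbh
        have h2 : (2 * b' : ZMod p) ≠ 0 := by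
          intro h2
          exact mul_ne_zero h4z hbz' (by linear_combination 2 * h2)
        conv_lhs => rw [h1]
        rw [map_mul, map_mul, map_mul, mul_assoc, legendreChar_mul_self h2, mul_one]
      have key := lift_quadSum hf hbh hz
      have e1 : ((-1 / (4 * z) + b) / p ^ 2 : ℂ) = b' / p + -1 / (4 * z) / p ^ 2 := by
        rw [hb']
        push_cast
        field_simp
        ring
      rw [hx, heckeTerm_inr hf.1 hhz hx0, ← hhz, e1, key, quadSum_prime hp hbz', hχ]
      have hg := legendreGauss_ne_zero hp
      have hg2 := legendreGauss_sq hp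
      have hs := legendreChar_neg_one_sq (p := p)
      set s := legendreChar p (-1)
      set x := legendreChar p (h : ZMod p) with hxdef
      have hs0 : s ≠ 0 := by intro h; rw [h] at hs; simp at hs
      have hx2 : x ^ 2 = 1 := by
        rw [sq]; exact legendreChar_mul_self (by rw [hhz]; exact hx0)
      have hx00 : x ≠ 0 := by intro h; rw [h] at hx2; simp at hx2
      -- With g the Gauss sum, g² = sp and s² = x² = 1. This reduces the odd power to one factor g
      -- and fixes the normalisation in `heckeConst`.
      have e2 : (s * x * legendreGauss p) ^ (2 * k + 1) = x * s * s ^ k * p ^ k * legendreGauss p := by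
        rw [zpow_add₀ (mul_ne_zero (mul_ne_zero hs0 hx00) hg), zpow_mul, zpow_one]
        have : (s * x * legendreGauss p) ^ (2 : ℤ) = s * p := by
          rw [show (2 : ℤ) = ((2 : ℕ) : ℤ) by norm_num, zpow_natCast, mul_pow, mul_pow, hg2, hx2, hs]
          ring
        rw [this, mul_zpow]
        ring
      have e3 : (p : ℂ) ^ (k - 1) = (p : ℂ) ^ (-2 : ℤ) * p ^ k * p := by
        rw [← zpow_add₀ hp0, ← zpow_add_one₀ hp0]; congr 1; ring
      have hC : heckeConst k p = (p : ℂ) ^ (-2 : ℤ) * p ^ k * s ^ k * (s * legendreGauss p) := by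
        have : (p : ℂ) = s * legendreGauss p * legendreGauss p := by
          linear_combination (-p : ℂ) * hs - s * hg2
        rw [heckeConst, e3, div_eq_iff hg]
        linear_combination (p : ℂ) ^ (-2 : ℤ) * p ^ k * s ^ k * this
      rw [e2, hC]
      ring
  · have hbz' : ¬ (p : ℤ) ∣ b := fun h => hd (hpd.mpr h)
    have hbu := isUnit_intCast_of_not_dvd hbz'
    have h4u : IsUnit (4 : ZMod (p ^ 2)) := by exact_mod_cast isUnit_intCast_of_not_dvd h4
    have hdu := isUnit_intCast_of_not_dvd (mt h4d.mp hd)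
    have hr : heckeClass p (4 * d) (-c) =
        .inl ((-c : ZMod (p ^ 2)) * ((4 * d : ℤ) : ZMod (p ^ 2))⁻¹) := by
      rw [heckeClass, if_neg (mt h4d.mp hd)]
      push_cast
      rfl
    set h : ℤ := ((-c : ZMod (p ^ 2)) * ((4 * d : ℤ) : ZMod (p ^ 2))⁻¹).cast with hh
    have hhz : (h : ZMod (p ^ 2)) = (-c : ZMod (p ^ 2)) * ((4 * d : ℤ) : ZMod (p ^ 2))⁻¹ :=
      ZMod.intCast_zmod_cast _
    have hbh : (4 * b * h : ZMod (p ^ 2)) = -1 := by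
      have hd2 := ZMod.mul_inv_of_unit _ hdu
      rw [hhz, hbz]
      push_cast at hd2 ⊢
      linear_combination (-(c : ZMod (p ^ 2)) * (c : ZMod (p ^ 2))⁻¹) * hd2 - hc2
    have hpz : 0 < (z / (p : ℂ) ^ 2).im := by
      have e : (z / (p : ℂ) ^ 2) = ((1 / p ^ 2 : ℝ) : ℂ) * z := by push_cast; ring
      rw [e, Complex.im_ofReal_mul]
      have := prime_pos (p := p)
      positivity
    have key := lift_quadSum hf hbh hpz
    have e1 : ((-1 / (4 * z) + b) / p ^ 2 : ℂ) =
        b / (p ^ 2 : ℕ) + -1 / (4 * (z / p ^ 2)) / (p ^ 2 : ℕ) ^ 2 := by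
      push_cast
      field_simp
      ring
    have e2 : (-2 * Complex.I * z) ^ ((k : ℂ) + 1 / 2) =
        (p : ℂ) ^ (2 * k + 1) * (-2 * Complex.I * (z / p ^ 2)) ^ ((k : ℂ) + 1 / 2) := by
      have := sq_mul_cpow (prime_pos (p := p)) k (u := -2 * Complex.I * (z / p ^ 2))
        (mul_ne_zero (by simp) (div_ne_zero hz0 (pow_ne_zero 2 hp0)))
      push_cast at this
      rw [← this]
      congr 1
      field_simp
    have e3 : (z / p ^ 2 + h / (p ^ 2 : ℕ) : ℂ) = (z + h) / p ^ 2 := by push_cast; ring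
    rw [hr, heckeTerm_inl hf.1 hhz, e1, key, quadSum_prime_sq hp hbu, e2, e3]
    ring

lemma neg_two_I_mul_neg_inv {z : ℂ} (hz : 0 < z.im) :
    -2 * Complex.I * (-1 / (4 * z)) = (-2 * Complex.I * z)⁻¹ := by
  have hz0 : z ≠ 0 := by rintro rfl; simp at hz
  field_simp
  rw [Complex.I_sq]
  ring

/-- -2iz lies in the right half-plane, away from the branch cut, so inversion commutes with the
principal power. -/
lemma cpow_neg_two_I_inv {z : ℂ} (hz : 0 < z.im) (κ : ℂ) :
    (-2 * Complex.I * (-1 / (4 * z))) ^ κ = ((-2 * Complex.I * z) ^ κ)⁻¹ := by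
  rw [neg_two_I_mul_neg_inv hz, Complex.inv_cpow]
  intro h
  have h1 : 0 < (-2 * Complex.I * z).re := by simpa using hz
  have := (Complex.arg_eq_pi_iff.mp h).1
  linarith

lemma neg_inv_neg_inv {z : ℂ} (hz : 0 < z.im) : -1 / (4 * (-1 / (4 * z))) = z := by
  have hz0 : z ≠ 0 := by rintro rfl; simp at hz
  field_simp

/-- The Fricke involution permutes the terms of the Hecke operator. -/
lemma heckeTerm_neg_inv (hp : p ≠ 2) (hε : ε ^ 2 = 1) (hf : f ∈ frickeSpace k ε) {c d : ℤ}
    (hcd : ¬((p : ℤ) ∣ c ∧ (p : ℤ) ∣ d)) {z : ℂ} (hz : 0 < z.im) :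
    heckeTerm k p f (heckeClass p c d) (-1 / (4 * z)) =
      ε * (-2 * Complex.I * z) ^ ((k : ℂ) + 1 / 2) *
        heckeTerm k p f (heckeClass p (4 * d) (-c)) z := by
  by_cases hc : (p : ℤ) ∣ c
  · have hd : ¬ (p : ℤ) ∣ 4 * d := fun h => hcd ⟨hc,
      (prime_int.dvd_or_dvd h).resolve_left (not_dvd_four hp)⟩
    -- When p ∣ c, the previous case applies to the row (4d, -c) at -1/(4z). Two Fricke steps return
    -- the row -4(c, d), which has the class of (c, d), and ε² = 1.
    have h1 := heckeTerm_neg_inv_of_not_dvd hp hf (d := -c) hd (im_neg_inv_pos hz)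
    have hz0 : z ≠ 0 := by rintro rfl; simp at hz
    have hu : -2 * Complex.I * z ≠ 0 := mul_ne_zero (by simp) hz0
    have hu2 := cpow_ne_zero' hu ((k : ℂ) + 1 / 2)
    have e : heckeClass p (4 * -c) (-(4 * d)) = heckeClass p c d := by
      rw [show 4 * -c = (-4) * c by ring, show -(4 * d) = (-4) * d by ring]
      exact heckeClass_mul (by rw [dvd_neg]; exact not_dvd_four hp) hcd
    rw [neg_inv_neg_inv hz, cpow_neg_two_I_inv hz, e] at h1
    rw [h1]
    field_simp
    rw [hε, mul_one]
  · exact heckeTerm_neg_inv_of_not_dvd hp hf hc hz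

/-- The uniform shape from which holomorphy and growth are read off for all terms at once. -/
lemma heckeTerm_eq (x : HeckeIndex p) : ∃ (A : ℂ) (s t : ℝ), 0 < s ∧
    ∀ z, heckeTerm k p f x z = A * lift f (s * z + t) := by
  have hp := prime_pos (p := p)
  rcases x with b | h
  · refine ⟨(p : ℂ) ^ (-2 : ℤ), 1 / p ^ 2, (b.cast : ℤ) / p ^ 2, by positivity, fun z => ?_⟩
    rw [heckeTerm]
    push_cast
    ring_nf
  · by_cases hh : h = 0
    · refine ⟨(p : ℂ) ^ (2 * k - 1), p ^ 2, 0, by positivity, fun z => ?_⟩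
      rw [hh, heckeTerm_inr_zero]
      push_cast
      ring_nf
    · refine ⟨heckeConst k p * legendreChar p h, 1, (h.cast : ℤ) / p, one_pos, fun z => ?_⟩
      rw [heckeTerm, if_neg hh]
      push_cast
      ring_nf

variable (k p f)

/-- The Hecke operator `T(p²)` as a sum over cosets. -/
def heckeSum (z : ℍ) : ℂ := ∑ x, heckeTerm k p f x z

variable {k p f}

lemma im_mul_add_pos {s t : ℝ} (hs : 0 < s) {z : ℂ} (hz : 0 < z.im) : 0 < (s * z + t : ℂ).im := by
  simp only [Complex.add_im, Complex.im_ofReal_mul, Complex.ofReal_im, add_zero]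
  positivity

lemma mdifferentiable_heckeTerm (hf : MDiff f) (x : HeckeIndex p) :
    MDiff fun z : ℍ => heckeTerm k p f x z := by
  obtain ⟨A, s, t, hs, h⟩ := heckeTerm_eq (k := k) (f := f) x
  rw [UpperHalfPlane.mdifferentiable_iff]
  have h1 : DifferentiableOn ℂ (fun w => A * lift f (s * w + t)) {z | 0 < z.im} := by
    refine DifferentiableOn.const_mul ?_ A
    exact (UpperHalfPlane.mdifferentiable_iff.mp hf).comp (by fun_prop) fun w hw => im_mul_add_pos hs hw
  refine h1.congr fun w hw => ?_
  rw [Function.comp_apply, ofComplex_apply_of_im_pos hw, h]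

lemma norm_lift_le {C : ℝ} (hC : ∀ z : ℍ, ‖f z‖ ≤ C * z.im ^ (-((k : ℝ) + 1 / 2) / 2)) {s t : ℝ}
    (hs : 0 < s) (z : ℍ) : ‖lift f (s * z + t)‖ ≤
      C * s ^ (-((k : ℝ) + 1 / 2) / 2) * z.im ^ (-((k : ℝ) + 1 / 2) / 2) := by
  rw [lift_of_im_pos f (im_mul_add_pos hs z.im_pos), mul_assoc, ← Real.mul_rpow hs.le z.im_pos.le]
  refine (hC _).trans (le_of_eq ?_)
  congr 2
  simp [← coe_im]

lemma hasCuspBound_heckeSum (hf : HasCuspBound k f) : HasCuspBound k (heckeSum k p f) := by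
  obtain ⟨C, hC⟩ := hf
  choose A s t hs h using heckeTerm_eq (k := k) (p := p) (f := f)
  refine ⟨∑ x, ‖A x‖ * (C * s x ^ (-((k : ℝ) + 1 / 2) / 2)), fun z => ?_⟩
  rw [heckeSum, Finset.sum_mul]
  refine norm_sum_le_of_le _ fun x _ => ?_
  rw [h, norm_mul, mul_assoc]
  exact mul_le_mul_of_nonneg_left (norm_lift_le hC (hs x) z) (norm_nonneg _)

/-- Translation and the Fricke involution only permute the terms, so the sum inherits periodicity,
the sign ε and the growth bound. -/
lemma heckeSum_mem (hp : p ≠ 2) (hk : 0 ≤ k) (hε : ε ^ 2 = 1) (hf : f ∈ frickeSpace k ε) :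
    heckeSum k p f ∈ frickeSpace k ε := by
  refine mem_frickeSpace_of hk ?_ (fun z => ?_) (fun z => ?_)
    (hasCuspBound_heckeSum (hasCuspBound_of_mem hf.1))
  · have : heckeSum k p f = fun z : ℍ => ∑ x, heckeTerm k p f x z := rfl
    rw [this]
    rw [UpperHalfPlane.mdifferentiable_iff]
    exact DifferentiableOn.fun_sum fun x _ =>
      UpperHalfPlane.mdifferentiable_iff.mp (mdifferentiable_heckeTerm hf.1.holo x)
  · rw [heckeSum, heckeSum]
    conv_rhs => rw [← sum_heckeClass_shear]
    refine Finset.sum_congr rfl fun x _ => ?_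
    rw [← heckeTerm_add_one hf.1 (heckeRow_primitive x), heckeClass_heckeRow, coe_vadd]
    push_cast
    rw [add_comm]
  · rw [heckeSum, heckeSum]
    conv_rhs => rw [← sum_heckeClass_fricke hp, Finset.mul_sum]
    refine Finset.sum_congr rfl fun x _ => ?_
    rw [← heckeTerm_neg_inv hp hε hf (heckeRow_primitive x) z.im_pos, heckeClass_heckeRow]
    rfl

end HeckeTerms

/-! ### Fourier coefficients of the Hecke operator -/

lemma qExp_natCast_mul (N n : ℕ) (w : ℂ) : qExp (N * n) w = qExp n (N * w) := by
  rw [qExp, qExp]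
  congr 1
  push_cast
  ring

lemma qExp_add_div {N : ℕ} [NeZero N] (n : ℕ) (b : ℤ) (w : ℂ) :
    qExp n (w + b / N) = qExp n w * ZMod.stdAddChar ((n : ZMod N) * (b : ZMod N)) := by
  have : (n : ZMod N) * (b : ZMod N) = ((n * b : ℤ) : ZMod N) := by push_cast; rfl
  rw [this, ZMod.stdAddChar_coe, qExp, qExp, ← Complex.exp_add]
  congr 1
  push_cast
  ring

section HeckeFourier

variable {k : ℤ} {p : ℕ} [Fact p.Prime] {f : ℍ → ℂ}

lemma hasSum_lift (hf : f ∈ cuspForms k) {w : ℂ} (hw : 0 < w.im) :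
    HasSum (fun n : ℕ => fourierCoeff f n * qExp n w) (lift f w) := by
  rw [lift_of_im_pos f hw]
  exact hasSum_fourierCoeff hf ⟨w, hw⟩

lemma natCast_mul_injective {N : ℕ} (hN : N ≠ 0) : Function.Injective fun n : ℕ => N * n :=
  fun _ _ h => Nat.eq_of_mul_eq_mul_left (Nat.pos_of_ne_zero hN) h

/-- Orthogonality of characters in b retains the exponents divisible by p² and gives the factor p²
that the normalisation p⁻² removes. -/
lemma hasSum_heckeTerm_inl (hf : f ∈ cuspForms k) {z : ℂ} (hz : 0 < z.im) :
    HasSum (fun n : ℕ => fourierCoeff f (p ^ 2 * n) * qExp n z)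
      (∑ b : ZMod (p ^ 2), heckeTerm k p f (.inl b) z) := by
  have hp0 := prime_natCast_ne_zero (p := p)
  have hN : p ^ 2 ≠ 0 := pow_ne_zero 2 (Fact.out : p.Prime).ne_zero
  have e1 (b : ZMod (p ^ 2)) : (z + (b.cast : ℤ)) / p ^ 2 =
      ((1 / p ^ 2 : ℝ) : ℂ) * z + (((b.cast : ℤ) / p ^ 2 : ℝ) : ℂ) := by push_cast; ring
  have h1 (b : ZMod (p ^ 2)) : HasSum (fun n : ℕ => (p : ℂ) ^ (-2 : ℤ) *
      (fourierCoeff f n * qExp n ((z + (b.cast : ℤ)) / p ^ 2))) (heckeTerm k p f (.inl b) z) := by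
    refine (hasSum_lift hf ?_).mul_left _
    rw [e1]
    have := prime_pos (p := p)
    exact im_mul_add_pos (by positivity) hz
  have h2 := hasSum_sum (s := Finset.univ) fun b _ => h1 b
  have h3 (n : ℕ) : ∑ b : ZMod (p ^ 2), (p : ℂ) ^ (-2 : ℤ) *
      (fourierCoeff f n * qExp n ((z + (b.cast : ℤ)) / p ^ 2)) =
      if p ^ 2 ∣ n then fourierCoeff f n * qExp n (z / p ^ 2) else 0 := by
    have h4 (b : ZMod (p ^ 2)) : qExp n ((z + (b.cast : ℤ)) / p ^ 2) =
        qExp n (z / p ^ 2) * ZMod.stdAddChar (b * (n : ZMod (p ^ 2))) := by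
      have := qExp_add_div (N := p ^ 2) n b.cast (z / p ^ 2)
      rw [ZMod.intCast_zmod_cast, mul_comm (n : ZMod (p ^ 2))] at this
      rw [← this]
      push_cast
      ring_nf
    have h5 := AddChar.sum_mulShift (n : ZMod (p ^ 2)) (ZMod.isPrimitive_stdAddChar (p ^ 2))
    rw [ZMod.card] at h5
    calc _ = (p : ℂ) ^ (-2 : ℤ) * (fourierCoeff f n * qExp n (z / p ^ 2)) *
          ∑ b : ZMod (p ^ 2), ZMod.stdAddChar (b * (n : ZMod (p ^ 2))) := by
          rw [Finset.mul_sum]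
          exact Finset.sum_congr rfl fun b _ => by rw [h4]; ring
      _ = _ := by
          rw [h5]
          simp only [ZMod.natCast_eq_zero_iff]
          split_ifs with hd
          · push_cast
            rw [mul_right_comm, ← zpow_natCast (p : ℂ) 2, ← zpow_add₀ hp0]
            simp
          · simp
  simp only [h3] at h2
  rw [← (natCast_mul_injective hN).hasSum_iff] at h2
  · refine (hasSum_congr_terms fun n => ?_).mp h2
    simp only [Function.comp_apply, if_pos (dvd_mul_right (p ^ 2) n), qExp_natCast_mul]
    congr 2
    push_cast
    field_simp
  · intro n hn
    rw [if_neg]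
    rintro ⟨m, rfl⟩
    exact hn ⟨m, rfl⟩

lemma hasSum_heckeTerm_inr_zero (hf : f ∈ cuspForms k) {z : ℂ} (hz : 0 < z.im) :
    HasSum (fun n : ℕ => (p : ℂ) ^ (2 * k - 1) *
      (if p ^ 2 ∣ n then fourierCoeff f (n / p ^ 2) else 0) * qExp n z)
      (heckeTerm k p f (.inr 0) z) := by
  have hN : p ^ 2 ≠ 0 := pow_ne_zero 2 (Fact.out : p.Prime).ne_zero
  have hpz : 0 < ((p : ℂ) ^ 2 * z).im := by
    have e : ((p : ℂ) ^ 2 * z) = ((p ^ 2 : ℝ) : ℂ) * z := by push_cast; ring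
    rw [e, Complex.im_ofReal_mul]
    exact mul_pos (pow_pos prime_pos 2) hz
  have h1 := (hasSum_lift hf hpz).mul_left ((p : ℂ) ^ (2 * k - 1))
  rw [heckeTerm_inr_zero, ← (natCast_mul_injective hN).hasSum_iff]
  · refine (hasSum_congr_terms fun n => ?_).mp h1
    simp only [Function.comp_apply, if_pos (dvd_mul_right (p ^ 2) n), qExp_natCast_mul,
      Nat.mul_div_cancel_left _ (Nat.pos_of_ne_zero hN)]
    push_cast
    ring
  · intro n hn
    rw [if_neg]
    · ring
    rintro ⟨m, rfl⟩
    exact hn ⟨m, rfl⟩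

/-- The sum over h is χ(n) times the Gauss sum, which cancels the denominator of `heckeConst`. The
residue h = 0 may be included since χ(0) = 0. -/
lemma hasSum_heckeTerm_twist (hp : p ≠ 2) (hf : f ∈ cuspForms k) {z : ℂ} (hz : 0 < z.im) :
    HasSum (fun n : ℕ => (p : ℂ) ^ (k - 1) * legendreChar p (-1) ^ k * legendreChar p n *
        fourierCoeff f n * qExp n z)
      (∑ h : ZMod p, heckeConst k p * legendreChar p h * lift f (z + (h.cast : ℤ) / p)) := by
  have e1 (h : ZMod p) : (z + (h.cast : ℤ) / p : ℂ) =
      ((1 : ℝ) : ℂ) * z + (((h.cast : ℤ) / p : ℝ) : ℂ) := by push_cast; ring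
  have h1 (h : ZMod p) : HasSum (fun n : ℕ => heckeConst k p * legendreChar p h *
      (fourierCoeff f n * qExp n (z + (h.cast : ℤ) / p)))
      (heckeConst k p * legendreChar p h * lift f (z + (h.cast : ℤ) / p)) := by
    refine (hasSum_lift hf ?_).mul_left _
    rw [e1]
    exact im_mul_add_pos one_pos hz
  have h2 := hasSum_sum (s := Finset.univ) fun h _ => h1 h
  refine (hasSum_congr_terms fun n => ?_).mp h2
  have h4 (h : ZMod p) : qExp n (z + (h.cast : ℤ) / p) =
      qExp n z * ZMod.stdAddChar ((n : ZMod p) * h) := by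
    rw [qExp_add_div, ZMod.intCast_zmod_cast]
  calc _ = heckeConst k p * (fourierCoeff f n * qExp n z) *
        ∑ h : ZMod p, legendreChar p h * ZMod.stdAddChar ((n : ZMod p) * h) := by
        rw [Finset.mul_sum]
        exact Finset.sum_congr rfl fun b _ => by rw [h4]; ring
    _ = _ := by
        have hg := legendreGauss_ne_zero hp
        rw [sum_legendreChar_mul hp, heckeConst]
        field_simp

lemma jacobiSym_eq_legendreChar (n : ℕ) :
    (jacobiSym ((k.negOnePow : ℤ) * n) p : ℂ) = legendreChar p (-1) ^ k * legendreChar p n := by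
  rw [← jacobiSym.legendreSym.to_jacobiSym, legendreSym, ← legendreChar_apply]
  push_cast
  rw [map_mul]
  congr 1
  have hs := legendreChar_neg_one_sq (p := p)
  have hs0 : legendreChar p (-1) ≠ 0 := by intro h; rw [h] at hs; simp at hs
  rcases Int.even_or_odd' k with ⟨m, rfl | rfl⟩
  · rw [Int.negOnePow_even _ (even_two_mul m), zpow_mul]
    have : legendreChar p (-1) ^ (2 : ℤ) = 1 := by exact_mod_cast hs
    rw [this]
    simp
  · rw [Int.negOnePow_odd _ (odd_two_mul_add_one m), zpow_add₀ hs0, zpow_mul]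
    have : legendreChar p (-1) ^ (2 : ℤ) = 1 := by exact_mod_cast hs
    rw [this]
    simp

lemma hasSum_heckeSum (hp : p ≠ 2) (hf : f ∈ cuspForms k) (z : ℍ) :
    HasSum (fun n : ℕ => heckeCoeff k p f n * qExp n z) (heckeSum k p f z) := by
  have h1 := ((hasSum_heckeTerm_inl (p := p) hf z.im_pos).add
    (hasSum_heckeTerm_twist hp hf z.im_pos)).add (hasSum_heckeTerm_inr_zero (p := p) hf z.im_pos)
  have h2 : ∑ h : ZMod p, heckeTerm k p f (.inr h) z =
      (∑ h : ZMod p, heckeConst k p * legendreChar p h * lift f (z + (h.cast : ℤ) / p)) +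
        heckeTerm k p f (.inr 0) z := by
    rw [← Finset.add_sum_erase _ _ (Finset.mem_univ (0 : ZMod p)),
      ← Finset.add_sum_erase (a := (0 : ZMod p)) _ (fun h : ZMod p => heckeConst k p *
        legendreChar p h * lift f (z + (h.cast : ℤ) / p)) (Finset.mem_univ _)]
    rw [MulChar.map_zero, mul_zero, zero_mul, zero_add, add_comm]
    congr 1
    refine Finset.sum_congr rfl fun h hh => ?_
    rw [heckeTerm, if_neg (Finset.ne_of_mem_erase hh)]
  rw [heckeSum, Fintype.sum_sum_type, h2, ← add_assoc]
  refine (hasSum_congr_terms fun n => ?_).mp h1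
  rw [heckeCoeff, jacobiSym_eq_legendreChar]
  ring

lemma hecke_eq_heckeSum (hp : p ≠ 2) (hf : f ∈ cuspForms k) : hecke k p f = heckeSum k p f :=
  funext fun z => (hasSum_heckeSum hp hf z).tsum_eq

variable (k p) in
/-- The Hecke operator `T(p²)` as a linear map. -/
def heckeOp : (ℍ → ℂ) →ₗ[ℂ] (ℍ → ℂ) where
  toFun := heckeSum k p
  map_add' f g := by
    funext z
    simp only [heckeSum, Pi.add_apply, ← Finset.sum_add_distrib]
    refine Finset.sum_congr rfl fun x _ => ?_
    rcases x with b | h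
    · simp only [heckeTerm, lift, Pi.add_apply]; ring
    · simp only [heckeTerm, lift, Pi.add_apply]; split_ifs <;> ring
  map_smul' c f := by
    funext z
    simp only [heckeSum, Pi.smul_apply, smul_eq_mul, Finset.mul_sum, RingHom.id_apply]
    refine Finset.sum_congr rfl fun x _ => ?_
    rcases x with b | h
    · simp only [heckeTerm, lift, Pi.smul_apply, smul_eq_mul]; ring
    · simp only [heckeTerm, lift, Pi.smul_apply, smul_eq_mul]; split_ifs <;> ring

variable {ε : ℂ}

lemma fourierCoeff_heckeSum (hp : p ≠ 2) (hk : 0 ≤ k) (hε : ε ^ 2 = 1) (hf : f ∈ frickeSpace k ε) :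
    fourierCoeff (heckeSum k p f) = heckeCoeff k p f :=
  fourierCoeff_unique (heckeSum_mem hp hk hε hf).1 (hasSum_heckeSum hp hf.1)

lemma legendreChar_sq_mul {q : ℕ} [Fact q.Prime] (hpq : p ≠ q) (n : ℕ) :
    legendreChar p ((q ^ 2 * n : ℕ) : ZMod p) = legendreChar p (n : ZMod p) := by
  have hq : ((q : ℕ) : ZMod p) ≠ 0 := by
    rw [Ne, ZMod.natCast_eq_zero_iff]
    exact fun h => hpq ((Nat.prime_dvd_prime_iff_eq Fact.out Fact.out).mp h)
  push_cast
  rw [map_mul, sq, map_mul, legendreChar_mul_self hq, one_mul]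

lemma dvd_sq_mul_iff {q : ℕ} [Fact q.Prime] (hpq : p ≠ q) (n : ℕ) :
    p ^ 2 ∣ q ^ 2 * n ↔ p ^ 2 ∣ n :=
  (((Nat.coprime_primes Fact.out Fact.out).mpr hpq).pow 2 2).dvd_mul_left

/-- Fourier coefficients are compared. For p ≠ q the factor q² affects neither divisibility by p²
nor the character mod p, so the nine terms match in each divisibility case. -/
lemma heckeSum_comm {q : ℕ} [Fact q.Prime] (hp : p ≠ 2) (hq : q ≠ 2) (hk : 0 ≤ k) (hε : ε ^ 2 = 1)
    (hf : f ∈ frickeSpace k ε) :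
    heckeSum k p (heckeSum k q f) = heckeSum k q (heckeSum k p f) := by
  by_cases hpq : p = q
  · subst hpq
    rfl
  have hfp := heckeSum_mem hp hk hε hf
  have hfq := heckeSum_mem hq hk hε hf
  refine eq_of_fourierCoeff_eq (heckeSum_mem hp hk hε hfq).1 (heckeSum_mem hq hk hε hfp).1 ?_
  rw [fourierCoeff_heckeSum hp hk hε hfq, fourierCoeff_heckeSum hq hk hε hfp]
  funext n
  have hp2 : 0 < p ^ 2 := pow_pos (Fact.out : p.Prime).pos 2
  have hq2 : 0 < q ^ 2 := pow_pos (Fact.out : q.Prime).pos 2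
  have c1 (m : ℕ) := dvd_sq_mul_iff (p := p) (q := q) hpq m
  have c2 (m : ℕ) := dvd_sq_mul_iff (p := q) (q := p) (Ne.symm hpq) m
  have l1 (m : ℕ) := legendreChar_sq_mul (p := p) (q := q) hpq m
  have l2 (m : ℕ) := legendreChar_sq_mul (p := q) (q := p) (Ne.symm hpq) m
  simp only [heckeCoeff, fourierCoeff_heckeSum hq hk hε hf, fourierCoeff_heckeSum hp hk hε hf,
    jacobiSym_eq_legendreChar, c1, c2, l1, l2]
  by_cases hpn : p ^ 2 ∣ n <;> by_cases hqn : q ^ 2 ∣ n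
  · obtain ⟨m, rfl⟩ := hpn
    obtain ⟨r, rfl⟩ := (c2 m).mp hqn
    have e1 : q ^ 2 * (p ^ 2 * (q ^ 2 * r)) / p ^ 2 = q ^ 2 * (q ^ 2 * r) := by
      rw [mul_left_comm, Nat.mul_div_cancel_left _ hp2]
    have e2 : p ^ 2 * (p ^ 2 * (q ^ 2 * r)) / q ^ 2 = p ^ 2 * (p ^ 2 * r) := by
      rw [mul_left_comm (p ^ 2) (q ^ 2), mul_left_comm (p ^ 2) (q ^ 2), Nat.mul_div_cancel_left _ hq2]
    have e3 : p ^ 2 * (q ^ 2 * r) / p ^ 2 = q ^ 2 * r := Nat.mul_div_cancel_left _ hp2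
    have e4 : p ^ 2 * (q ^ 2 * r) / q ^ 2 = p ^ 2 * r := by
      rw [mul_left_comm, Nat.mul_div_cancel_left _ hq2]
    have e5 : q ^ 2 * r / q ^ 2 = r := Nat.mul_div_cancel_left _ hq2
    have e6 : p ^ 2 * r / p ^ 2 = r := Nat.mul_div_cancel_left _ hp2
    have e7 : legendreChar p ((p ^ 2 * (q ^ 2 * r) : ℕ) : ZMod p) =
        legendreChar p ((p ^ 2 * r : ℕ) : ZMod p) := by rw [mul_left_comm, l1]
    simp only [e1, e2, e3, e4, e5, e6, e7, c2, l2, dvd_mul_right, if_true]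
    rw [mul_left_comm (q ^ 2) (p ^ 2)]
    ring
  · obtain ⟨m, rfl⟩ := hpn
    have hqm : ¬ q ^ 2 ∣ m := fun h => hqn ((c2 m).mpr h)
    have e1 : q ^ 2 * (p ^ 2 * m) / p ^ 2 = q ^ 2 * m := by
      rw [mul_left_comm, Nat.mul_div_cancel_left _ hp2]
    have e3 : p ^ 2 * m / p ^ 2 = m := Nat.mul_div_cancel_left _ hp2
    simp only [e1, e3, c2, l2, hqm, dvd_mul_right, if_true, if_false]
    rw [mul_left_comm (q ^ 2) (p ^ 2)]
    ring
  · obtain ⟨m, rfl⟩ := hqn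
    have hpm : ¬ p ^ 2 ∣ m := fun h => hpn ((c1 m).mpr h)
    have e1 : p ^ 2 * (q ^ 2 * m) / q ^ 2 = p ^ 2 * m := by
      rw [mul_left_comm, Nat.mul_div_cancel_left _ hq2]
    have e3 : q ^ 2 * m / q ^ 2 = m := Nat.mul_div_cancel_left _ hq2
    simp only [e1, e3, c1, l1, hpm, dvd_mul_right, if_true, if_false]
    rw [mul_left_comm (q ^ 2) (p ^ 2)]
    ring
  · simp only [hpn, hqn, if_false]
    rw [mul_left_comm (q ^ 2) (p ^ 2)]
    ring

end HeckeFourier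

/-! ### Unfolding with partitions of unity -/

section Unfolding

open MeasureTheory

/-- A nonnegative function whose translates under `G` sum to one. -/
structure IsWeight (G : Type*) {X : Type*} [SMul G X] [MeasurableSpace X] (ψ : X → ℝ) : Prop where
  measurable : Measurable ψ
  nonneg : ∀ x, 0 ≤ ψ x
  hasSum : ∀ x, HasSum (fun g : G => ψ (g • x)) 1

variable {G X : Type*} [Group G] [Countable G] [MulAction G X] [MeasurableSpace X]
  [MeasurableConstSMul G X] {μ : Measure X} [SMulInvariantMeasure G X μ] {ψ : X → ℝ}

omit [Countable G] [MeasurableConstSMul G X] in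
lemma IsWeight.hasSum_inv (hψ : IsWeight G ψ) (x : X) : HasSum (fun g : G => ψ (g⁻¹ • x)) 1 :=
  (Equiv.inv G).hasSum_iff.mpr (hψ.hasSum x)

omit [MeasurableConstSMul G X] [Countable G] in
lemma IsWeight.tsum_enorm (hψ : IsWeight G ψ) (x : X) : ∑' g : G, ‖ψ (g⁻¹ • x)‖ₑ = 1 := by
  have h := hψ.hasSum_inv x
  have : ∀ g : G, ‖ψ (g⁻¹ • x)‖ₑ = ENNReal.ofReal (ψ (g⁻¹ • x)) := fun g =>
    Real.enorm_of_nonneg (hψ.nonneg _)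
  simp only [this]
  rw [← ENNReal.ofReal_tsum_of_nonneg (fun g => hψ.nonneg _) h.summable, h.tsum_eq,
    ENNReal.ofReal_one]

lemma enorm_ofReal' (r : ℝ) : ‖(r : ℂ)‖ₑ = ‖r‖ₑ := by
  rw [← ofReal_norm, ← ofReal_norm, Complex.norm_real]

/-- Unfolding: integrating a sum over a group against a weight. -/
theorem IsWeight.integral_tsum_smul (hψ : IsWeight G ψ) {H : X → ℂ} (hH : Integrable H μ) :
    ∫ x, (ψ x : ℂ) * ∑' g : G, H (g • x) ∂μ = ∫ x, H x ∂μ := by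
  have hψm : AEStronglyMeasurable (fun x => (ψ x : ℂ)) μ :=
    (Complex.measurable_ofReal.comp hψ.measurable).aestronglyMeasurable
  have hmp (g : G) : MeasurePreserving (g • · : X → X) μ μ := measurePreserving_smul g μ
  have hcv (g : G) (x : X) : (ψ (g⁻¹ • (g • x)) : ℂ) * H (g • x) = ψ x * H (g • x) := by
    rw [inv_smul_smul]
  have hm1 (g : G) : AEStronglyMeasurable (fun x => (ψ (g⁻¹ • x) : ℂ) * H x) μ :=
    (hψm.comp_measurePreserving (hmp g⁻¹)).mul hH.aestronglyMeasurable
  have hm (g : G) : AEStronglyMeasurable (fun x => (ψ x : ℂ) * H (g • x)) μ :=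
    hψm.mul (hH.aestronglyMeasurable.comp_measurePreserving (hmp g))
  -- Since the translates of ψ sum to 1, this total equals ∫ |H|, which justifies exchanging sum and
  -- integral.
  have hsum : ∑' g : G, ∫⁻ x, ‖(ψ (g⁻¹ • x) : ℂ) * H x‖ₑ ∂μ ≠ ⊤ := by
    rw [← lintegral_tsum fun g => (hm1 g).enorm]
    have : ∀ x, ∑' g : G, ‖(ψ (g⁻¹ • x) : ℂ) * H x‖ₑ = ‖H x‖ₑ := fun x => by
      simp only [enorm_mul, enorm_ofReal']
      rw [ENNReal.tsum_mul_right, hψ.tsum_enorm, one_mul]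
    simp only [this]
    exact hH.hasFiniteIntegral.ne
  have hemb (g : G) : MeasurableEmbedding (g • · : X → X) := measurableEmbedding_const_smul g
  have hl (g : G) : ∫⁻ x, ‖(ψ x : ℂ) * H (g • x)‖ₑ ∂μ = ∫⁻ x, ‖(ψ (g⁻¹ • x) : ℂ) * H x‖ₑ ∂μ := by
    rw [← (hmp g).lintegral_comp_emb (hemb g) fun x => ‖(ψ (g⁻¹ • x) : ℂ) * H x‖ₑ]
    exact lintegral_congr fun x => by rw [hcv]
  have hi (g : G) : ∫ x, (ψ x : ℂ) * H (g • x) ∂μ = ∫ x, (ψ (g⁻¹ • x) : ℂ) * H x ∂μ := by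
    rw [← (hmp g).integral_comp (hemb g) fun x => (ψ (g⁻¹ • x) : ℂ) * H x]
    exact integral_congr_ae (Eventually.of_forall fun x => (hcv g x).symm)
  simp only [← tsum_mul_left]
  rw [integral_tsum hm (by simpa only [hl] using hsum)]
  simp only [hi]
  rw [← integral_tsum hm1 hsum]
  congr 1
  funext x
  rw [tsum_mul_right]
  have h := hψ.hasSum_inv x
  rw [← Complex.ofReal_tsum, h.tsum_eq, Complex.ofReal_one, one_mul]

/-- Integrals of invariant functions against weights do not depend on the weight. -/
theorem IsWeight.integral_eq (hψ : IsWeight G ψ) {ψ' : X → ℝ} (hψ' : IsWeight G ψ') {F : X → ℂ}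
    (hF : ∀ (g : G) x, F (g • x) = F x) (hint : Integrable (fun x => (ψ' x : ℂ) * F x) μ) :
    ∫ x, (ψ x : ℂ) * F x ∂μ = ∫ x, (ψ' x : ℂ) * F x ∂μ := by
  -- Unfolding with H = ψ'F: by invariance of F, the translates of H sum to F.
  rw [← hψ.integral_tsum_smul hint]
  congr 1
  funext x
  simp only [hF]
  rw [tsum_mul_right, ← Complex.ofReal_tsum, (hψ'.hasSum x).tsum_eq, Complex.ofReal_one, one_mul]

omit [Countable G] [MeasurableSpace X] in
lemma bijective_out_mul (Γ : Subgroup G) :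
    Function.Bijective fun x : (G ⧸ Γ) × Γ => x.1.out * (x.2 : G) := by
  constructor
  · rintro ⟨q, γ⟩ ⟨q', γ'⟩ h
    have h1 : q = q' := by
      have := congrArg (QuotientGroup.mk : G → G ⧸ Γ) h
      simpa [QuotientGroup.mk_mul_of_mem _ γ.2, QuotientGroup.mk_mul_of_mem _ γ'.2] using this
    subst h1
    exact Prod.ext rfl (Subtype.ext (mul_left_cancel h))
  · intro g
    refine ⟨((g : G ⧸ Γ), ⟨(g : G ⧸ Γ).out⁻¹ * g, ?_⟩), by simp⟩
    rw [← QuotientGroup.eq]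
    exact Quotient.out_eq _

omit [Countable G] in
/-- A finite index subgroup has a weight if the group has. -/
theorem IsWeight.subgroup (hψ : IsWeight G ψ) (Γ : Subgroup G) [Γ.FiniteIndex] :
    IsWeight Γ fun x => ∑ᶠ q : G ⧸ Γ, ψ (q.out • x) := by
  have := Fintype.ofFinite (G ⧸ Γ)
  refine ⟨?_, fun x => finsum_nonneg fun q => hψ.nonneg _, fun x => ?_⟩
  · simp only [finsum_eq_sum_of_fintype]
    exact Finset.measurable_fun_sum _ fun q _ => hψ.measurable.comp (measurable_const_smul q.out)
  · simp only [finsum_eq_sum_of_fintype]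
    have h := (Equiv.ofBijective _ (bijective_out_mul Γ)).hasSum_iff.mpr (hψ.hasSum x)
    have h2 := ((Equiv.prodComm Γ (G ⧸ Γ)).hasSum_iff.mpr h).prod_fiberwise
      (g := fun γ : Γ => ∑ q : G ⧸ Γ, ψ (q.out • γ • x)) fun γ => ?_
    · exact h2
    · refine (hasSum_congr_terms fun q => ?_).mp (hasSum_fintype (fun q : G ⧸ Γ => ψ (q.out • γ • x)))
      simp only [Function.comp_apply, Equiv.prodComm_apply, Prod.swap_prod_mk, Equiv.ofBijective_apply]
      rw [mul_smul]
      rfl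

omit [Countable G] in
theorem integrable_finsum_smul (hi : Integrable ψ μ) (Γ : Subgroup G)
    [Γ.FiniteIndex] : Integrable (fun x => ∑ᶠ q : G ⧸ Γ, ψ (q.out • x)) μ := by
  have := Fintype.ofFinite (G ⧸ Γ)
  simp only [finsum_eq_sum_of_fintype]
  exact integrable_finsetSum _ fun q _ => (measurePreserving_smul q.out μ).integrable_comp_of_integrable hi

end Unfolding

/-! ### An integrable weight for the modular group -/

section ModularWeight

open MeasureTheory ModularGroup
open scoped Modular

instance : Countable SL(2, ℤ) :=
  have : Countable (Matrix (Fin 2) (Fin 2) ℤ) := inferInstanceAs (Countable (Fin 2 → Fin 2 → ℤ))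
  inferInstanceAs (Countable {A : Matrix (Fin 2) (Fin 2) ℤ // A.det = 1})

instance : MeasurableConstSMul SL(2, ℤ) ℍ :=
  ⟨fun γ => measurable_const_smul (Matrix.SpecialLinearGroup.mapGL ℝ γ)⟩

instance : SMulInvariantMeasure SL(2, ℤ) ℍ volume :=
  ⟨fun γ _ hs => measure_preimage_smul_of_nullMeasurableSet (μ := volume)
    hs.nullMeasurableSet (Matrix.SpecialLinearGroup.mapGL ℝ γ)⟩

/-- If g moves z into 𝒟, then γg⁻¹ carries a point of 𝒟 into 𝒟 and so lies in an explicit finite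
list. Dividing by the resulting count corrects the overlap of translates along the boundary. -/
lemma finite_smul_mem_fd (z : ℍ) : {γ : SL(2, ℤ) | γ • z ∈ 𝒟}.Finite := by
  obtain ⟨g, hg⟩ := exists_smul_mem_fd z
  have hfin : (({1, -1, T, -T, T⁻¹, -T⁻¹, S, -S, T * S, -(T * S), T⁻¹ * S * T⁻¹,
      -(T⁻¹ * S * T⁻¹), S * T⁻¹, -(S * T⁻¹), S * T, -(S * T), T * S * T, -(T * S * T), T⁻¹ * S,
      -(T⁻¹ * S)} : Set SL(2, ℤ))).Finite := by
    repeat apply Set.Finite.insert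
    exact Set.finite_singleton _
  refine (hfin.preimage (mul_left_injective g⁻¹).injOn).subset fun γ hγ => ?_
  have hγ' : (γ * g⁻¹) • (g • z) ∈ 𝒟 := by
    rw [smul_smul, inv_mul_cancel_right]
    exact hγ
  have h := cases_of_mem_fd_smul_mem_fd hg hγ'
  rw [Set.mem_preimage]
  generalize γ * g⁻¹ = δ at h
  simp only [Set.mem_insert_iff, Set.mem_singleton_iff]
  rcases h with (h | h) | ⟨h | h, -⟩ | ⟨h | h, -⟩ | ⟨h | h, -⟩ | ⟨h | h, -⟩ | ⟨h | h, -⟩ |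
    ⟨h | h, -⟩ | ⟨h | h, -⟩ | ⟨h | h, -⟩ | ⟨h | h, -⟩ <;>
  simp only [h, true_or, or_true]

/-- The number of translates of `z` in the fundamental domain. -/
def fdCount (z : ℍ) : ℕ := (finite_smul_mem_fd z).toFinset.card

lemma fdCount_pos (z : ℍ) : 0 < fdCount z := by
  obtain ⟨g, hg⟩ := exists_smul_mem_fd z
  exact Finset.card_pos.mpr ⟨g, by simpa using hg⟩

lemma fdCount_smul (γ : SL(2, ℤ)) (z : ℍ) : fdCount (γ • z) = fdCount z := by
  refine Finset.card_bij (fun g _ => g * γ) (fun g hg => ?_) (fun a _ b _ h => ?_) fun g hg => ?_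
  · rw [Set.Finite.mem_toFinset, Set.mem_ofPred_eq] at hg ⊢
    rwa [mul_smul]
  · exact mul_right_cancel h
  · rw [Set.Finite.mem_toFinset, Set.mem_ofPred_eq] at hg
    refine ⟨g * γ⁻¹, ?_, by simp⟩
    rw [Set.Finite.mem_toFinset, Set.mem_ofPred_eq, smul_smul, inv_mul_cancel_right]
    exact hg

/-- The weight for the modular group supported on the standard fundamental domain. -/
def modularWeight (z : ℍ) : ℝ := (𝒟 : Set ℍ).indicator (fun z => (fdCount z : ℝ)⁻¹) z

lemma fdCount_eq_tsum (z : ℍ) :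
    HasSum (fun γ : SL(2, ℤ) => (𝒟 : Set ℍ).indicator (fun _ => (1 : ℝ)) (γ • z)) (fdCount z) := by
  have h : HasSum (fun γ : SL(2, ℤ) => (𝒟 : Set ℍ).indicator (fun _ => (1 : ℝ)) (γ • z))
      (∑ γ ∈ (finite_smul_mem_fd z).toFinset, (𝒟 : Set ℍ).indicator (fun _ => (1 : ℝ)) (γ • z)) := by
    refine hasSum_sum_of_ne_finset_zero fun γ hγ => Set.indicator_of_notMem (fun h => hγ ?_) _
    rwa [Set.Finite.mem_toFinset]
  have h2 : ∑ γ ∈ (finite_smul_mem_fd z).toFinset, (𝒟 : Set ℍ).indicator (fun _ => (1 : ℝ)) (γ • z) =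
      ∑ γ ∈ (finite_smul_mem_fd z).toFinset, (1 : ℝ) := Finset.sum_congr rfl fun γ hγ =>
    Set.indicator_of_mem (by rwa [Set.Finite.mem_toFinset] at hγ) _
  rw [h2] at h
  simpa [fdCount] using h

lemma measurable_fdCount : Measurable fun z => (fdCount z : ℝ) := by
  have : (fun z => (fdCount z : ℝ)) = fun z =>
      (∑' γ : SL(2, ℤ), (𝒟 : Set ℍ).indicator (fun _ => (1 : ENNReal)) (γ • z)).toReal := by
    funext z
    rw [ENNReal.tsum_toReal_eq fun γ => ?_]
    · rw [← (fdCount_eq_tsum z).tsum_eq]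
      refine tsum_congr fun γ => ?_
      by_cases h : γ • z ∈ 𝒟
      · rw [Set.indicator_of_mem h, Set.indicator_of_mem h, ENNReal.toReal_one]
      · rw [Set.indicator_of_notMem h, Set.indicator_of_notMem h, ENNReal.toReal_zero]
    · exact ne_top_of_le_ne_top ENNReal.one_ne_top (Set.indicator_le_self' (by simp) _)
  rw [this]
  refine Measurable.ennreal_toReal (Measurable.tsum fun γ => ?_)
  exact (measurable_const.indicator isClosed_fd.measurableSet).comp (measurable_const_smul γ)

lemma isWeight_modularWeight : IsWeight SL(2, ℤ) modularWeight := by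
  refine ⟨measurable_fdCount.inv.indicator isClosed_fd.measurableSet, fun z => ?_, fun z => ?_⟩
  · exact Set.indicator_nonneg (fun _ _ => by positivity) _
  · have h := (fdCount_eq_tsum z).mul_left (fdCount z : ℝ)⁻¹
    rw [inv_mul_cancel₀ (Nat.cast_ne_zero.mpr (fdCount_pos z).ne')] at h
    refine (hasSum_congr_terms fun γ => ?_).mp h
    by_cases hγ : γ • z ∈ 𝒟
    · rw [modularWeight, Set.indicator_of_mem hγ, Set.indicator_of_mem hγ, fdCount_smul, mul_one]
    · rw [modularWeight, Set.indicator_of_notMem hγ, Set.indicator_of_notMem hγ, mul_zero]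

/-- 𝒟 lies in the strip |x| ≤ 1/2, y ≥ 1/2, whose hyperbolic area is finite because y⁻² is
integrable there. -/
lemma volume_fd_lt_top : volume (𝒟 : Set ℍ) < ⊤ := by
  rw [volume_eq_lintegral]
  set B : Set ℂ := Set.Icc (-1 / 2) (1 / 2) ×ℂ Set.Ici (1 / 2) with hB
  have hsub : UpperHalfPlane.coe '' 𝒟 ⊆ B := by
    rw [coe_fd]
    rintro z ⟨h1, h2, h3⟩
    have h3' := abs_le.mp h3
    refine ⟨⟨by simpa [neg_div] using h3'.1, by simpa using h3'.2⟩, ?_⟩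
    have h4 : 1 ≤ z.re ^ 2 + z.im ^ 2 := by
      rw [← one_le_sq_iff₀ (norm_nonneg z), ← Complex.normSq_eq_norm_sq, Complex.normSq_apply] at h2
      nlinarith
    change 1 / 2 ≤ z.im
    nlinarith
  refine (lintegral_mono_set hsub).trans_lt ?_
  have e : ∀ z : ℂ, (((1 / ‖z.im‖₊) ^ 2 : NNReal) : ENNReal) =
      (fun p : ℝ × ℝ => (1 : ENNReal) * (((1 / ‖p.2‖₊) ^ 2 : NNReal) : ENNReal))
        (Complex.measurableEquivRealProd z) := fun z => by simp
  have hB' : B = Complex.measurableEquivRealProd ⁻¹' (Set.Icc (-1 / 2) (1 / 2) ×ˢ Set.Ici (1 / 2)) := by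
    ext z; simp [hB, Complex.mem_reProdIm]
  rw [hB', lintegral_congr e]
  refine (Complex.volume_preserving_equiv_real_prod.setLIntegral_comp_preimage_emb
    Complex.measurableEquivRealProd.measurableEmbedding (fun p : ℝ × ℝ =>
      (1 : ENNReal) * (((1 / ‖p.2‖₊) ^ 2 : NNReal) : ENNReal)) _).trans_lt ?_
  rw [Measure.volume_eq_prod, ← Measure.prod_restrict,
    lintegral_prod_mul (f := fun _ => 1) (g := fun y : ℝ => (((1 / ‖y‖₊) ^ 2 : NNReal) : ENNReal))
      (by fun_prop) (by fun_prop)]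
  refine ENNReal.mul_lt_top (by simp) ?_
  have hint : IntegrableOn (fun y : ℝ => y ^ (-2 : ℝ)) (Set.Ici (1 / 2)) := by
    rw [integrableOn_Ici_iff_integrableOn_Ioi]
    exact integrableOn_Ioi_rpow_of_lt (by norm_num) (by norm_num)
  refine lt_of_le_of_lt (setLIntegral_mono' measurableSet_Ici fun y hy => ?_) hint.2
  have hy0 : 0 < y := lt_of_lt_of_le (by norm_num) hy
  have : (((1 / ‖y‖₊) ^ 2 : NNReal) : ENNReal) = ‖y ^ (-2 : ℝ)‖ₑ := by
    rw [enorm_eq_nnnorm]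
    congr 1
    ext
    simp [Real.rpow_neg hy0.le, Real.norm_of_nonneg hy0.le]
  exact this.le

lemma integrable_modularWeight : Integrable modularWeight volume := by
  refine Integrable.mono' (g := (𝒟 : Set ℍ).indicator fun _ => (1 : ℝ)) ?_
    isWeight_modularWeight.measurable.aestronglyMeasurable (Eventually.of_forall fun z => ?_)
  · exact (integrable_indicator_iff isClosed_fd.measurableSet).mpr
      (integrableOn_const volume_fd_lt_top.ne)
  · rw [Real.norm_of_nonneg (isWeight_modularWeight.nonneg z), modularWeight]
    refine Set.indicator_le_indicator ?_
    exact inv_le_one_of_one_le₀ (by exact_mod_cast fdCount_pos z)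

/-- Every finite index subgroup of the modular group has an integrable weight. -/
theorem exists_weight (Γ : Subgroup SL(2, ℤ)) [Γ.FiniteIndex] :
    ∃ ψ : ℍ → ℝ, IsWeight Γ ψ ∧ Integrable ψ volume :=
  ⟨_, isWeight_modularWeight.subgroup Γ,
    integrable_finsum_smul integrable_modularWeight Γ⟩

/-- The density y⁻² is positive. This lets a continuous function that vanishes almost everywhere be
zero, as definiteness of the Petersson product requires. -/
instance : Measure.IsOpenPosMeasure (volume : Measure ℍ) := by
  constructor
  intro U hU hne h0
  rw [volume_def] at h0
  have h1 : (volume.comap UpperHalfPlane.coe) U = 0 := by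
    refine withDensity_absolutelyContinuous' ?_ (Eventually.of_forall fun z => ?_) h0
    · refine Measurable.aemeasurable (measurable_coe_nnreal_ennreal.comp ?_)
      refine (measurable_const.div ?_).pow_const 2
      exact continuous_im.measurable.subtype_mk
    · have := z.im_pos
      rw [ENNReal.coe_ne_zero]
      refine pow_ne_zero 2 (div_ne_zero one_ne_zero fun h => this.ne' ?_)
      exact congrArg NNReal.toReal h
  rw [measurableEmbedding_coe.comap_apply] at h1
  exact (isOpenEmbedding_coe.isOpenMap U hU).measure_ne_zero volume (hne.image _) h1

end ModularWeight

/-! ### The Petersson integrand -/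

section Petersson

open MeasureTheory
open scoped ComplexConjugate

variable {k : ℤ} {p : ℕ} [Fact p.Prime] {ε : ℂ} {f g : ℍ → ℂ}

/-- The integrand `F(z) conj(g(z)) y^{k+1/2}` of the Petersson product. -/
def pet (k : ℤ) (F g : ℍ → ℂ) (z : ℍ) : ℂ := F z * conj (g z) * ((z.im ^ ((k : ℝ) + 1 / 2) : ℝ) : ℂ)

omit [Fact p.Prime] in
lemma norm_pet_le {F : ℍ → ℂ} (hF : HasCuspBound k F) (hg : HasCuspBound k g) :
    ∃ C, ∀ z, ‖pet k F g z‖ ≤ C := by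
  obtain ⟨A, hA⟩ := hF
  obtain ⟨B, hB⟩ := hg
  refine ⟨A * B, fun z => ?_⟩
  have hy := z.im_pos
  have h1 := Real.rpow_pos_of_pos hy (-((k : ℝ) + 1 / 2) / 2)
  have e : z.im ^ (-((k : ℝ) + 1 / 2) / 2) * z.im ^ (-((k : ℝ) + 1 / 2) / 2) *
      z.im ^ ((k : ℝ) + 1 / 2) = 1 := by
    rw [← Real.rpow_add hy, ← Real.rpow_add hy]
    ring_nf
    exact Real.rpow_zero _
  rw [pet, norm_mul, norm_mul, RCLike.norm_conj, Complex.norm_real,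
    Real.norm_of_nonneg (Real.rpow_nonneg hy.le _)]
  calc _ ≤ (A * z.im ^ (-((k : ℝ) + 1 / 2) / 2)) * (B * z.im ^ (-((k : ℝ) + 1 / 2) / 2)) *
        z.im ^ ((k : ℝ) + 1 / 2) := by
        refine mul_le_mul_of_nonneg_right ?_ (Real.rpow_nonneg hy.le _)
        exact mul_le_mul (hA z) (hB z) (norm_nonneg _) ((norm_nonneg _).trans (hA z))
    _ = A * B * (z.im ^ (-((k : ℝ) + 1 / 2) / 2) * z.im ^ (-((k : ℝ) + 1 / 2) / 2) *
        z.im ^ ((k : ℝ) + 1 / 2)) := by ring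
    _ = A * B := by rw [e, mul_one]

lemma continuous_pet {F : ℍ → ℂ} (hF : Continuous F) (hg : Continuous g) :
    Continuous (pet k F g) := by
  refine (hF.mul (Complex.continuous_conj.comp hg)).mul (Complex.continuous_ofReal.comp ?_)
  exact continuous_im.rpow_const fun z => Or.inl z.im_ne_zero

lemma integrable_weight_mul_pet {ψ : ℍ → ℝ} (hψ : Integrable ψ volume) {F : ℍ → ℂ}
    (hF : Continuous F) (hFb : HasCuspBound k F) (hg : Continuous g) (hgb : HasCuspBound k g) :
    Integrable (fun z => (ψ z : ℂ) * pet k F g z) volume := by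
  obtain ⟨C, hC⟩ := norm_pet_le hFb hgb
  exact hψ.ofReal.mul_bdd (c := C) (continuous_pet hF hg).aestronglyMeasurable
    (Eventually.of_forall hC)

lemma norm_thetaMultiplier_sq {γ : SL(2, ℤ)} (hγ : γ ∈ CongruenceSubgroup.Gamma0 4) (z : ℍ) :
    ‖thetaMultiplier γ z‖ ^ 2 = ‖(γ 1 0 : ℂ) * z + γ 1 1‖ := by
  have h := theta_smul_pow_four hγ z
  have h0 := theta_ne_zero z
  have h1 : thetaMultiplier γ z ^ 4 = ((γ 1 0 : ℂ) * z + γ 1 1) ^ 2 := by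
    rw [thetaMultiplier, div_pow, h]
    field_simp
  have h2 := congrArg norm h1
  rw [norm_pow, norm_pow] at h2
  refine (sq_eq_sq₀ (by positivity) (by positivity)).mp ?_
  rw [← h2, ← pow_mul]

/-- F' may differ from F because γ turns one Hecke term into another. -/
lemma pet_smul (hg : g ∈ cuspForms k) {γ : SL(2, ℤ)} (hγ : γ ∈ CongruenceSubgroup.Gamma0 4)
    {F F' : ℍ → ℂ} {z : ℍ} (hF : F (γ • z) = thetaMultiplier γ z ^ (2 * k + 1) * F' z) :
    pet k F g (γ • z) = pet k F' g z := by
  have hj := norm_pos_iff.mpr (bottom_ne_zero γ z)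
  have hm := norm_thetaMultiplier_sq hγ z
  set m := thetaMultiplier γ z with hmdef
  have h1 : m ^ (2 * k + 1) * conj (m ^ (2 * k + 1)) =
      ((‖(γ 1 0 : ℂ) * z + γ 1 1‖ ^ (2 * k + 1) : ℝ) : ℂ) := by
    rw [Complex.mul_conj, Complex.normSq_eq_norm_sq, norm_zpow, ← hm, ← zpow_natCast, ← zpow_natCast,
      ← zpow_mul, ← zpow_mul, mul_comm]
  have h2 : (γ • z).im ^ ((k : ℝ) + 1 / 2) * ‖(γ 1 0 : ℂ) * z + γ 1 1‖ ^ (2 * k + 1) =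
      z.im ^ ((k : ℝ) + 1 / 2) := by
    rw [smul_im_eq, Real.div_rpow z.im_pos.le (by positivity), ← Real.rpow_natCast _ 2,
      ← Real.rpow_mul hj.le, ← Real.rpow_intCast]
    have : ((2 : ℕ) : ℝ) * ((k : ℝ) + 1 / 2) = ((2 * k + 1 : ℤ) : ℝ) := by push_cast; ring
    rw [this]
    exact div_mul_cancel₀ _ (Real.rpow_pos_of_pos hj _).ne'
  rw [pet, pet, hF, hg.transform γ hγ z, ← hmdef, ← h2, map_mul]
  push_cast at h1 ⊢
  linear_combination F' z * conj (g z) * ((γ • z).im ^ ((k : ℝ) + 1 / 2) : ℝ) * h1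

lemma hasCuspBound_heckeTerm (hf : HasCuspBound k f) (x : HeckeIndex p) :
    HasCuspBound k fun z : ℍ => heckeTerm k p f x z := by
  obtain ⟨C, hC⟩ := hf
  obtain ⟨A, s, t, hs, h⟩ := heckeTerm_eq (k := k) (f := f) x
  refine ⟨‖A‖ * (C * s ^ (-((k : ℝ) + 1 / 2) / 2)), fun z => ?_⟩
  change ‖heckeTerm k p f x z‖ ≤ _
  rw [h, norm_mul, mul_assoc]
  exact mul_le_mul_of_nonneg_left (norm_lift_le hC hs z) (norm_nonneg _)

/-! ### Equivariance of the terms of the Hecke operator -/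

variable (k p f) in
/-- The quotients of the terms of the Hecke operator by a power of theta, indexed by rows. -/
def rowTerm (c d : ℤ) (z : ℍ) : ℂ :=
  -- The value 0 on rows divisible by p makes the equivariance relations hold for all integral rows,
  -- as `gamma0_four_equivariant` demands.
  if (p : ℤ) ∣ c ∧ (p : ℤ) ∣ d then 0
  else heckeTerm k p f (heckeClass p c d) z / theta z ^ (2 * k + 1)

lemma rowTerm_vadd_one (hf : f ∈ cuspForms k) (c d : ℤ) (z : ℍ) :
    rowTerm k p f c d ((1 : ℝ) +ᵥ z) = rowTerm k p f c (c + d) z := by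
  have h1 : ((p : ℤ) ∣ c ∧ (p : ℤ) ∣ c + d) ↔ ((p : ℤ) ∣ c ∧ (p : ℤ) ∣ d) :=
    and_congr_right fun h => dvd_add_right h
  by_cases h : (p : ℤ) ∣ c ∧ (p : ℤ) ∣ d
  · rw [rowTerm, rowTerm, if_pos h, if_pos (h1.mpr h)]
  · rw [rowTerm, rowTerm, if_neg h, if_neg (mt h1.mp h), theta_vadd_one, coe_vadd,
      Complex.ofReal_one, add_comm (1 : ℂ), heckeTerm_add_one hf h]

lemma rowTerm_frickePoint (hp : p ≠ 2) (hε : ε ^ 2 = 1) (hf : f ∈ frickeSpace k ε) (c d : ℤ)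
    (z : ℍ) : rowTerm k p f c d (frickePoint z) = ε * rowTerm k p f (4 * d) (-c) z := by
  have h1 : ((p : ℤ) ∣ 4 * d ∧ (p : ℤ) ∣ -c) ↔ ((p : ℤ) ∣ c ∧ (p : ℤ) ∣ d) := by
    rw [dvd_neg, and_comm]
    exact and_congr_right fun _ => ⟨fun h => (prime_int.dvd_or_dvd h).resolve_left
      (not_dvd_four hp), fun h => h.mul_left _⟩
  by_cases h : (p : ℤ) ∣ c ∧ (p : ℤ) ∣ d
  · rw [rowTerm, rowTerm, if_pos h, if_pos (h1.mpr h), mul_zero]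
  · have h0 := neg_two_I_mul_ne_zero z
    have h2 := cpow_ne_zero' h0 ((k : ℂ) + 1 / 2)
    have h3 := zpow_ne_zero (2 * k + 1) (theta_ne_zero z)
    rw [rowTerm, rowTerm, if_neg h, if_neg (mt h1.mp h), theta_frickePoint, mul_zpow, cpow_half_zpow,
      coe_frickePoint, heckeTerm_neg_inv hp hε hf h z.im_pos]
    generalize (-2 * Complex.I * (z : ℂ)) ^ ((k : ℂ) + 1 / 2) = U at h2 ⊢
    field_simp

lemma rowTerm_mul (c d : ℤ) {m : ℤ} (hm : ¬ (p : ℤ) ∣ m) (z : ℍ) :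
    rowTerm k p f (m * c) (m * d) z = rowTerm k p f c d z := by
  have h1 : ((p : ℤ) ∣ m * c ∧ (p : ℤ) ∣ m * d) ↔ ((p : ℤ) ∣ c ∧ (p : ℤ) ∣ d) := by
    rw [prime_int.dvd_mul, prime_int.dvd_mul]
    tauto
  by_cases h : (p : ℤ) ∣ c ∧ (p : ℤ) ∣ d
  · rw [rowTerm, rowTerm, if_pos h, if_pos (h1.mpr h)]
  · rw [rowTerm, rowTerm, if_neg h, if_neg (mt h1.mp h), heckeClass_mul hm h]

lemma rowTerm_smul (hp : p ≠ 2) (hε : ε ^ 2 = 1) (hf : f ∈ frickeSpace k ε) {γ : SL(2, ℤ)}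
    (hγ : γ ∈ CongruenceSubgroup.Gamma0 4) (z : ℍ) :
    rowTerm k p f 0 1 (γ • z) = rowTerm k p f (γ 1 0) (γ 1 1) z := by
  refine gamma0_four_equivariant (S := rowTerm k p f) (fun c d z => ?_)
    (rowTerm_vadd_one hf.1) (fun c d z => ?_) hγ z
  · have := rowTerm_mul (k := k) (p := p) (f := f) c d (m := -1)
      (by rw [dvd_neg]; exact prime_int.not_dvd_one) z
    rw [← this]
    simp
  · have hT (c d : ℤ) (z : ℍ) : rowTerm k p f c d ((-1 : ℝ) +ᵥ z) = rowTerm k p f c (d - c) z := by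
      have := rowTerm_vadd_one (p := p) hf.1 c (d - c) ((-1 : ℝ) +ᵥ z)
      rw [vadd_vadd] at this
      simp only [add_neg_cancel, zero_vadd, add_sub_cancel] at this
      exact this.symm
    -- Fricke, T⁻¹ and Fricke carry (c, d) to -4(c + 4d, d), and a scalar prime to p does not change
    -- the class.
    have h4 : ¬ (p : ℤ) ∣ -4 := by rw [dvd_neg]; exact not_dvd_four hp
    rw [lowerGen_smul, rowTerm_frickePoint hp hε hf, hT, rowTerm_frickePoint hp hε hf, ← mul_assoc,
      ← sq, hε, one_mul, ← rowTerm_mul (c + 4 * d) d h4]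
    congr 1 <;> ring

/-- Up to the multiplier, the translates of the term p^{2k-1} f(p²z) under Γ₀(4) are again terms of
T(p²). This is what makes the unfolding possible. -/
lemma heckeTerm_smul (hp : p ≠ 2) (hε : ε ^ 2 = 1) (hf : f ∈ frickeSpace k ε) {γ : SL(2, ℤ)}
    (hγ : γ ∈ CongruenceSubgroup.Gamma0 4) (z : ℍ) :
    heckeTerm k p f (.inr 0) (γ • z : ℍ) = thetaMultiplier γ z ^ (2 * k + 1) *
      heckeTerm k p f (heckeClass p (γ 1 0) (γ 1 1)) z := by
  have h := rowTerm_smul hp hε hf hγ z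
  have h01 : ¬((p : ℤ) ∣ 0 ∧ (p : ℤ) ∣ 1) := fun h => prime_int.not_dvd_one h.2
  have hdet : γ 0 0 * γ 1 1 - γ 0 1 * γ 1 0 = 1 := by
    rw [← Matrix.det_fin_two]; exact γ.det_coe
  have hγp : ¬((p : ℤ) ∣ γ 1 0 ∧ (p : ℤ) ∣ γ 1 1) := fun h =>
    prime_int.not_dvd_one (hdet ▸ dvd_sub (h.2.mul_left _) (h.1.mul_left _))
  have hc : heckeClass p 0 1 = .inr 0 := by
    rw [heckeClass, if_pos (dvd_zero _)]; simp
  have h1 := zpow_ne_zero (2 * k + 1) (theta_ne_zero z)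
  have h2 := zpow_ne_zero (2 * k + 1) (theta_ne_zero (γ • z))
  rw [rowTerm, rowTerm, if_neg h01, if_neg hγp, hc, div_eq_div_iff h2 h1] at h
  rw [thetaMultiplier, div_zpow]
  field_simp
  linear_combination h

end Petersson

/-! ### Cosets of `Γ₀(4p²)` in `Γ₀(4)` -/

section Cosets

variable {p : ℕ} [Fact p.Prime]

lemma det_eq_one (γ : SL(2, ℤ)) : γ 0 0 * γ 1 1 - γ 0 1 * γ 1 0 = 1 := by
  rw [← Matrix.det_fin_two]; exact γ.det_coe

lemma row_primitive (γ : SL(2, ℤ)) : ¬((p : ℤ) ∣ γ 1 0 ∧ (p : ℤ) ∣ γ 1 1) := fun h =>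
  prime_int.not_dvd_one (det_eq_one γ ▸ dvd_sub (h.2.mul_left _) (h.1.mul_left _))

lemma mem_gamma0_iff {N : ℕ} {γ : SL(2, ℤ)} :
    γ ∈ CongruenceSubgroup.Gamma0 N ↔ (N : ℤ) ∣ γ 1 0 := by
  rw [CongruenceSubgroup.Gamma0_mem, ZMod.intCast_zmod_eq_zero_iff_dvd]

lemma exists_heckeClass_eq (hp : p ≠ 2) (x : HeckeIndex p) :
    ∃ γ ∈ CongruenceSubgroup.Gamma0 4, heckeClass p (γ 1 0) (γ 1 1) = x := by
  suffices h : ∃ c d : ℤ, IsCoprime (4 * c) d ∧ heckeClass p (4 * c) d = x by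
    obtain ⟨c, d, hcd, hx⟩ := h
    obtain ⟨γ, -, hγ⟩ := ModularGroup.bottom_row_surj (R := ℤ)
      (show (![4 * c, d] : Fin 2 → ℤ) ∈ {cd : Fin 2 → ℤ | IsCoprime (cd 0) (cd 1)} from hcd)
    have h0 : γ 1 0 = 4 * c := congrFun hγ 0
    have h1 : γ 1 1 = d := congrFun hγ 1
    refine ⟨γ, mem_gamma0_iff.mpr ?_, by rw [h0, h1, hx]⟩
    rw [h0]
    exact dvd_mul_right _ _
  have h4 := not_dvd_four hp
  rcases x with b | h
  -- The row (4, 4b + p²): adding p² makes the second entry odd without changing its class.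
  · refine ⟨1, 4 * b.cast + p ^ 2, ?_, ?_⟩
    · have h2 : IsCoprime ((p : ℤ) ^ 2) 4 := ((prime_int.coprime_iff_not_dvd).mpr h4).pow_left
      rw [mul_one, add_comm, mul_comm]
      exact (IsCoprime.add_mul_right_right_iff).mpr h2.symm
    · have hu := isUnit_intCast_of_not_dvd h4
      have h1 := ZMod.mul_inv_of_unit _ hu
      rw [mul_one, heckeClass, if_neg h4]
      congr 1
      have h0 : (p : ZMod (p ^ 2)) ^ 2 = 0 := by rw [← Nat.cast_pow, ZMod.natCast_self]
      push_cast at h1 ⊢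
      rw [h0]
      linear_combination b * h1
  · refine ⟨p * ((4 * h : ZMod p)⁻¹).cast, 1, isCoprime_one_right, ?_⟩
    have h4z : (4 : ZMod p) ≠ 0 := by exact_mod_cast intCast_ne_zero_iff.mpr h4
    rw [mul_left_comm, heckeClass, if_pos (dvd_mul_right _ _),
      Int.mul_ediv_cancel_left _ prime_cast_ne_zero]
    congr 1
    push_cast
    rw [mul_inv, mul_inv, mul_inv, inv_inv, inv_inv, one_mul, ← mul_assoc,
      inv_mul_cancel₀ h4z, one_mul]

variable (p) in
/-- Representatives of the cosets. -/
def cosetRep (hp : p ≠ 2) (x : HeckeIndex p) : CongruenceSubgroup.Gamma0 4 :=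
  ⟨(exists_heckeClass_eq hp x).choose, (exists_heckeClass_eq hp x).choose_spec.1⟩

lemma heckeClass_cosetRep (hp : p ≠ 2) (x : HeckeIndex p) :
    heckeClass p ((cosetRep p hp x : SL(2, ℤ)) 1 0) ((cosetRep p hp x : SL(2, ℤ)) 1 1) = x :=
  (exists_heckeClass_eq hp x).choose_spec.2

omit [Fact p.Prime] in
lemma gamma0_le : CongruenceSubgroup.Gamma0 (4 * p ^ 2) ≤ CongruenceSubgroup.Gamma0 4 := by
  intro γ hγ
  rw [mem_gamma0_iff] at hγ ⊢
  push_cast at hγ ⊢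
  exact (dvd_mul_right _ _).trans hγ

lemma heckeClass_mul_left {γ : SL(2, ℤ)} (hγ : γ ∈ CongruenceSubgroup.Gamma0 (4 * p ^ 2))
    (δ : SL(2, ℤ)) : heckeClass p ((γ * δ) 1 0) ((γ * δ) 1 1) = heckeClass p (δ 1 0) (δ 1 1) := by
  rw [heckeClass_eq_iff (row_primitive _) (row_primitive _)]
  rw [mem_gamma0_iff] at hγ
  have h1 : (p : ℤ) ^ 2 ∣ γ 1 0 := by
    push_cast at hγ
    exact (dvd_mul_left _ _).trans hγ
  have e0 : (γ * δ) 1 0 = γ 1 0 * δ 0 0 + γ 1 1 * δ 1 0 := by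
    rw [Matrix.SpecialLinearGroup.coe_mul, Matrix.mul_apply, Fin.sum_univ_two]
  have e1 : (γ * δ) 1 1 = γ 1 0 * δ 0 1 + γ 1 1 * δ 1 1 := by
    rw [Matrix.SpecialLinearGroup.coe_mul, Matrix.mul_apply, Fin.sum_univ_two]
  rw [e0, e1]
  have : (γ 1 0 * δ 0 0 + γ 1 1 * δ 1 0) * δ 1 1 - (γ 1 0 * δ 0 1 + γ 1 1 * δ 1 1) * δ 1 0 =
      γ 1 0 * (δ 0 0 * δ 1 1 - δ 0 1 * δ 1 0) := by ring
  rw [this]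
  exact h1.mul_right _

lemma mul_inv_mem_gamma0 (hp : p ≠ 2) {γ δ : SL(2, ℤ)} (hγ : γ ∈ CongruenceSubgroup.Gamma0 4)
    (hδ : δ ∈ CongruenceSubgroup.Gamma0 4)
    (h : heckeClass p (γ 1 0) (γ 1 1) = heckeClass p (δ 1 0) (δ 1 1)) :
    γ * δ⁻¹ ∈ CongruenceSubgroup.Gamma0 (4 * p ^ 2) := by
  rw [heckeClass_eq_iff (row_primitive _) (row_primitive _)] at h
  rw [mem_gamma0_iff] at hγ hδ ⊢
  have e0 : (γ * δ⁻¹) 1 0 = γ 1 0 * δ 1 1 - γ 1 1 * δ 1 0 := by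
    rw [Matrix.SpecialLinearGroup.coe_mul, Matrix.mul_apply, Fin.sum_univ_two,
      Matrix.SpecialLinearGroup.coe_inv, Matrix.adjugate_fin_two]
    simp
    ring
  rw [e0]
  push_cast at hγ hδ ⊢
  refine IsCoprime.mul_dvd ?_ (dvd_sub (hγ.mul_right _) (hδ.mul_left _)) h
  exact (((prime_int.coprime_iff_not_dvd).mpr (not_dvd_four hp)).pow_left (m := 2)).symm

/-- The class of the bottom row is a complete invariant of the cosets Γ₀(4p²)γ in Γ₀(4). -/
lemma bijective_mul_cosetRep (hp : p ≠ 2) : Function.Bijective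
    fun x : HeckeIndex p × CongruenceSubgroup.Gamma0 (4 * p ^ 2) =>
      (⟨x.2, gamma0_le x.2.2⟩ * cosetRep p hp x.1 : CongruenceSubgroup.Gamma0 4) := by
  constructor
  · rintro ⟨x, γ⟩ ⟨x', γ'⟩ h
    have h' := congrArg (fun δ : CongruenceSubgroup.Gamma0 4 =>
      heckeClass p ((δ : SL(2, ℤ)) 1 0) ((δ : SL(2, ℤ)) 1 1)) h
    simp only [Subgroup.coe_mul, heckeClass_mul_left γ.2, heckeClass_mul_left γ'.2,
      heckeClass_cosetRep] at h'
    subst h'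
    have := congrArg Subtype.val (mul_right_cancel h)
    exact Prod.ext rfl (Subtype.ext this)
  · intro γ
    refine ⟨(heckeClass p ((γ : SL(2, ℤ)) 1 0) ((γ : SL(2, ℤ)) 1 1), ⟨γ * (cosetRep p hp _ : SL(2, ℤ))⁻¹,
      mul_inv_mem_gamma0 hp γ.2 (Subtype.mem _) (heckeClass_cosetRep hp _).symm⟩), ?_⟩
    exact Subtype.ext (by simp)

end Cosets

/-! ### The Hecke operators are symmetric -/

section Symmetric

open MeasureTheory
open scoped ComplexConjugate

lemma hasSum_prod_of_fintype {X Y : Type*} [Fintype X] [DecidableEq X] {F : X × Y → ℂ} {a : X → ℂ}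
    (h : ∀ x, HasSum (fun y => F (x, y)) (a x)) : HasSum F (∑ x, a x) := by
  have h1 (x : X) : HasSum (fun v : X × Y => if v.1 = x then F v else 0) (a x) := by
    refine ((Prod.mk_right_injective x).hasSum_iff fun v hv => if_neg fun h => hv ⟨v.2, ?_⟩).mp ?_
    · exact Prod.ext h.symm rfl
    · refine (hasSum_congr_terms fun y => ?_).mp (h x)
      exact (if_pos rfl).symm
  refine (hasSum_congr_terms fun v => ?_).mp (hasSum_sum fun x (_ : x ∈ Finset.univ) => h1 x)
  simp

variable {k : ℤ} {p : ℕ} [Fact p.Prime] {ε : ℂ} {f g : ℍ → ℂ}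

variable (k p) in
/-- The Petersson integrand of one term of the Hecke operator. -/
def heckePet (f g : ℍ → ℂ) (z : ℍ) : ℂ := pet k (fun z => heckeTerm k p f (.inr 0) z) g z

lemma heckePet_smul (hp : p ≠ 2) (hε : ε ^ 2 = 1) (hf : f ∈ frickeSpace k ε) (hg : g ∈ cuspForms k)
    {γ : SL(2, ℤ)} (hγ : γ ∈ CongruenceSubgroup.Gamma0 4) (z : ℍ) :
    heckePet k p f g (γ • z) =
      pet k (fun z => heckeTerm k p f (heckeClass p (γ 1 0) (γ 1 1)) z) g z :=
  pet_smul (F' := fun z : ℍ => heckeTerm k p f (heckeClass p (γ 1 0) (γ 1 1)) z) hg hγ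
    (heckeTerm_smul hp hε hf hγ z)

lemma heckePet_smul_of_mem (hp : p ≠ 2) (hε : ε ^ 2 = 1) (hf : f ∈ frickeSpace k ε)
    (hg : g ∈ cuspForms k) {γ : SL(2, ℤ)} (hγ : γ ∈ CongruenceSubgroup.Gamma0 (4 * p ^ 2)) (z : ℍ) :
    heckePet k p f g (γ • z) = heckePet k p f g z := by
  have h := heckeClass_mul_left (p := p) hγ 1
  have h1 : heckeClass p ((1 : SL(2, ℤ)) 1 0) ((1 : SL(2, ℤ)) 1 1) = .inr 0 := by
    change heckeClass p 0 1 = _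
    rw [heckeClass, if_pos (dvd_zero _)]; simp
  rw [mul_one, h1] at h
  rw [heckePet_smul hp hε hf hg (gamma0_le hγ), h]
  rfl

lemma pet_heckeSum (z : ℍ) :
    pet k (heckeSum k p f) g z = ∑ x, pet k (fun z => heckeTerm k p f x z) g z := by
  simp only [pet, heckeSum, Finset.sum_mul]

/-- Γ₀(4) is split into cosets of Γ₀(4p²). On the coset of index x the integrand is constantly the
x-th Hecke term, and the values of Ψ sum to 1. -/
lemma tsum_weight_mul_heckePet (hp : p ≠ 2) (hε : ε ^ 2 = 1) (hf : f ∈ frickeSpace k ε)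
    (hg : g ∈ cuspForms k) {Ψ : ℍ → ℝ} (hΨ : IsWeight (CongruenceSubgroup.Gamma0 (4 * p ^ 2)) Ψ)
    (z : ℍ) :
    ∑' γ : CongruenceSubgroup.Gamma0 4, (Ψ (γ • z) : ℂ) * heckePet k p f g (γ • z) =
      pet k (heckeSum k p f) g z := by
  classical
  refine HasSum.tsum_eq ?_
  refine (Equiv.ofBijective _ (bijective_mul_cosetRep hp)).hasSum_iff.mp ?_
  rw [pet_heckeSum]
  refine hasSum_prod_of_fintype fun x => ?_
  have h := ((Complex.hasSum_ofReal (x := 1)).mpr (hΨ.hasSum (cosetRep p hp x • z))).mul_right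
    (pet k (fun z => heckeTerm k p f x z) g z)
  rw [Complex.ofReal_one, one_mul] at h
  refine (hasSum_congr_terms fun γ => ?_).mp h
  have e1 : heckePet k p f g (((γ : SL(2, ℤ)) * (cosetRep p hp x : SL(2, ℤ))) • z) =
      pet k (fun z => heckeTerm k p f x z) g z := by
    rw [heckePet_smul hp hε hf hg (mul_mem (gamma0_le γ.2) (cosetRep p hp x).2),
      heckeClass_mul_left γ.2, heckeClass_cosetRep]
  rw [← e1]
  congr 2
  change Ψ ((γ : SL(2, ℤ)) • (cosetRep p hp x : SL(2, ℤ)) • z) =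
    Ψ (((γ : SL(2, ℤ)) * (cosetRep p hp x : SL(2, ℤ))) • z)
  rw [mul_smul]

lemma continuous_of_mem (hf : f ∈ cuspForms k) : Continuous f := hf.holo.continuous

lemma integrable_weight_mul_heckePet {Ψ : ℍ → ℝ}
    (hi : Integrable Ψ volume) (hf : f ∈ cuspForms k) (hg : g ∈ cuspForms k) :
    Integrable (fun z => (Ψ z : ℂ) * heckePet k p f g z) volume :=
  integrable_weight_mul_pet hi (mdifferentiable_heckeTerm hf.holo _).continuous
    (hasCuspBound_heckeTerm (hasCuspBound_of_mem hf) _) (continuous_of_mem hg)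
    (hasCuspBound_of_mem hg)

/-- Unfolding: all of T(p²) at level 4 becomes the one term with f(p²z) at level 4p². -/
lemma integral_pet_heckeSum (hp : p ≠ 2) (hε : ε ^ 2 = 1) (hf : f ∈ frickeSpace k ε)
    (hg : g ∈ cuspForms k) {ψ Ψ : ℍ → ℝ} (hψ : IsWeight (CongruenceSubgroup.Gamma0 4) ψ)
    (hΨ : IsWeight (CongruenceSubgroup.Gamma0 (4 * p ^ 2)) Ψ) (hi : Integrable Ψ volume) :
    ∫ z, (ψ z : ℂ) * pet k (heckeSum k p f) g z = ∫ z, (Ψ z : ℂ) * heckePet k p f g z := by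
  rw [← hψ.integral_tsum_smul (integrable_weight_mul_heckePet hi hf.1 hg)]
  simp only [tsum_weight_mul_heckePet hp hε hf hg hΨ]

variable (p) in
/-- The matrix of `z ↦ -1 / (4p²z)`. -/
def levelFricke : GL (Fin 2) ℝ :=
  Matrix.GeneralLinearGroup.mkOfDetNeZero !![0, -1; 4 * (p : ℝ) ^ 2, 0] (by
    have := prime_pos (p := p)
    rw [Matrix.det_fin_two_of]
    have : 0 < (p : ℝ) ^ 2 := by positivity
    nlinarith)

lemma coe_levelFricke_smul (z : ℍ) : ((levelFricke p • z : ℍ) : ℂ) = -1 / (4 * (p ^ 2 * z)) := by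
  have hp := prime_pos (p := p)
  have hdet : 0 < (levelFricke p).det.val := by
    change 0 < Matrix.det !![0, -1; 4 * (p : ℝ) ^ 2, 0]
    rw [Matrix.det_fin_two_of]
    have : 0 < (p : ℝ) ^ 2 := by positivity
    nlinarith
  rw [coe_smul_of_det_pos hdet, num, denom]
  simp [levelFricke, Matrix.GeneralLinearGroup.mkOfDetNeZero, mul_assoc]

/-- Conjugation by `levelFricke` on `Γ₀(N)`. -/
def gamma0Flip (N : ℕ) (γ : CongruenceSubgroup.Gamma0 N) : CongruenceSubgroup.Gamma0 N :=
  ⟨⟨!![(γ : SL(2, ℤ)) 1 1, -((γ : SL(2, ℤ)) 1 0 / N); -(N * (γ : SL(2, ℤ)) 0 1),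
    (γ : SL(2, ℤ)) 0 0], by
      have h := det_eq_one (γ : SL(2, ℤ))
      have h1 := Int.mul_ediv_cancel' (mem_gamma0_iff.mp γ.2)
      rw [Matrix.det_fin_two_of]
      linear_combination h - (γ : SL(2, ℤ)) 0 1 * h1⟩,
    mem_gamma0_iff.mpr (by simp)⟩

lemma gamma0Flip_involutive {N : ℕ} (hN : N ≠ 0) : Function.Involutive (gamma0Flip N) := by
  intro γ
  have h1 := Int.mul_ediv_cancel' (mem_gamma0_iff.mp γ.2)
  have hN' : (N : ℤ) ≠ 0 := by exact_mod_cast hN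
  apply Subtype.ext
  apply Subtype.ext
  ext i j
  have h2 : -(-(N * (γ : SL(2, ℤ)) 0 1) / (N : ℤ)) = (γ : SL(2, ℤ)) 0 1 := by
    rw [← mul_neg, Int.mul_ediv_cancel_left _ hN', neg_neg]
  fin_cases i <;> fin_cases j <;> simp [gamma0Flip, h1, h2]

lemma levelFricke_smul_smul (γ : CongruenceSubgroup.Gamma0 (4 * p ^ 2)) (z : ℍ) :
    levelFricke p • γ • z = gamma0Flip _ γ • levelFricke p • z := by
  have h1 := Int.mul_ediv_cancel' (mem_gamma0_iff.mp γ.2)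
  have h1' : (4 * (p : ℝ) ^ 2) * (((γ : SL(2, ℤ)) 1 0 / (4 * p ^ 2 : ℕ) : ℤ) : ℝ) =
      ((γ : SL(2, ℤ)) 1 0 : ℤ) := by
    exact_mod_cast h1
  change levelFricke p • Matrix.SpecialLinearGroup.mapGL ℝ (γ : SL(2, ℤ)) • z =
    Matrix.SpecialLinearGroup.mapGL ℝ (gamma0Flip _ γ : SL(2, ℤ)) • levelFricke p • z
  rw [smul_smul, smul_smul]
  have e00 : (gamma0Flip _ γ : SL(2, ℤ)) 0 0 = (γ : SL(2, ℤ)) 1 1 := rfl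
  have e01 : (gamma0Flip _ γ : SL(2, ℤ)) 0 1 = -((γ : SL(2, ℤ)) 1 0 / (4 * p ^ 2 : ℕ)) := rfl
  have e10 : (gamma0Flip _ γ : SL(2, ℤ)) 1 0 = -((4 * p ^ 2 : ℕ) * (γ : SL(2, ℤ)) 0 1) := rfl
  have e11 : (gamma0Flip _ γ : SL(2, ℤ)) 1 1 = (γ : SL(2, ℤ)) 0 0 := rfl
  congr 1
  generalize (gamma0Flip _ γ : SL(2, ℤ)) = δ at *
  ext i j
  fin_cases i <;> fin_cases j <;>
  simp only [levelFricke, Matrix.GeneralLinearGroup.mkOfDetNeZero, Units.val_mul, Matrix.mul_apply,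
    Fin.sum_univ_two, Matrix.SpecialLinearGroup.mapGL_coe_matrix] <;>
  simp [e00, e01, e10, e11]
  · push_cast at h1'
    linear_combination -h1'
  · ring

lemma IsWeight.levelFricke {Ψ : ℍ → ℝ} (hΨ : IsWeight (CongruenceSubgroup.Gamma0 (4 * p ^ 2)) Ψ) :
    IsWeight (CongruenceSubgroup.Gamma0 (4 * p ^ 2)) fun z => Ψ (levelFricke p • z) := by
  have hN : 4 * p ^ 2 ≠ 0 := by have := (Fact.out : p.Prime).pos; positivity
  refine ⟨hΨ.measurable.comp (measurable_const_smul _), fun z => hΨ.nonneg _, fun z => ?_⟩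
  refine (hasSum_congr_terms fun γ => ?_).mp
    ((gamma0Flip_involutive hN).toPerm.hasSum_iff.mpr (hΨ.hasSum (HalfIntegral.levelFricke p • z)))
  rw [Function.comp_apply, Function.Involutive.coe_toPerm, levelFricke_smul_smul]

/-- For w = -1/(4p²z), p²w is the Fricke image of z and w is that of p²z, so f(p²w) and g(w) become
f(z) and g(p²z). The signs cancel because both forms lie in the same eigenspace, and the automorphy
factors are absorbed by the power of Im w. -/
lemma heckePet_levelFricke (hε : ε ^ 2 = 1) (hf : f ∈ frickeSpace k ε) (hg : g ∈ frickeSpace k ε)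
    (z : ℍ) : heckePet k p f g (levelFricke p • z) = conj (heckePet k p g f z) := by
  have hp := prime_pos (p := p)
  have hp0 := prime_natCast_ne_zero (p := p)
  have hz := z.ne_zero
  have hzn : 0 < ‖(z : ℂ)‖ := norm_pos_iff.mpr hz
  have hεε : ε * conj ε = 1 := by
    rcases eq_or_eq_neg_of_sq_eq_sq ε 1 (hε.trans (one_pow 2).symm) with rfl | rfl <;> simp
  have hcoe := coe_levelFricke_smul (p := p) z
  have hzp : 0 < ((p : ℂ) ^ 2 * z).im := by
    rw [← Complex.ofReal_natCast, ← Complex.ofReal_pow, Complex.im_ofReal_mul]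
    exact mul_pos (by positivity) z.im_pos
  set U := (-2 * Complex.I * (z : ℂ)) ^ ((k : ℂ) + 1 / 2) with hU
  have h1 : lift f ((p : ℂ) ^ 2 * (levelFricke p • z : ℍ)) = ε * U * f z := by
    rw [hcoe]
    have : (p : ℂ) ^ 2 * (-1 / (4 * (p ^ 2 * z))) = -1 / (4 * (z : ℂ)) := by field_simp
    rw [this, lift_neg_inv hf z.im_pos, lift_coe]
  have h2 : g (levelFricke p • z) = ε * ((p : ℂ) ^ (2 * k + 1) * U) * lift g (p ^ 2 * z) := by
    rw [← lift_coe g, hcoe, lift_neg_inv hg hzp, hU, ← Complex.ofReal_natCast,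
      ← sq_mul_cpow hp k (neg_two_I_mul_ne_zero z)]
    ring_nf
  have h3 : (levelFricke p • z : ℍ).im = z.im / (4 * p ^ 2 * ‖(z : ℂ)‖ ^ 2) := by
    rw [← coe_im, hcoe]
    have e : -1 / (4 * ((p : ℂ) ^ 2 * z)) = ((-1 / (4 * p ^ 2) : ℝ) : ℂ) * (z : ℂ)⁻¹ := by
      push_cast
      field_simp
    rw [e, Complex.im_ofReal_mul, Complex.inv_im, Complex.normSq_eq_norm_sq, coe_im]
    field_simp
  have hUn : ‖U‖ = (2 * ‖(z : ℂ)‖) ^ ((k : ℝ) + 1 / 2) := by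
    have : ((k : ℂ) + 1 / 2) = (((k : ℝ) + 1 / 2 : ℝ) : ℂ) := by push_cast; ring
    rw [hU, this, Complex.norm_cpow_real]
    simp
  have h4 : ‖U‖ ^ 2 * (p : ℝ) ^ (2 * k + 1) * (levelFricke p • z : ℍ).im ^ ((k : ℝ) + 1 / 2) =
      z.im ^ ((k : ℝ) + 1 / 2) := by
    have e1 : ‖U‖ ^ 2 * (p : ℝ) ^ (2 * k + 1) =
        (4 * p ^ 2 * ‖(z : ℂ)‖ ^ 2) ^ ((k : ℝ) + 1 / 2) := by
      have e2 : (4 * p ^ 2 * ‖(z : ℂ)‖ ^ 2) = (2 * ‖(z : ℂ)‖ * p) ^ (2 : ℝ) := by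
        rw [Real.rpow_two]; ring
      rw [e2, ← Real.rpow_mul (by positivity), Real.mul_rpow (by positivity) hp.le, hUn,
        ← Real.rpow_natCast, ← Real.rpow_mul (by positivity), ← Real.rpow_intCast]
      push_cast
      ring_nf
    rw [e1, h3, Real.div_rpow z.im_pos.le (by positivity)]
    exact mul_div_cancel₀ _ (Real.rpow_pos_of_pos (by positivity) _).ne'
  have h5 : ((‖U‖ ^ 2 : ℝ) : ℂ) = U * conj U := by
    rw [Complex.mul_conj, Complex.normSq_eq_norm_sq]
  rw [heckePet, heckePet, pet, pet, heckeTerm_inr_zero, heckeTerm_inr_zero, h1, h2, ← h4,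
    Complex.ofReal_mul, Complex.ofReal_mul, h5]
  simp only [map_mul, Complex.conj_conj, map_zpow₀, Complex.conj_natCast, Complex.conj_ofReal,
    Complex.ofReal_zpow, Complex.ofReal_natCast]
  linear_combination ((p : ℂ) ^ (2 * k - 1) * U * conj U * f z * p ^ (2 * k + 1) *
    conj (lift g (p ^ 2 * z)) *
    (((levelFricke p • z : ℍ).im ^ ((k : ℝ) + 1 / 2) : ℝ) : ℂ)) * hεε

lemma integral_heckePet (hp : p ≠ 2) (hε : ε ^ 2 = 1) (hf : f ∈ frickeSpace k ε)
    (hg : g ∈ frickeSpace k ε) {Ψ : ℍ → ℝ}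
    (hΨ : IsWeight (CongruenceSubgroup.Gamma0 (4 * p ^ 2)) Ψ) (hi : Integrable Ψ volume) :
    ∫ z, (Ψ z : ℂ) * heckePet k p f g z = conj (∫ z, (Ψ z : ℂ) * heckePet k p g f z) := by
  have hmp : MeasurePreserving (levelFricke p • · : ℍ → ℍ) volume volume :=
    measurePreserving_smul _ _
  rw [← hΨ.levelFricke.integral_eq hΨ
    (fun γ z => heckePet_smul_of_mem hp hε hg hf.1 γ.2 z) (integrable_weight_mul_heckePet hi hg.1 hf.1),
    ← integral_conj, ← hmp.integral_comp (measurableEmbedding_const_smul _)]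
  congr 1
  funext z
  rw [heckePet_levelFricke hε hf hg, map_mul, Complex.conj_ofReal]

lemma conj_pet (z : ℍ) : conj (pet k f g z) = pet k g f z := by
  rw [pet, pet, map_mul, map_mul, Complex.conj_conj, Complex.conj_ofReal, mul_comm (conj _)]

/-- The Hecke operators are symmetric for the Petersson product. -/
theorem integral_pet_heckeSum_left (hp : p ≠ 2) (hε : ε ^ 2 = 1) (hf : f ∈ frickeSpace k ε)
    (hg : g ∈ frickeSpace k ε) {ψ : ℍ → ℝ} (hψ : IsWeight (CongruenceSubgroup.Gamma0 4) ψ) :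
    ∫ z, (ψ z : ℂ) * pet k (heckeSum k p f) g z = ∫ z, (ψ z : ℂ) * pet k f (heckeSum k p g) z := by
  have : NeZero (4 * p ^ 2) := ⟨by have := (Fact.out : p.Prime).pos; positivity⟩
  obtain ⟨Ψ, hΨ, hi⟩ := exists_weight (CongruenceSubgroup.Gamma0 (4 * p ^ 2))
  rw [integral_pet_heckeSum hp hε hf hg.1 hψ hΨ hi, integral_heckePet hp hε hf hg hΨ hi,
    ← integral_pet_heckeSum hp hε hg hf.1 hψ hΨ hi, ← integral_conj]
  congr 1
  funext z
  rw [map_mul, Complex.conj_ofReal, conj_pet]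

/-- The Petersson product is definite. -/
theorem eq_zero_of_integral_pet (hf : f ∈ cuspForms k) {ψ : ℍ → ℝ}
    (hψ : IsWeight (CongruenceSubgroup.Gamma0 4) ψ) (hi : Integrable ψ volume)
    (h : ∫ z, (ψ z : ℂ) * pet k f f z = 0) : f = 0 := by
  have hc := continuous_of_mem hf
  have hb := hasCuspBound_of_mem hf
  have e (z : ℍ) : pet k f f z = ((‖f z‖ ^ 2 * z.im ^ ((k : ℝ) + 1 / 2) : ℝ) : ℂ) := by
    rw [pet, Complex.mul_conj, Complex.normSq_eq_norm_sq, Complex.ofReal_mul]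
  have hy (z : ℍ) : 0 < z.im ^ ((k : ℝ) + 1 / 2) := Real.rpow_pos_of_pos z.im_pos _
  have hint := integrable_weight_mul_pet hi hc hb hc hb
  simp only [e, ← Complex.ofReal_mul] at h hint
  have hre : Integrable (fun z => ψ z * (‖f z‖ ^ 2 * z.im ^ ((k : ℝ) + 1 / 2))) volume := hint.re
  rw [integral_complex_ofReal, Complex.ofReal_eq_zero, integral_eq_zero_iff_of_nonneg
    (fun z => mul_nonneg (hψ.nonneg z) (mul_nonneg (sq_nonneg _) (hy z).le)) hre] at h
  have hae : ∀ᵐ z ∂(volume : Measure ℍ), ψ z = 0 ∨ f z = 0 := by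
    filter_upwards [h] with z hz
    have hz' : ψ z * (‖f z‖ ^ 2 * z.im ^ ((k : ℝ) + 1 / 2)) = 0 := hz
    rcases mul_eq_zero.mp hz' with h0 | h0
    · exact Or.inl h0
    · exact Or.inr (by simpa using (mul_eq_zero.mp h0).resolve_right (hy z).ne')
  -- ψ may vanish on large sets, but its translates sum to 1. Almost every z thus has a γ with ψ(γz)
  -- ≠ 0, so f(γz) = 0 and hence f(z) = 0.
  have hae2 : ∀ᵐ z ∂(volume : Measure ℍ), ∀ γ : CongruenceSubgroup.Gamma0 4,
      ψ (γ • z) = 0 ∨ f (γ • z) = 0 := by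
    rw [ae_all_iff]
    exact fun γ => (measurePreserving_smul γ volume).quasiMeasurePreserving.ae hae
  have hae3 : f =ᵐ[volume] 0 := by
    filter_upwards [hae2] with z hz
    by_contra hne
    have : ∀ γ : CongruenceSubgroup.Gamma0 4, ψ (γ • z) = 0 := fun γ => by
      refine (hz γ).resolve_right fun h0 => hne ?_
      have h1 := hf.transform γ γ.2 z
      change f (γ • z) = _ at h1
      rw [h0, zero_eq_mul] at h1
      refine h1.resolve_left (zpow_ne_zero _ ?_)
      exact div_ne_zero (theta_ne_zero _) (theta_ne_zero _)
    have h1 := hψ.hasSum z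
    simp only [this] at h1
    exact zero_ne_one (hasSum_zero.unique h1)
  exact hc.ae_eq_iff_eq volume continuous_zero |>.mp hae3

end Symmetric

/-! ### The completed `L`-function -/

section LFunction

open Asymptotics MeasureTheory

variable {k : ℤ} {ε : ℂ} {f g : ℍ → ℂ}

/-- The restriction of `f` to the imaginary axis, `t ↦ f(it/2)`. -/
def axisFun (f : ℍ → ℂ) (t : ℝ) : ℂ := lift f (Complex.I * t / 2)

lemma axisPoint_im (t : ℝ) : (Complex.I * t / 2).im = t / 2 := by
  rw [Complex.div_ofNat_im, Complex.I_mul_im, Complex.ofReal_re]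

lemma axisFun_of_pos (f : ℍ → ℂ) {t : ℝ} (ht : 0 < t) :
    axisFun f t = f ⟨Complex.I * t / 2, by rw [axisPoint_im]; positivity⟩ :=
  lift_of_im_pos f (by rw [axisPoint_im]; positivity)

lemma hasSum_axisFun (hf : f ∈ cuspForms k) {t : ℝ} (ht : 0 < t) :
    HasSum (fun n : ℕ => fourierCoeff f n * (Real.exp (-Real.pi * n * t) : ℂ)) (axisFun f t) := by
  rw [axisFun_of_pos f ht]
  refine (hasSum_congr_terms fun n => ?_).mp (hasSum_fourierCoeff hf _)
  rw [qExp, Complex.ofReal_exp]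
  congr 2
  push_cast
  linear_combination ((Real.pi : ℂ) * n * t) * Complex.I_sq

/-- The scaling it/2 places the fixed point of the Fricke involution at t = 1, and there -2iz = t is
positive, so the power is a real one. -/
lemma axisFun_one_div (hf : f ∈ frickeSpace k ε) {t : ℝ} (ht : 0 < t) :
    axisFun f (1 / t) = (ε * (t ^ ((k : ℝ) + 1 / 2) : ℝ)) • axisFun f t := by
  have h0 : (t : ℂ) ≠ 0 := Complex.ofReal_ne_zero.mpr ht.ne'
  have hI := Complex.I_ne_zero
  have him : 0 < (Complex.I * t / 2).im := by rw [axisPoint_im]; positivity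
  have e : Complex.I * ((1 / t : ℝ) : ℂ) / 2 = -1 / (4 * (Complex.I * t / 2)) := by
    push_cast
    field_simp
    rw [Complex.I_sq]
    norm_num
  have e2 : -2 * Complex.I * (Complex.I * t / 2) = t := by
    linear_combination (-(t : ℂ)) * Complex.I_sq
  rw [axisFun, axisFun, e, lift_neg_inv hf him, e2, smul_eq_mul, Complex.ofReal_cpow ht.le]
  push_cast
  rfl

lemma continuousOn_axisFun (hf : f ∈ cuspForms k) : ContinuousOn (axisFun f) (Set.Ioi 0) := by
  have h := (UpperHalfPlane.mdifferentiable_iff.mp hf.holo).continuousOn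
  refine h.comp (by fun_prop : ContinuousOn (fun t : ℝ => Complex.I * (t : ℂ) / 2) (Set.Ioi 0)) ?_
  intro t ht
  change 0 < (Complex.I * t / 2).im
  rw [axisPoint_im]
  exact half_pos ht

lemma axisFun_isBigO (hf : f ∈ cuspForms k) (r : ℝ) : axisFun f =O[atTop] fun t : ℝ => t ^ r := by
  have h := (isZeroAtImInfty_of_mem hf).exp_decay_atImInfty one_pos
    (periodic_of_vadd (vadd_one_of_mem hf)) hf.holo (isZeroAtImInfty_of_mem hf).isBoundedAtImInfty
  obtain ⟨C, hC⟩ := h.bound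
  obtain ⟨A, hA⟩ := (atImInfty_mem _).mp hC
  have h1 : axisFun f =O[atTop] fun t : ℝ => Real.exp (-Real.pi * t) := by
    refine IsBigO.of_bound C ?_
    filter_upwards [eventually_gt_atTop 0, eventually_ge_atTop (2 * A)] with t ht htA
    have him : 0 < (Complex.I * t / 2).im := by rw [axisPoint_im]; positivity
    have h2 := hA ⟨Complex.I * t / 2, him⟩ (by
      change A ≤ (Complex.I * t / 2).im
      rw [axisPoint_im]; linarith)
    rw [axisFun_of_pos f ht]
    refine h2.trans (le_of_eq ?_)
    congr 3
    change -2 * Real.pi * (Complex.I * t / 2).im / 1 = _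
    rw [axisPoint_im]
    ring
  exact h1.trans (isLittleO_exp_neg_mul_rpow_atTop Real.pi_pos r).isBigO

/-- The functional equation data of `f`. -/
def axisPair (hk : 0 ≤ k) (hε : ε ≠ 0) (hf : f ∈ frickeSpace k ε) : WeakFEPair ℂ where
  f := axisFun f
  g := axisFun f
  k := (k : ℝ) + 1 / 2
  ε := ε
  f₀ := 0
  g₀ := 0
  hf_int := (continuousOn_axisFun hf.1).locallyIntegrableOn measurableSet_Ioi
  hg_int := (continuousOn_axisFun hf.1).locallyIntegrableOn measurableSet_Ioi
  hk := by positivity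
  hε := hε
  h_feq := fun _ hx => axisFun_one_div hf hx
  hf_top := fun r => by simpa using! axisFun_isBigO hf.1 r
  hg_top := fun r => by simpa using! axisFun_isBigO hf.1 r

lemma hasMellin_axisFun (hk : 0 ≤ k) (hε : ε ≠ 0) (hf : f ∈ frickeSpace k ε) (s : ℂ) :
    MellinConvergent (axisFun f) s :=
  (IsStrongFEPair.hasMellin (P := axisPair hk hε hf) ⟨rfl, rfl⟩ s).1

lemma differentiable_mellin_axisFun (hk : 0 ≤ k) (hε : ε ≠ 0) (hf : f ∈ frickeSpace k ε) :
    Differentiable ℂ (mellin (axisFun f)) := by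
  have hP : IsStrongFEPair (axisPair hk hε hf) := ⟨rfl, rfl⟩
  exact hP.Λ_eq ▸ hP.differentiable_Λ

lemma mellin_axisFun_sub (hk : 0 ≤ k) (hε : ε ≠ 0) (hf : f ∈ frickeSpace k ε) (s : ℂ) :
    mellin (axisFun f) (((k : ℝ) + 1 / 2 : ℝ) - s) = ε * mellin (axisFun f) s := by
  have hP : IsStrongFEPair (axisPair hk hε hf) := ⟨rfl, rfl⟩
  have h := (axisPair hk hε hf).functional_equation s
  rw [hP.Λ_eq, hP.symm_Λ_eq] at h
  exact h

/-- Hecke's estimate: the coefficient integral is taken at height 1/n, where the exponential factor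
is bounded. -/
lemma norm_fourierCoeff_le (hf : f ∈ cuspForms k) :
    ∃ C : ℝ, ∀ n : ℕ, n ≠ 0 → ‖fourierCoeff f n‖ ≤ C * (n : ℝ) ^ (((k : ℝ) + 1 / 2) / 2) := by
  obtain ⟨C, hC⟩ := hasCuspBound_of_mem hf
  refine ⟨Real.exp (2 * Real.pi) * C, fun n hn => ?_⟩
  have hn0 : (0 : ℝ) < n := by positivity
  have ht : (0 : ℝ) < 1 / n := by positivity
  rw [fourierCoeff, qExpansion_coeff_eq_intervalIntegral one_pos
    (periodic_of_vadd (vadd_one_of_mem hf)) hf.holo (isZeroAtImInfty_of_mem hf).isBoundedAtImInfty n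
    ht, Complex.ofReal_one, div_one, one_mul]
  refine (intervalIntegral.norm_integral_le_of_norm_le_const fun u _ => ?_).trans_eq
    (by rw [sub_zero, abs_one, mul_one])
  have him : ((u : ℂ) + ((1 / n : ℝ) : ℂ) * (UpperHalfPlane.I : ℂ)).im = 1 / n := by simp
  rw [norm_mul, norm_div, norm_one, norm_pow, Function.Periodic.norm_qParam, ← Real.exp_nat_mul,
    him, one_div (Real.exp _), ← Real.exp_neg, mul_assoc (Real.exp _)]
  have e1 : -((n : ℝ) * (-2 * Real.pi * (1 / n) / 1)) = 2 * Real.pi := by field_simp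
  rw [e1]
  refine mul_le_mul_of_nonneg_left ((hC _).trans_eq ?_) (Real.exp_pos _).le
  congr 1
  change ((u : ℂ) + ((1 / n : ℝ) : ℂ) * (UpperHalfPlane.I : ℂ)).im ^ _ = _
  rw [him, one_div, Real.inv_rpow hn0.le, ← Real.rpow_neg hn0.le]
  congr 1
  ring

/-- The Mellin transform along the imaginary axis is the completed `L`-function. -/
theorem isCompletedL_mellin (hk : 0 ≤ k) (hε : ε ≠ 0) (hf : f ∈ frickeSpace k ε) :
    IsCompletedL f (mellin (axisFun f)) := by
  refine ⟨differentiable_mellin_axisFun hk hε hf, ((k : ℝ) + 1 / 2) / 2 + 1, fun s hs => ?_⟩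
  have hs0 : 0 < s.re := by
    have : (0 : ℝ) ≤ k := by exact_mod_cast hk
    linarith
  have hs1 : s ≠ 0 := fun h => by rw [h, Complex.zero_re] at hs0; exact hs0.false
  have hsum : LSeriesSummable (fourierCoeff f) s := by
    refine LSeriesSummable_of_le_const_mul_rpow hs ?_
    simpa using norm_fourierCoeff_le hf.1
  refine ⟨hsum, ?_⟩
  have h := hasSum_mellin_pi_mul₀ (a := fourierCoeff f) (p := fun n : ℕ => (n : ℝ))
    (F := axisFun f) (s := s) (fun n => Nat.cast_nonneg n) hs0 (fun t ht => ?_) ?_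
  · rw [← h.tsum_eq, LSeries, ← tsum_mul_left]
    refine tsum_congr fun n => ?_
    -- The factor 2^s reflects the scaling t/2, which gives exponentials e^{-πnt}.
    have e : (2 * Real.pi : ℂ) ^ (-s) * 2 ^ s = (Real.pi : ℂ) ^ (-s) := by
      have h2 : (2 * Real.pi : ℂ) = ((2 : ℝ) : ℂ) * (Real.pi : ℂ) := by push_cast; rfl
      rw [h2, Complex.mul_cpow_ofReal_nonneg two_pos.le Real.pi_pos.le, mul_right_comm]
      push_cast
      rw [← Complex.cpow_add _ _ two_ne_zero, neg_add_cancel, Complex.cpow_zero, one_mul]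
    rw [e, LSeries.term_def₀ (fourierCoeff_zero hf.1), Complex.cpow_neg (n : ℂ), Complex.ofReal_natCast]
    ring
  · refine (hasSum_congr_terms fun n => ?_).mp (hasSum_axisFun hf.1 ht)
    split_ifs with hn
    · have : n = 0 := by exact_mod_cast hn
      rw [this, fourierCoeff_zero hf.1, zero_mul]
    · rfl
  · refine (summable_congr fun n => ?_).mp hsum.norm
    rw [LSeries.term_def₀ (fourierCoeff_zero hf.1), norm_mul, Complex.cpow_neg, norm_inv]
    rcases Nat.eq_zero_or_pos n with rfl | hn
    · simp [fourierCoeff_zero hf.1]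
    · rw [Complex.norm_natCast_cpow_of_pos hn, div_eq_mul_inv]

/-- The value of the completed `L`-function at `s` as a linear functional. -/
def valueL (hk : 0 ≤ k) (hε : ε ≠ 0) (s : ℂ) : frickeSpace k ε →ₗ[ℂ] ℂ where
  toFun f := mellin (axisFun (f : ℍ → ℂ)) s
  map_add' f g := (hasMellin_add (hasMellin_axisFun hk hε f.2 s) (hasMellin_axisFun hk hε g.2 s)).2
  map_smul' c f := mellin_const_smul (axisFun (f : ℍ → ℂ)) s c

end LFunction

/-! ### Explicit cusp forms built from theta constants -/

section ThetaForms

/-- A modular invariant majorant for monomials in theta constants. -/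
def thetaMajorant (N : ℕ) (τ : ℍ) : ℝ :=
  ‖theta2 τ‖ * ‖jacobiTheta τ‖ * ‖theta4 τ‖ *
    max ‖theta2 τ‖ (max ‖jacobiTheta τ‖ ‖theta4 τ‖) ^ N * τ.im ^ (((N : ℝ) + 3) / 4)

lemma thetaMajorant_nonneg (N : ℕ) (τ : ℍ) : 0 ≤ thetaMajorant N τ := by
  have := τ.im_pos
  rw [thetaMajorant]
  positivity

/-- T and S permute the absolute values of the three theta constants, up to a common factor for S.
The product and the maximum are symmetric, and the power of the imaginary part compensates that
factor in total degree N + 3. -/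
lemma thetaMajorant_T (N : ℕ) (τ : ℍ) :
    thetaMajorant N (ModularGroup.T • τ) = thetaMajorant N τ := by
  have e : ((ModularGroup.T • τ : ℍ) : ℂ) = (τ : ℂ) + 1 := by
    rw [modular_T_smul, coe_vadd, Complex.ofReal_one, add_comm]
  have e2 : (ModularGroup.T • τ).im = τ.im := by
    rw [modular_T_smul, vadd_im]
  have e3 : ‖theta2 ((τ : ℂ) + 1)‖ = ‖theta2 τ‖ := by
    have : (Real.pi * Complex.I / 4 : ℂ) = ((Real.pi / 4 : ℝ) : ℂ) * Complex.I := by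
      push_cast; ring
    rw [theta2_add_one, norm_mul, this, Complex.norm_exp_ofReal_mul_I, one_mul]
  rw [thetaMajorant, thetaMajorant, e, e2, e3, jacobiTheta_add_one, theta4_add_one,
    max_comm ‖theta4 τ‖]
  ring

lemma thetaMajorant_S (N : ℕ) (τ : ℍ) :
    thetaMajorant N (ModularGroup.S • τ) = thetaMajorant N τ := by
  have h0 := τ.ne_zero
  have e : ((ModularGroup.S • τ : ℍ) : ℂ) = -1 / τ := by
    rw [modular_S_smul]
    change (-(τ : ℂ))⁻¹ = _
    field_simp
  have hr := norm_pos_iff.mpr (neg_I_mul_cpow_half_ne_zero h0)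
  have hr4 : ‖(-Complex.I * τ) ^ (1 / 2 : ℂ)‖ ^ 4 = Complex.normSq τ := by
    rw [← norm_pow, cpow_half_pow_four, norm_pow, norm_mul, norm_neg, Complex.norm_I, one_mul,
      Complex.normSq_eq_norm_sq]
  set r := ‖(-Complex.I * τ) ^ (1 / 2 : ℂ)‖ with hrdef
  have e2 : (ModularGroup.S • τ).im = τ.im / r ^ 4 := by
    rw [hr4, modular_S_smul]
    change (-(τ : ℂ))⁻¹.im = _
    rw [Complex.inv_im, Complex.neg_im, neg_neg, Complex.normSq_neg, coe_im]
  have e3 : (r ^ 4) ^ (((N : ℝ) + 3) / 4) = r ^ (N + 3) := by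
    rw [← Real.rpow_natCast, ← Real.rpow_mul hr.le, ← Real.rpow_natCast]
    congr 1
    push_cast
    ring
  rw [thetaMajorant, thetaMajorant, e, e2, theta2_neg_inv h0, jacobiTheta_neg_inv h0,
    theta4_neg_inv h0, norm_mul, norm_mul, norm_mul, ← hrdef, ← mul_max_of_nonneg _ _ hr.le,
    ← mul_max_of_nonneg _ _ hr.le, Real.div_rpow τ.im_pos.le (by positivity), e3,
    max_comm ‖theta4 τ‖, max_comm ‖jacobiTheta τ‖ ‖theta2 τ‖, max_assoc, mul_pow]
  field_simp
  ring

lemma thetaMajorant_smul (N : ℕ) (γ : SL(2, ℤ)) (τ : ℍ) :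
    thetaMajorant N (γ • τ) = thetaMajorant N τ := by
  have h := slash_action_generators_SL2Z (f := fun τ => (thetaMajorant N τ : ℂ)) (k := 0)
    (by ext τ; rw [ModularForm.SL_slash_apply, neg_zero, zpow_zero, mul_one, thetaMajorant_S])
    (by ext τ; rw [ModularForm.SL_slash_apply, neg_zero, zpow_zero, mul_one, thetaMajorant_T]) γ
  have h2 := congrFun h τ
  rw [ModularForm.SL_slash_apply, neg_zero, zpow_zero, mul_one] at h2
  exact_mod_cast h2

lemma continuous_theta_constants : Continuous (fun τ : ℍ => theta2 τ) ∧
    Continuous (fun τ : ℍ => jacobiTheta τ) ∧ Continuous (fun τ : ℍ => theta4 τ) :=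
  ⟨(mdifferentiable_of_differentiableAt fun _ h => differentiableAt_theta2 h).continuous,
    (mdifferentiable_of_differentiableAt fun _ h => differentiableAt_jacobiTheta h).continuous,
    (mdifferentiable_of_differentiableAt fun _ h => differentiableAt_theta4 h).continuous⟩

/-- The guaranteed factor θ₂ decays like e^{-πy/4}, which beats the power of y. -/
lemma isBoundedAtImInfty_thetaMajorant (N : ℕ) :
    ∃ M A : ℝ, ∀ τ : ℍ, A ≤ τ.im → thetaMajorant N τ ≤ M := by
  obtain ⟨C2, hC2, h2⟩ := exists_norm_theta2_le
  obtain ⟨C3, h3⟩ := exists_norm_jacobiTheta_le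
  obtain ⟨C4, h4⟩ := exists_norm_theta4_le
  have ht := tendsto_rpow_mul_exp_neg_mul_atTop_nhds_zero (((N : ℝ) + 3) / 4) (Real.pi / 4)
    (by have := Real.pi_pos; positivity)
  obtain ⟨A, hA⟩ := eventually_atTop.mp (ht.eventually_le_const zero_lt_one)
  refine ⟨C2 * C3 * C4 * max C2 (max C3 C4) ^ N, max A 1, fun τ hτ => ?_⟩
  have h1 : 1 ≤ τ.im := (le_max_right _ _).trans hτ
  have hy := τ.im_pos
  have hA' := hA τ.im ((le_max_left _ _).trans hτ)
  have h3' := h3 τ h1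
  have h4' := h4 τ h1
  have h2' := h2 τ h1
  have p3 : 0 ≤ C3 := (norm_nonneg _).trans h3'
  have p4 : 0 ≤ C4 := (norm_nonneg _).trans h4'
  have h2'' : ‖theta2 τ‖ ≤ C2 := h2'.trans (mul_le_of_le_one_right hC2.le
    (Real.exp_le_one_iff.mpr (by
      have := Real.pi_pos
      have : 0 ≤ Real.pi / 4 * τ.im := by positivity
      change -Real.pi / 4 * τ.im ≤ 0
      linarith)))
  have hmax : max ‖theta2 τ‖ (max ‖jacobiTheta τ‖ ‖theta4 τ‖) ≤ max C2 (max C3 C4) :=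
    max_le_max h2'' (max_le_max h3' h4')
  have e : -Real.pi / 4 * (τ : ℂ).im = -(Real.pi / 4) * τ.im := by rw [coe_im]; ring
  calc thetaMajorant N τ ≤ (C2 * Real.exp (-Real.pi / 4 * (τ : ℂ).im)) * C3 * C4 *
        max C2 (max C3 C4) ^ N * τ.im ^ (((N : ℝ) + 3) / 4) := by
        rw [thetaMajorant]
        gcongr
    _ = C2 * C3 * C4 * max C2 (max C3 C4) ^ N *
        (τ.im ^ (((N : ℝ) + 3) / 4) * Real.exp (-(Real.pi / 4) * τ.im)) := by rw [e]; ring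
    _ ≤ _ := mul_le_of_le_one_right (by positivity) hA'

lemma exists_thetaMajorant_le (N : ℕ) : ∃ C : ℝ, ∀ τ, thetaMajorant N τ ≤ C := by
  obtain ⟨h2, h3, h4⟩ := continuous_theta_constants
  have hc : Continuous (thetaMajorant N) := by
    refine Continuous.mul ?_ (continuous_im.rpow_const fun z => Or.inl z.im_ne_zero)
    exact ((h2.norm.mul h3.norm).mul h4.norm).mul ((h2.norm.max (h3.norm.max h4.norm)).pow N)
  obtain ⟨C, hC⟩ := ModularGroup.exists_bound_of_invariant hc
    (by
      rw [isBoundedAtImInfty_iff]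
      obtain ⟨M, A, h⟩ := isBoundedAtImInfty_thetaMajorant N
      exact ⟨M, A, fun z hz => by
        rw [Real.norm_of_nonneg (thetaMajorant_nonneg N z)]; exact h z hz⟩)
    (thetaMajorant_smul N)
  exact ⟨C, fun τ => (le_abs_self _).trans (hC τ)⟩

/-- The form `θ₂⁴ θ₄⁴ (θ₄⁴ - θ₂⁴)ʲ θ₃ᵐ` evaluated at `2z`. -/
def thetaForm (j m : ℕ) (z : ℍ) : ℂ :=
  theta2 (2 * z) ^ 4 * theta4 (2 * z) ^ 4 * (theta4 (2 * z) ^ 4 - theta2 (2 * z) ^ 4) ^ j *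
    jacobiTheta (2 * z) ^ m

lemma mdifferentiable_thetaForm (j m : ℕ) : MDiff (thetaForm j m) := by
  refine mdifferentiable_of_differentiableAt (F := fun z => theta2 (2 * z) ^ 4 *
    theta4 (2 * z) ^ 4 * (theta4 (2 * z) ^ 4 - theta2 (2 * z) ^ 4) ^ j *
    jacobiTheta (2 * z) ^ m) fun z hz => ?_
  have hz2 : 0 < (2 * z).im := by simpa using hz
  have hd : DifferentiableAt ℂ (fun z : ℂ => 2 * z) z := by fun_prop
  have h2 : DifferentiableAt ℂ (fun z => theta2 (2 * z)) z :=
    (differentiableAt_theta2 hz2).comp z hd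
  have h3 : DifferentiableAt ℂ (fun z => jacobiTheta (2 * z)) z :=
    (differentiableAt_jacobiTheta hz2).comp z hd
  have h4 : DifferentiableAt ℂ (fun z => theta4 (2 * z)) z :=
    (differentiableAt_theta4 hz2).comp z hd
  exact (((h2.pow 4).mul (h4.pow 4)).mul (((h4.pow 4).sub (h2.pow 4)).pow j)).mul (h3.pow m)

/-- In τ = 2z this is τ ↦ τ + 2, which fixes θ₃ and θ₄ and multiplies θ₂ by i; only θ₂⁴ occurs. -/
lemma thetaForm_vadd_one (j m : ℕ) (z : ℍ) :
    thetaForm j m ((1 : ℝ) +ᵥ z) = thetaForm j m z := by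
  have e : 2 * (((1 : ℝ) +ᵥ z : ℍ) : ℂ) = 2 * z + 1 + 1 := by
    rw [coe_vadd]; push_cast; ring
  have e8 : (Complex.exp (Real.pi * Complex.I / 4) * Complex.exp (Real.pi * Complex.I / 4)) ^ 4 =
      1 := by
    rw [← Complex.exp_add, ← Complex.exp_nat_mul, Complex.exp_eq_one_iff]
    exact ⟨1, by push_cast; ring⟩
  have e2 : theta2 (2 * z + 1 + 1) ^ 4 = theta2 (2 * z) ^ 4 := by
    rw [theta2_add_one, theta2_add_one, ← mul_assoc, mul_pow, e8, one_mul]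
  rw [thetaForm, thetaForm, e, e2, theta4_add_one, jacobiTheta_add_one, jacobiTheta_add_one,
    theta4_add_one]

/-- The swap of θ₂ and θ₄ fixes θ₂⁴θ₄⁴ and negates θ₄⁴ - θ₂⁴. The hypothesis counts the theta
factors, each of weight 1/2. -/
lemma thetaForm_frickePoint {k : ℤ} {j m : ℕ} (hm : 8 + 4 * (j : ℤ) + m = 2 * k + 1) (z : ℍ) :
    thetaForm j m (frickePoint z) =
      (-1) ^ j * (-2 * Complex.I * z) ^ ((k : ℂ) + 1 / 2) * thetaForm j m z := by
  have h0 := z.ne_zero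
  have e : 2 * (frickePoint z : ℂ) = -1 / (2 * z) := by rw [coe_frickePoint]; field_simp; ring
  have h2 : (2 * (z : ℂ)) ≠ 0 := mul_ne_zero two_ne_zero h0
  have e1 : -Complex.I * (2 * (z : ℂ)) = -2 * Complex.I * z := by ring
  have e3 : (8 + 4 * (j : ℤ) + m) = ((8 + 4 * j + m : ℕ) : ℤ) := by push_cast; ring
  rw [thetaForm, thetaForm, e, theta2_neg_inv h2, theta4_neg_inv h2, jacobiTheta_neg_inv h2, e1,
    ← cpow_half_zpow, ← hm, e3, zpow_natCast]
  generalize (-2 * Complex.I * (z : ℂ)) ^ (1 / 2 : ℂ) = U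
  generalize theta2 (2 * z) = a
  generalize theta4 (2 * z) = b
  generalize jacobiTheta (2 * z) = c
  have e4 : (U * a) ^ 4 - (U * b) ^ 4 = (-1) * U ^ 4 * (b ^ 4 - a ^ 4) := by ring
  rw [e4, mul_pow, mul_pow, mul_pow, mul_pow, mul_pow]
  ring

/-- The condition m ≥ 1 supplies the factor θ₃, so that one copy of each theta constant can be set
aside and the rest bounded by powers of the maximum. -/
lemma hasCuspBound_thetaForm {k : ℤ} {j m : ℕ} (hm : 8 + 4 * (j : ℤ) + m = 2 * k + 1)
    (hm1 : 1 ≤ m) : HasCuspBound k (thetaForm j m) := by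
  obtain ⟨n, rfl⟩ := Nat.exists_eq_add_of_le' hm1
  -- The total degree 8 + 4j + (n + 1) less the three factors set aside.
  obtain ⟨C, hC⟩ := exists_thetaMajorant_le (6 + 4 * j + n)
  refine ⟨2 ^ j * C * 2 ^ (-((k : ℝ) + 1 / 2) / 2), fun z => ?_⟩
  have hz : 0 < (2 * (z : ℂ)).im := by simpa using z.im_pos
  have him : (⟨2 * (z : ℂ), hz⟩ : ℍ).im = 2 * z.im := by
    change (2 * (z : ℂ)).im = _
    simp
  have h := hC ⟨2 * (z : ℂ), hz⟩
  have e : (((6 + 4 * j + n : ℕ) : ℝ) + 3) / 4 = ((k : ℝ) + 1 / 2) / 2 := by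
    have : (8 + 4 * (j : ℝ) + (n + 1 : ℕ)) = 2 * k + 1 := by exact_mod_cast hm
    push_cast at this ⊢
    linarith
  have hy : 0 < 2 * z.im := mul_pos two_pos z.im_pos
  have hyr := Real.rpow_pos_of_pos hy (((k : ℝ) + 1 / 2) / 2)
  rw [thetaMajorant, e, him] at h
  rw [mul_assoc _ _ (z.im ^ _), ← Real.mul_rpow two_pos.le z.im_pos.le, neg_div,
    Real.rpow_neg hy.le, ← div_eq_mul_inv, le_div_iff₀ hyr]
  refine le_trans ?_ (mul_le_mul_of_nonneg_left h (by positivity))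
  rw [← mul_assoc]
  refine mul_le_mul_of_nonneg_right ?_ hyr.le
  change ‖theta2 (2 * z) ^ 4 * theta4 (2 * z) ^ 4 * (theta4 (2 * z) ^ 4 - theta2 (2 * z) ^ 4) ^ j *
    jacobiTheta (2 * z) ^ (n + 1)‖ ≤ 2 ^ j * (‖theta2 (2 * z)‖ * ‖jacobiTheta (2 * z)‖ *
      ‖theta4 (2 * z)‖ * max ‖theta2 (2 * z)‖ (max ‖jacobiTheta (2 * z)‖ ‖theta4 (2 * z)‖) ^ _)
  have hsub := norm_sub_le (theta4 (2 * z) ^ 4) (theta2 (2 * z) ^ 4)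
  rw [norm_mul, norm_mul, norm_mul, norm_pow, norm_pow, norm_pow, norm_pow]
  rw [norm_pow, norm_pow] at hsub
  have h2 := le_max_left ‖theta2 (2 * z)‖ (max ‖jacobiTheta (2 * z)‖ ‖theta4 (2 * z)‖)
  have h3 := (le_max_left ‖jacobiTheta (2 * z)‖ ‖theta4 (2 * z)‖).trans
    (le_max_right ‖theta2 (2 * z)‖ _)
  have h4 := (le_max_right ‖jacobiTheta (2 * z)‖ ‖theta4 (2 * z)‖).trans
    (le_max_right ‖theta2 (2 * z)‖ _)
  have a0 := norm_nonneg (theta2 (2 * z))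
  have b0 := norm_nonneg (jacobiTheta (2 * z))
  have c0 := norm_nonneg (theta4 (2 * z))
  have d0 := norm_nonneg (theta4 (2 * z) ^ 4 - theta2 (2 * z) ^ 4)
  generalize ‖theta4 (2 * z) ^ 4 - theta2 (2 * z) ^ 4‖ = d at *
  generalize max ‖theta2 (2 * z)‖ (max ‖jacobiTheta (2 * z)‖ ‖theta4 (2 * z)‖) = M at *
  generalize ‖theta2 (2 * z)‖ = a at *
  generalize ‖theta4 (2 * z)‖ = c at *
  generalize ‖jacobiTheta (2 * z)‖ = b at *
  have M0 : 0 ≤ M := a0.trans h2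
  have hd : d ≤ 2 * M ^ 4 := by
    have := pow_le_pow_left₀ a0 h2 4
    have := pow_le_pow_left₀ c0 h4 4
    linarith
  calc a ^ 4 * c ^ 4 * d ^ j * b ^ (n + 1) = a * b * c * (a ^ 3 * c ^ 3 * d ^ j * b ^ n) := by ring
    _ ≤ a * b * c * (M ^ 3 * M ^ 3 * (2 * M ^ 4) ^ j * M ^ n) := by gcongr
    _ = _ := by rw [mul_pow]; ring

lemma thetaForm_mem {k : ℤ} (hk : 0 ≤ k) {j m : ℕ} (hm : 8 + 4 * (j : ℤ) + m = 2 * k + 1)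
    (hm1 : 1 ≤ m) : thetaForm j m ∈ frickeSpace k ((-1) ^ j) :=
  mem_frickeSpace_of hk (mdifferentiable_thetaForm j m) (thetaForm_vadd_one j m)
    (thetaForm_frickePoint hm) (hasCuspBound_thetaForm hm hm1)

/-- The restriction of `thetaForm` to the imaginary axis. -/
def realThetaForm (j m : ℕ) (t : ℝ) : ℝ :=
  realTheta2 t ^ 4 * realTheta4 t ^ 4 * (realTheta4 t ^ 4 - realTheta2 t ^ 4) ^ j *
    realTheta3 t ^ m

lemma axisFun_thetaForm (j m : ℕ) {t : ℝ} (ht : 0 < t) :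
    axisFun (thetaForm j m) t = realThetaForm j m t := by
  rw [axisFun_of_pos _ ht, thetaForm]
  have e : 2 * (Complex.I * t / 2) = t * Complex.I := by ring
  change theta2 (2 * (Complex.I * t / 2)) ^ 4 * theta4 (2 * (Complex.I * t / 2)) ^ 4 *
    (theta4 (2 * (Complex.I * t / 2)) ^ 4 - theta2 (2 * (Complex.I * t / 2)) ^ 4) ^ j *
    jacobiTheta (2 * (Complex.I * t / 2)) ^ m = _
  rw [e, theta2_I ht, theta4_I ht, jacobiTheta_I, realThetaForm, realTheta4]
  push_cast
  rfl

lemma realThetaForm_zero_pos (m : ℕ) {t : ℝ} (ht : 0 < t) : 0 < realThetaForm 0 m t := by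
  have h2 := realTheta2_pos ht
  have h3 := realTheta3_pos ht
  have h4 := realTheta4_pos ht
  rw [realThetaForm, pow_zero]
  positivity

lemma realThetaForm_pos (j m : ℕ) {t : ℝ} (ht : 1 < t) : 0 < realThetaForm j m t := by
  have h0 : 0 < t := one_pos.trans ht
  have h2 := realTheta2_pos h0
  have h3 := realTheta3_pos h0
  have h4 := realTheta4_pos h0
  have h5 : 0 < realTheta4 t ^ 4 - realTheta2 t ^ 4 :=
    sub_pos.mpr (pow_lt_pow_left₀ (realTheta2_lt_realTheta4 ht) h2.le four_ne_zero)
  rw [realThetaForm]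
  positivity

lemma realThetaForm_one_div {k : ℤ} (hk : 0 ≤ k) {j m : ℕ}
    (hm : 8 + 4 * (j : ℤ) + m = 2 * k + 1) (hm1 : 1 ≤ m) {t : ℝ} (ht : 0 < t) :
    realThetaForm j m (1 / t) = (-1) ^ j * t ^ ((k : ℝ) + 1 / 2) * realThetaForm j m t := by
  have h := axisFun_one_div (thetaForm_mem hk hm hm1) ht
  rw [axisFun_thetaForm j m ht, axisFun_thetaForm j m (one_div_pos.mpr ht), smul_eq_mul] at h
  exact_mod_cast h

end ThetaForms

/-! ### Nonvanishing of the Mellin transforms of the theta forms -/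

section Nonvanishing

open MeasureTheory

lemma setIntegral_Ioi_ne_zero {F : ℝ → ℝ} (hF : IntegrableOn F (Set.Ioi 0))
    (h0 : ∀ t, 0 < t → 0 ≤ F t) (h1 : ∀ t, 1 < t → 0 < F t) : ∫ t in Set.Ioi 0, F t ≠ 0 := by
  refine ne_of_gt ((setIntegral_pos_iff_support_of_nonneg_ae ?_ hF).mpr ?_)
  · exact (ae_restrict_iff' measurableSet_Ioi).mpr (Eventually.of_forall h0)
  · refine lt_of_lt_of_le ?_ (measure_mono (show Set.Ioi (1 : ℝ) ⊆ _ from fun t ht =>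
      ⟨(h1 t ht).ne', Set.mem_Ioi.mpr (one_pos.trans ht)⟩))
    rw [Real.volume_Ioi]
    exact ENNReal.zero_lt_top

lemma mellin_ofReal {G : ℝ → ℂ} {g : ℝ → ℝ} (hG : ∀ t, 0 < t → G t = g t) (σ : ℝ) :
    mellin G σ = ((∫ t in Set.Ioi 0, t ^ (σ - 1) * g t : ℝ) : ℂ) := by
  rw [mellin, ← integral_complex_ofReal]
  refine setIntegral_congr_fun measurableSet_Ioi fun t ht => ?_
  rw [smul_eq_mul, hG t ht, Complex.ofReal_mul, Complex.ofReal_cpow (Set.mem_Ioi.mp ht).le]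
  push_cast
  rfl

lemma integrableOn_of_mellinConvergent {G : ℝ → ℂ} {g : ℝ → ℝ} (hG : ∀ t, 0 < t → G t = g t)
    {σ : ℝ} (h : MellinConvergent G σ) : IntegrableOn (fun t => t ^ (σ - 1) * g t) (Set.Ioi 0) := by
  have h1 : IntegrableOn (fun t : ℝ => ((t ^ (σ - 1) * g t : ℝ) : ℂ)) (Set.Ioi 0) := by
    refine (integrableOn_congr_fun (fun t ht => ?_) measurableSet_Ioi).mp h
    rw [smul_eq_mul, hG t ht, Complex.ofReal_mul, Complex.ofReal_cpow (Set.mem_Ioi.mp ht).le]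
    push_cast
    rfl
  exact h1.re

lemma mellin_thetaForm_zero_ne_zero {k : ℤ} (hk : 0 ≤ k) {m : ℕ} (hm : 8 + (m : ℤ) = 2 * k + 1)
    (hm1 : 1 ≤ m) (σ : ℝ) : mellin (axisFun (thetaForm 0 m)) σ ≠ 0 := by
  have hmem := thetaForm_mem (j := 0) hk (by simpa using hm) hm1
  have hG : ∀ t, 0 < t → axisFun (thetaForm 0 m) t = realThetaForm 0 m t :=
    fun t ht => axisFun_thetaForm 0 m ht
  have hpos (t : ℝ) (ht : 0 < t) : 0 < t ^ (σ - 1) * realThetaForm 0 m t :=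
    mul_pos (Real.rpow_pos_of_pos ht _) (realThetaForm_zero_pos m ht)
  rw [mellin_ofReal hG, Complex.ofReal_ne_zero]
  exact setIntegral_Ioi_ne_zero
    (integrableOn_of_mellinConvergent hG (hasMellin_axisFun hk (by simp) hmem σ))
    (fun t ht => (hpos t ht).le) (fun t ht => hpos t (one_pos.trans ht))

/-- The functional equation with sign -1 makes a zero at σ also a zero at κ - σ. These points differ
off the centre, and the transforms at two distinct real points cannot be equal. -/
lemma mellin_thetaForm_one_ne_zero {k : ℤ} (hk : 0 ≤ k) {m : ℕ} (hm : 12 + (m : ℤ) = 2 * k + 1)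
    (hm1 : 1 ≤ m) {σ : ℝ} (hσ : σ ≠ (k : ℝ) / 2 + 1 / 4) :
    mellin (axisFun (thetaForm 1 m)) σ ≠ 0 := by
  have hm' : 8 + 4 * ((1 : ℕ) : ℤ) + m = 2 * k + 1 := by push_cast; linarith
  have hmem := thetaForm_mem (j := 1) hk hm' hm1
  have hG : ∀ t, 0 < t → axisFun (thetaForm 1 m) t = realThetaForm 1 m t :=
    fun t ht => axisFun_thetaForm 1 m ht
  have hint (s : ℝ) : IntegrableOn (fun t => t ^ (s - 1) * realThetaForm 1 m t) (Set.Ioi 0) :=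
    integrableOn_of_mellinConvergent hG (hasMellin_axisFun hk (by simp) hmem s)
  set κ : ℝ := (k : ℝ) + 1 / 2 with hκ
  have hneg (t : ℝ) (h0 : 0 < t) (h1 : t ≤ 1) : realThetaForm 1 m t ≤ 0 := by
    rcases h1.lt_or_eq with h1 | rfl
    · have h := realThetaForm_one_div hk hm' hm1 h0
      have h2 := realThetaForm_pos 1 m (one_lt_one_div h0 h1)
      have h3 := Real.rpow_pos_of_pos h0 ((k : ℝ) + 1 / 2)
      rw [h, pow_one] at h2
      by_contra! h4
      nlinarith [mul_pos h3 h4]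
    · have h := realThetaForm_one_div hk hm' hm1 one_pos
      rw [Real.one_rpow, one_div_one] at h
      linarith
  -- On t > 0 the form and t^{b-1} - t^{a-1} are both nonpositive for t ≤ 1 and both positive for t
  -- > 1, so their product is nonnegative.
  have key (a b : ℝ) (hab : a < b) :
      ∫ t in Set.Ioi 0, (t ^ (b - 1) * realThetaForm 1 m t - t ^ (a - 1) * realThetaForm 1 m t) ≠
        0 := by
    refine setIntegral_Ioi_ne_zero ((hint b).sub (hint a)) (fun t ht => ?_) fun t ht => ?_
    · rw [← sub_mul]
      rcases le_total t 1 with h1 | h1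
      · exact mul_nonneg_of_nonpos_of_nonpos (sub_nonpos.mpr
          (Real.rpow_le_rpow_of_exponent_ge ht h1 (by linarith))) (hneg t ht h1)
      · rcases h1.lt_or_eq with h1 | rfl
        · exact mul_nonneg (sub_nonneg.mpr
            (Real.rpow_le_rpow_of_exponent_le h1.le (by linarith))) (realThetaForm_pos 1 m h1).le
        · simp
    · rw [← sub_mul]
      exact mul_pos (sub_pos.mpr (Real.rpow_lt_rpow_of_exponent_lt ht (by linarith)))
        (realThetaForm_pos 1 m ht)
  intro h
  have h' := mellin_axisFun_sub hk (by simp) hmem (σ : ℂ)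
  rw [h, mul_zero, ← Complex.ofReal_sub, mellin_ofReal hG, Complex.ofReal_eq_zero] at h'
  rw [mellin_ofReal hG, Complex.ofReal_eq_zero] at h
  rcases lt_or_gt_of_ne (show σ ≠ κ - σ by intro e; apply hσ; rw [hκ] at e; linarith) with hlt | hlt
  · have := key _ _ hlt
    rw [integral_sub (hint _) (hint _), h, h', sub_zero] at this
    exact this rfl
  · have := key _ _ hlt
    rw [integral_sub (hint _) (hint _), h, h', sub_zero] at this
    exact this rfl

end Nonvanishing

/-! ### Eigenforms with nonvanishing `L`-value -/

section Eigenforms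

open MeasureTheory
open scoped ComplexConjugate

/-- A linear functional that is not zero does not vanish on some joint eigenvector of a commuting
family of symmetric operators. -/
theorem exists_joint_eigenvector {V ι : Type*} [AddCommGroup V] [Module ℂ V]
    [FiniteDimensional ℂ V] (core : InnerProductSpace.Core ℂ V) {T : ι → V →ₗ[ℂ] V}
    (hT : ∀ i x y, core.inner (T i x) y = core.inner x (T i y))
    (hcomm : ∀ i j, Commute (T i) (T j)) {L : V →ₗ[ℂ] ℂ} {v : V} (hv : L v ≠ 0) :
    ∃ w, L w ≠ 0 ∧ ∀ i, ∃ c : ℂ, T i w = c • w := by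
  let _ : NormedAddCommGroup V := core.toNormedAddCommGroup
  let _ : InnerProductSpace ℂ V := InnerProductSpace.ofCore core.toCore
  have htop := LinearMap.IsSymmetric.iSup_iInf_eq_top_of_commute (T := T) (fun i x y => hT i x y)
    fun i j _ => hcomm i j
  by_contra! h
  -- The joint eigenspaces span V, so a functional vanishing on all of them would be zero.
  have hle : (⨆ χ : ι → ℂ, ⨅ i, Module.End.eigenspace (T i) (χ i)) ≤ LinearMap.ker L := by
    refine iSup_le fun χ w hw => ?_
    by_contra hLw
    obtain ⟨i, hi⟩ := h w hLw
    exact hi (χ i) (Module.End.mem_eigenspace_iff.mp ((Submodule.mem_iInf _).mp hw i))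
  rw [htop] at hle
  exact hv (hle Submodule.mem_top)

variable {k : ℤ} {ε : ℂ}

instance finiteDimensional_frickeSpace : FiniteDimensional ℂ (frickeSpace k ε) :=
  Submodule.finiteDimensional_of_le (S₂ := cuspForms k) inf_le_left

/-- The Petersson product attached to an integrable weight. -/
abbrev peterssonCore (k : ℤ) (ε : ℂ) {ψ : ℍ → ℝ} (hψ : IsWeight (CongruenceSubgroup.Gamma0 4) ψ)
    (hi : Integrable ψ volume) : InnerProductSpace.Core ℂ (frickeSpace k ε) where
  -- The arguments are exchanged because the inner product is conjugate-linear in its first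
  -- variable.
  inner f g := ∫ z, (ψ z : ℂ) * pet k (g : ℍ → ℂ) f z
  conj_inner_symm f g := by
    rw [← integral_conj]
    congr 1
    funext z
    rw [map_mul, Complex.conj_ofReal, conj_pet]
  re_inner_nonneg f := by
    have e (z : ℍ) : (ψ z : ℂ) * pet k (f : ℍ → ℂ) f z =
        ((ψ z * (‖(f : ℍ → ℂ) z‖ ^ 2 * z.im ^ ((k : ℝ) + 1 / 2)) : ℝ) : ℂ) := by
      rw [pet, Complex.mul_conj, Complex.normSq_eq_norm_sq, Complex.ofReal_mul, Complex.ofReal_mul]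
    simp only [e]
    rw [integral_complex_ofReal]
    change 0 ≤ ∫ z, _
    exact integral_nonneg fun z => mul_nonneg (hψ.nonneg z)
      (mul_nonneg (sq_nonneg _) (Real.rpow_nonneg z.im_pos.le _))
  add_left f g h := by
    have hI (f : frickeSpace k ε) := integrable_weight_mul_pet hi (continuous_of_mem h.2.1)
      (hasCuspBound_of_mem h.2.1) (continuous_of_mem f.2.1) (hasCuspBound_of_mem f.2.1)
    rw [← integral_add (hI f) (hI g)]
    congr 1
    funext z
    simp only [pet, Submodule.coe_add, Pi.add_apply, map_add]
    ring
  smul_left f g c := by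
    rw [← integral_const_mul]
    congr 1
    funext z
    simp only [pet, Submodule.coe_smul, Pi.smul_apply, smul_eq_mul, map_mul]
    ring
  definite f hf := Subtype.ext (eq_zero_of_integral_pet f.2.1 hψ hi hf)

/-- If the completed `L`-function of one form in a Fricke eigenspace does not vanish at `s`, then
the same is true for some Hecke eigenform in that space. -/
theorem exists_eigenform (hk : 0 ≤ k) (hε : ε ^ 2 = 1) {s : ℂ} {f : ℍ → ℂ}
    (hf : f ∈ frickeSpace k ε) (hL : mellin (axisFun f) s ≠ 0) :
    ∃ g ∈ frickeSpace k ε, IsHeckeEigenform k g ∧ ∃ Λ : ℂ → ℂ, IsCompletedL g Λ ∧ Λ s ≠ 0 := by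
  have hε0 : ε ≠ 0 := by rintro rfl; norm_num at hε
  obtain ⟨ψ, hψ, hi⟩ := exists_weight (CongruenceSubgroup.Gamma0 4)
  let ι := {p : ℕ // p.Prime ∧ p ≠ 2}
  have hfact (i : ι) : Fact (i : ℕ).Prime := ⟨i.2.1⟩
  let T (i : ι) : frickeSpace k ε →ₗ[ℂ] frickeSpace k ε :=
    (heckeOp k i).restrict fun g hg => heckeSum_mem i.2.2 hk hε hg
  obtain ⟨g, hg, hT⟩ := exists_joint_eigenvector (peterssonCore k ε hψ hi) (T := T)
    (fun i f g => (integral_pet_heckeSum_left i.2.2 hε g.2 f.2 hψ).symm)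
    (fun i j => LinearMap.ext fun f => Subtype.ext (heckeSum_comm i.2.2 j.2.2 hk hε f.2))
    (L := valueL hk hε0 s) (v := ⟨f, hf⟩) hL
  refine ⟨g, g.2, ⟨g.2.1, ?_, fun p hp hp2 => ?_⟩, _, isCompletedL_mellin hk hε0 g.2, hg⟩
  · intro h0
    have : g = 0 := Subtype.ext h0
    exact hg (by rw [this, map_zero])
  · have : Fact p.Prime := ⟨hp⟩
    obtain ⟨c, hc⟩ := hT ⟨p, hp, hp2⟩
    exact ⟨c, by rw [hecke_eq_heckeSum hp2 g.2.1]; exact congrArg Subtype.val hc⟩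

end Eigenforms

end HalfIntegral

end

theorem mainTheorem1 (σ : ℝ) :
    (∀ k : ℤ, 4 ≤ k →
      ∃ f ∈ HalfIntegral.plusSpace k, HalfIntegral.IsHeckeEigenform k f ∧
        ∃ Λ : ℂ → ℂ, HalfIntegral.IsCompletedL f Λ ∧ Λ (σ : ℂ) ≠ 0) ∧
    (∀ k : ℤ, 6 ≤ k → σ ≠ (k : ℝ) / 2 + 1 / 4 →
      ∃ f ∈ HalfIntegral.minusSpace k, HalfIntegral.IsHeckeEigenform k f ∧
        ∃ Λ : ℂ → ℂ, HalfIntegral.IsCompletedL f Λ ∧ Λ (σ : ℂ) ≠ 0) := by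
  refine ⟨fun k hk => ?_, fun k hk hσ => ?_⟩
  · have hk0 : 0 ≤ k := by linarith
    -- The exponent of θ₃ that makes the weight k + 1/2; it is positive exactly when k ≥ 4.
    obtain ⟨m, hm⟩ := Int.eq_ofNat_of_zero_le (show 0 ≤ 2 * k - 7 by linarith)
    have hm1 : 1 ≤ m := by omega
    have hm' : 8 + (m : ℤ) = 2 * k + 1 := by linarith
    have hmem := HalfIntegral.thetaForm_mem (j := 0) hk0 (by simpa using hm') hm1
    rw [pow_zero] at hmem
    rw [HalfIntegral.plusSpace_eq]
    exact HalfIntegral.exists_eigenform hk0 (one_pow 2) hmem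
      (HalfIntegral.mellin_thetaForm_zero_ne_zero hk0 hm' hm1 σ)
  · have hk0 : 0 ≤ k := by linarith
    -- The factor θ₄⁴ - θ₂⁴ uses four more theta factors, so the exponent of θ₃ is positive exactly
    -- when k ≥ 6.
    obtain ⟨m, hm⟩ := Int.eq_ofNat_of_zero_le (show 0 ≤ 2 * k - 11 by linarith)
    have hm1 : 1 ≤ m := by omega
    have hm' : 12 + (m : ℤ) = 2 * k + 1 := by linarith
    have hmem := HalfIntegral.thetaForm_mem (j := 1) hk0
      (show 8 + 4 * ((1 : ℕ) : ℤ) + m = 2 * k + 1 by push_cast; linarith) hm1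
    rw [pow_one] at hmem
    rw [HalfIntegral.minusSpace_eq]
    exact HalfIntegral.exists_eigenform hk0 neg_one_sq hmem
      (HalfIntegral.mellin_thetaForm_one_ne_zero hk0 hm' hm1 hσ)
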